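/- Let $k\ge 7$ be an integer, let $\tau(n)$ denote the number of positive divisors of $n$, and let $\phi$ be Euler's totient function. There exist constants $\eta>0$, $\delta>0$ and $C>0$, depending only on $k$, such that the following holds. For every odd prime $p$, with $q=p^k$, for every integer $a$ with $(a,q)=1$, and for every real number $x>q^{3/2-\eta}$, $$\Big|\sum_{\substack{1\le n\le x\\ n\equiv a \bmod q}}\tau(n)-\frac{1}{\phi(q)}\sum_{\substack{1\le n\le x\\ (n,q)=1}}\tau(n)\Big|\le C\,\frac{x^{1-\delta}}{q}.$$ -/

import Mathlib

/-! By the hyperbola method the divisor sum over a class modulo q counts pairs with mn ≡ a, mn ≤ x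
and m ≤ √x, up to a box that is counted twice. After cutting the region into boxes and expanding in
additive characters, the error is governed by incomplete sums ∑ ψ(h/m) over intervals of length at
most √x. The Weil-type bound √q log q for them only suffices for x somewhat beyond q^(3/2). To pass
below that point, √q must be beaten by a power of q for lengths about q^(3/4); this is
`exists_norm_invSum_le_rpow`.

Completion turns such a sum into an average of Kloosterman sums K(r, h) with weights of size about
q/|r|. Modulo a prime power, with h a unit, K(r, h) vanishes unless rh = l² for a unit l, and is
then a combination of ψ(2l) and ψ(-2l) with Gauss factors of size at most √q (`kloosterman_eq`).
Along r = r₁ + pv the root l becomes, through the Catalan series of √(1 - 4z), a polynomial in v of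
formal degree k - 1 whose top coefficient is p^(k-1) times a unit once p is large
(`kloosterman_progression`). Weyl differencing lowers the degree without touching that power of p,
ends with linear phases modulo p, and yields cancellation in v-intervals of length p^(2/3)
(`norm_sum_polynomial_phase_le`). Hence sums of K(r, h) over r save a power of p beyond length
p^(5/3) (`norm_sum_kloosterman_le`). The frequencies |r| < p^(5/3) are bounded termwise, which is
affordable because p^(5/3) ≤ q^(5/21) for k ≥ 7 and 5/21 < 1/4.

Frequencies divisible by p belong to the modulus p^(k-1), whose error enters divided by p
(`abs_boxError_succ_le`), so only unit frequencies need the new bound. The main term is never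
evaluated: it suffices that one number M serves every reduced class, since averaging over the
classes then replaces M by the stated mean. -/

/-! ### Additive characters modulo n and geometric sums -/

theorem norm_stdAddChar {n : ℕ} [NeZero n] (y : ZMod n) : ‖ZMod.stdAddChar y‖ = 1 := by
  rw [ZMod.stdAddChar_apply]; exact Circle.norm_coe _

theorem conj_stdAddChar {n : ℕ} [NeZero n] (y : ZMod n) :
    (starRingEnd ℂ) (ZMod.stdAddChar y) = ZMod.stdAddChar (-y) := by
  rw [ZMod.stdAddChar_apply, ZMod.stdAddChar_apply, ← Circle.coe_inv_eq_conj, AddChar.map_neg_eq_inv]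

/-- The chord |e(θ) - 1| is 2|sin πθ|, and Jordan's inequality applies because the least absolute
residue gives |θ| ≤ 1/2. -/
theorem norm_stdAddChar_sub_one {n : ℕ} [NeZero n] (y : ZMod n) :
    4 * |(y.valMinAbs : ℝ)| / n ≤ ‖ZMod.stdAddChar y - 1‖ := by
  have hn : (0 : ℝ) < n := by exact_mod_cast Nat.pos_of_ne_zero (NeZero.ne n)
  conv_rhs => rw [← ZMod.coe_valMinAbs y]
  rw [ZMod.stdAddChar_coe]
  set j := y.valMinAbs with hj
  have h1 : (2 * (Real.pi : ℂ) * Complex.I * (j : ℂ) / (n : ℂ)) =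
      Complex.I * ((2 * Real.pi * j / n : ℝ) : ℂ) := by push_cast; ring
  rw [h1, Complex.norm_exp_I_mul_ofReal_sub_one, norm_mul, Real.norm_eq_abs, Real.norm_eq_abs, abs_two]
  have hle : |(j : ℝ)| / n ≤ 1 / 2 := by
    have := ZMod.natAbs_valMinAbs_le y
    rw [div_le_iff₀ hn]
    have h2 : ((y.valMinAbs.natAbs : ℕ) : ℝ) ≤ n / 2 := by
      have : ((y.valMinAbs.natAbs : ℕ) : ℝ) ≤ ((n / 2 : ℕ) : ℝ) := by exact_mod_cast this
      exact this.trans Nat.cast_div_le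
    rw [Nat.cast_natAbs, Int.cast_abs] at h2
    linarith
  have h0 : 0 ≤ |(j : ℝ)| / n := by positivity
  have hs : |Real.sin (2 * Real.pi * j / n / 2)| = Real.sin (Real.pi * (|(j : ℝ)| / n)) := by
    have : 2 * Real.pi * j / n / 2 = Real.pi * (j / n) := by ring
    rw [this]
    have h3 : 0 ≤ Real.sin (Real.pi * (|(j : ℝ)| / n)) := by
      apply Real.sin_nonneg_of_nonneg_of_le_pi
      · positivity
      · nlinarith [Real.pi_pos]
    rcases abs_cases (j : ℝ) with ⟨h, -⟩ | ⟨h, -⟩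
    · rw [h] at h3 ⊢; exact abs_of_nonneg h3
    · rw [h] at h3 ⊢
      rw [neg_div, mul_neg, Real.sin_neg] at h3 ⊢
      rw [abs_of_nonpos (by linarith)]
  rw [hs]
  have := Real.mul_le_sin (x := Real.pi * (|(j : ℝ)| / n)) (by positivity)
    (by nlinarith [Real.pi_pos])
  have h4 : 2 / Real.pi * (Real.pi * (|(j : ℝ)| / n)) = 2 * (|(j : ℝ)| / n) := by
    field_simp
  rw [h4] at this
  calc 4 * |(j : ℝ)| / n = 2 * (2 * (|(j : ℝ)| / n)) := by ring
    _ ≤ _ := by linarith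

theorem abs_valMinAbs_pos {n : ℕ} {y : ZMod n} (hy : y ≠ 0) : 0 < |(y.valMinAbs : ℝ)| := by
  simpa using hy

theorem stdAddChar_ne_one {n : ℕ} [NeZero n] {y : ZMod n} (hy : y ≠ 0) :
    ZMod.stdAddChar y ≠ 1 := by
  intro h
  apply hy
  apply ZMod.injective_stdAddChar
  rw [h, AddChar.map_zero_eq_one]

theorem norm_geom_stdAddChar_le {n : ℕ} [NeZero n] {y : ZMod n} (hy : y ≠ 0) (N : ℕ) :
    ‖∑ v ∈ Finset.range N, ZMod.stdAddChar ((v : ZMod n) * y)‖ ≤ n / (2 * |(y.valMinAbs : ℝ)|) := by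
  have hn : (0 : ℝ) < n := by exact_mod_cast Nat.pos_of_ne_zero (NeZero.ne n)
  have hj := abs_valMinAbs_pos hy
  have h1 : ∀ v : ℕ, ZMod.stdAddChar ((v : ZMod n) * y) = (ZMod.stdAddChar y) ^ v := by
    intro v; rw [← nsmul_eq_mul, AddChar.map_nsmul_eq_pow]
  simp_rw [h1]
  rw [geom_sum_eq (stdAddChar_ne_one hy), norm_div]
  have h2 : ‖ZMod.stdAddChar y ^ N - 1‖ ≤ 2 := by
    refine (norm_sub_le _ _).trans ?_
    rw [norm_pow, norm_stdAddChar]; norm_num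
  have h3 := norm_stdAddChar_sub_one y
  rw [div_le_div_iff₀ (lt_of_lt_of_le (by positivity) h3) (by positivity)]
  rw [div_le_iff₀ hn] at h3
  nlinarith

theorem one_div_abs_valMinAbs_le {n : ℕ} [NeZero n] {v : ℕ} (h0 : 0 < v) (hv : v < n) :
    1 / |(((v : ZMod n).valMinAbs : ℤ) : ℝ)| ≤ 1 / v + 1 / ((n : ℝ) - v) := by
  have h1 : (0 : ℝ) < v := by exact_mod_cast h0
  have h2 : (0 : ℝ) < (n : ℝ) - v := by rw [sub_pos]; exact_mod_cast hv
  rcases le_or_gt v (n / 2) with h | h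
  · rw [ZMod.valMinAbs_natCast_of_le_half h]
    simp only [Int.cast_natCast, Nat.abs_cast]
    have : 0 ≤ 1 / ((n : ℝ) - v) := by positivity
    linarith
  · rw [ZMod.valMinAbs_natCast_of_half_lt h hv]
    have : |(((v : ℤ) - n : ℤ) : ℝ)| = n - v := by
      push_cast; rw [abs_sub_comm, abs_of_pos h2]
    rw [this]
    have : 0 ≤ 1 / (v : ℝ) := by positivity
    linarith

theorem sum_one_div_le_one_add_log (n : ℕ) :
    ∑ i ∈ Finset.range n, 1 / ((i : ℝ) + 1) ≤ 1 + Real.log n := by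
  have := harmonic_le_one_add_log n
  simpa [harmonic] using this

theorem ZMod.sum_eq_sum_range {M : Type*} [AddCommMonoid M] {n : ℕ} [NeZero n] (f : ZMod n → M) :
    ∑ y, f y = ∑ v ∈ Finset.range n, f v := by
  symm
  refine Finset.sum_bij (fun (v : ℕ) _ => (v : ZMod n)) ?_ ?_ ?_ ?_
  · simp
  · intro a ha b hb h
    rw [Finset.mem_range] at ha hb
    have := congrArg ZMod.val h
    rwa [ZMod.val_cast_of_lt ha, ZMod.val_cast_of_lt hb] at this
  · intro y _
    exact ⟨y.val, Finset.mem_range.2 (ZMod.val_lt y), by simp⟩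
  · simp

theorem sum_div_valMinAbs_le {n : ℕ} [NeZero n] :
    ∑ y ∈ (Finset.univ : Finset (ZMod n)).erase 0, (n : ℝ) / (2 * |(y.valMinAbs : ℝ)|) ≤
      n * (1 + Real.log n) := by
  have hn0 : 0 < n := Nat.pos_of_ne_zero (NeZero.ne n)
  have hn : (0 : ℝ) < n := by exact_mod_cast hn0
  -- The term y = 0 is a division by zero, hence 0, and may be put back.
  have h1 : ∑ y ∈ (Finset.univ : Finset (ZMod n)).erase 0, (n : ℝ) / (2 * |(y.valMinAbs : ℝ)|) =
      ∑ y : ZMod n, (n : ℝ) / (2 * |(y.valMinAbs : ℝ)|) := by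
    apply Finset.sum_erase; simp
  rw [h1, ZMod.sum_eq_sum_range]
  obtain ⟨m, rfl⟩ : ∃ m, n = m + 1 := ⟨n - 1, by omega⟩
  rw [Finset.sum_range_succ']
  simp only [Nat.cast_zero, ZMod.valMinAbs_zero, Int.cast_zero, abs_zero, mul_zero, div_zero, add_zero]
  have h2 : ∀ i ∈ Finset.range m, ((m + 1 : ℕ) : ℝ) / (2 * |((((i + 1 : ℕ) : ZMod (m + 1)).valMinAbs : ℤ) : ℝ)|)
      ≤ ((m + 1 : ℕ) : ℝ) / 2 * (1 / ((i : ℝ) + 1) + 1 / (((m - 1 - i : ℕ) : ℝ) + 1)) := by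
    intro i hi
    rw [Finset.mem_range] at hi
    have := one_div_abs_valMinAbs_le (n := m + 1) (v := i + 1) (by omega) (by omega)
    rw [← div_div, div_eq_mul_one_div (_ / 2)]
    apply mul_le_mul_of_nonneg_left _ (by positivity)
    refine this.trans (le_of_eq ?_)
    congr 2
    · push_cast; ring
    · have : ((m - 1 - i : ℕ) : ℝ) = m - 1 - i := by
        rw [Nat.cast_sub (by omega), Nat.cast_sub (by omega)]; simp
      rw [this]; push_cast; ring
  refine (Finset.sum_le_sum h2).trans ?_
  rw [← Finset.mul_sum, Finset.sum_add_distrib, Finset.sum_range_reflect (fun i => 1 / ((i : ℝ) + 1)) m]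
  have h3 := sum_one_div_le_one_add_log m
  have h4 : Real.log m ≤ Real.log ((m + 1 : ℕ) : ℝ) := by
    rcases Nat.eq_zero_or_pos m with rfl | hm
    · simp
    · apply Real.log_le_log (by exact_mod_cast hm); push_cast; linarith
  nlinarith

/-! ### Weyl differencing for polynomial phases -/

/-- Weyl–van der Corput identity: the diagonal is split off and the off-diagonal terms are grouped
by their difference. The index `h` encodes the difference h + 1. -/
theorem norm_sum_range_sq (g : ℕ → ℂ) (N : ℕ) :
    ‖∑ v ∈ Finset.range N, g v‖ ^ 2 = ∑ v ∈ Finset.range N, ‖g v‖ ^ 2 +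
      2 * (∑ h ∈ Finset.range N, ∑ v ∈ Finset.range (N - (h + 1)),
        g (v + (h + 1)) * (starRingEnd ℂ) (g v)).re := by
  induction N with
  | zero => simp
  | succ N ih =>
    have h1 : ∑ h ∈ Finset.range (N + 1), ∑ v ∈ Finset.range (N + 1 - (h + 1)),
        g (v + (h + 1)) * (starRingEnd ℂ) (g v) =
        (∑ h ∈ Finset.range N, ∑ v ∈ Finset.range (N - (h + 1)),
        g (v + (h + 1)) * (starRingEnd ℂ) (g v)) +
        g N * (starRingEnd ℂ) (∑ v ∈ Finset.range N, g v) := by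
      rw [Finset.sum_range_succ, map_sum, Finset.mul_sum,
      ← Finset.sum_range_reflect (fun v => g N * (starRingEnd ℂ) (g v)) N]
      simp only [Nat.sub_self, Finset.range_zero, Finset.sum_empty, add_zero]
      rw [← Finset.sum_add_distrib]
      apply Finset.sum_congr rfl
      intro h hh
      rw [Finset.mem_range] at hh
      have e1 : N + 1 - (h + 1) = (N - (h + 1)) + 1 := by omega
      rw [e1, Finset.sum_range_succ]
      have e2 : N - (h + 1) = N - 1 - h := by omega
      have e3 : N - 1 - h + (h + 1) = N := by omega
      rw [e2, e3]
    rw [Finset.sum_range_succ, h1, Finset.sum_range_succ, Complex.sq_norm, Complex.normSq_add,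
      ← Complex.sq_norm, ← Complex.sq_norm, ih, Complex.add_re]
    have : (g N * (starRingEnd ℂ) (∑ v ∈ Finset.range N, g v)).re =
        ((∑ v ∈ Finset.range N, g v) * (starRingEnd ℂ) (g N)).re := by
      simp [Complex.mul_re]; ring
    rw [this]; ring

theorem norm_sum_range_sq_le (g : ℕ → ℂ) (hg : ∀ v, ‖g v‖ = 1) (N : ℕ) :
    ‖∑ v ∈ Finset.range N, g v‖ ^ 2 ≤ N +
      2 * ∑ h ∈ Finset.range (N - 1), ‖∑ v ∈ Finset.range (N - (h + 1)),
        g (v + (h + 1)) * (starRingEnd ℂ) (g v)‖ := by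
  rw [norm_sum_range_sq]
  simp only [hg, one_pow, Finset.sum_const, Finset.card_range, nsmul_eq_mul, mul_one]
  rcases N with _ | N
  · simp
  -- The last difference leaves an empty inner sum, so every remaining difference is smaller than
  -- the length.
  rw [Finset.sum_range_succ]
  simp only [Nat.sub_self, Finset.range_zero, Finset.sum_empty, add_zero, Nat.add_sub_cancel]
  have := (Complex.re_le_norm _).trans (norm_sum_le (Finset.range N) (fun h =>
    ∑ v ∈ Finset.range (N + 1 - (h + 1)), g (v + (h + 1)) * (starRingEnd ℂ) (g v)))
  linarith

namespace Polynomial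

variable {R : Type*} [CommRing R]

theorem natDegree_taylor_sub_self_le {P : R[X]} {d : ℕ} (hP : P.natDegree ≤ d + 1) (h : R) :
    (taylor h P - P).natDegree ≤ d := by
  rw [natDegree_le_iff_coeff_eq_zero]
  intro n hn
  rw [coeff_sub, taylor_coeff]
  have h1 : (hasseDeriv n P).natDegree < 1 := by
    have := natDegree_hasseDeriv_le P n
    omega
  rw [eval_eq_sum_range' h1]
  simp [hasseDeriv_coeff]

/-- Differencing trades one degree for a factor (d + 1)h in the top coefficient. That factor is a
unit when d + 1 and h are prime to p, so the exact power of p in the coefficient survives. -/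
theorem coeff_taylor_sub_self {P : R[X]} {d : ℕ} (hP : P.natDegree ≤ d + 1) (h : R) :
    (taylor h P - P).coeff d = (d + 1) * h * P.coeff (d + 1) := by
  rw [coeff_sub, taylor_coeff]
  have h1 : (hasseDeriv d P).natDegree < 2 := by
    have := natDegree_hasseDeriv_le P d
    omega
  rw [eval_eq_sum_range' h1]
  simp [hasseDeriv_coeff, Finset.sum_range_succ, add_comm 1 d]
  ring

end Polynomial

theorem stdAddChar_mul_intCast (a b : ℕ) [NeZero a] [NeZero b] (x : ℤ) :
    ZMod.stdAddChar ((a : ZMod (a * b)) * (x : ZMod (a * b))) = ZMod.stdAddChar (x : ZMod b) := by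
  have ha : (a : ℂ) ≠ 0 := by exact_mod_cast NeZero.ne a
  have hb : (b : ℂ) ≠ 0 := by exact_mod_cast NeZero.ne b
  have : (a : ZMod (a * b)) * (x : ZMod (a * b)) = ((a * x : ℤ) : ZMod (a * b)) := by push_cast; ring
  rw [this, ZMod.stdAddChar_coe, ZMod.stdAddChar_coe]
  congr 1
  push_cast
  field_simp

section

variable {p : ℕ} [hp : Fact p.Prime]

theorem stdAddChar_pow_mul (k : ℕ) (j : ℕ) (x : ℤ) :
    ZMod.stdAddChar ((p : ZMod (p ^ (j + k))) ^ j * (x : ZMod (p ^ (j + k)))) =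
      ZMod.stdAddChar (x : ZMod (p ^ k)) := by
  have := stdAddChar_mul_intCast (p ^ j) (p ^ k) x
  have key : ∀ (m : ℕ) [NeZero m], m = p ^ j * p ^ k →
      ZMod.stdAddChar ((p : ZMod m) ^ j * (x : ZMod m)) = ZMod.stdAddChar (x : ZMod (p ^ k)) := by
    rintro m _ rfl
    rw [← this]; push_cast; rfl
  exact key _ (pow_add _ _ _)

theorem isUnit_natCast_zmod_pow {k : ℕ} (hk : k ≠ 0) (n : ℕ) :
    IsUnit (n : ZMod (p ^ k)) ↔ ¬ p ∣ n := by
  rw [ZMod.isUnit_iff_coprime, Nat.coprime_pow_right_iff (Nat.pos_of_ne_zero hk), Nat.coprime_comm,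
    hp.out.coprime_iff_not_dvd]

/-- The factor p^k turns the phase into a character modulo p of slope 2(h + 1)c. For 0 < h + 1 < N ≤
p these slopes are nonzero and distinct, so the geometric-sum bounds add up to at most a harmonic
sum over nonzero residues. -/
theorem sum_norm_linear_phase_le {k : ℕ} (c : ZMod (p ^ (k + 1))) (hc : IsUnit c) (hp2 : p ≠ 2)
    (N : ℕ) (hN : N ≤ p) (γ : ℕ → ZMod (p ^ (k + 1))) :
    ∑ h ∈ Finset.range (N - 1), ‖∑ v ∈ Finset.range (N - (h + 1)),
      ZMod.stdAddChar ((v : ZMod (p ^ (k + 1))) *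
        (2 * ((h + 1 : ℕ) : ZMod (p ^ (k + 1))) * ((p : ZMod (p ^ (k + 1))) ^ k * c)) + γ h)‖ ≤
      p * (1 + Real.log p) := by
  have hc' : ¬ p ∣ c.val := by
    rw [← isUnit_natCast_zmod_pow (p := p) (k := k + 1) (by omega), ZMod.natCast_zmod_val]; exact hc
  let y : ℕ → ZMod p := fun h => ((2 * (h + 1) * c.val : ℕ) : ZMod p)
  have hy : ∀ h ∈ Finset.range (N - 1), y h ≠ 0 := by
    intro h hh
    rw [Finset.mem_range] at hh
    simp only [y]
    rw [Ne, ZMod.natCast_eq_zero_iff, hp.out.dvd_mul, hp.out.dvd_mul]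
    rintro ((h2 | h2) | h2)
    · exact hp2 ((Nat.prime_dvd_prime_iff_eq hp.out Nat.prime_two).1 h2)
    · exact absurd (Nat.le_of_dvd (by omega) h2) (by omega)
    · exact hc' h2
  have hinj : Set.InjOn y (Finset.range (N - 1)) := by
    intro h1 hh1 h2 hh2 h12
    simp only [Finset.coe_range, Set.mem_Iio] at hh1 hh2
    have e2 : ((2 : ℕ) : ZMod p) ≠ 0 := by
      rw [Ne, ZMod.natCast_eq_zero_iff]
      intro h2; exact hp2 ((Nat.prime_dvd_prime_iff_eq hp.out Nat.prime_two).1 h2)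
    have e3 : ((c.val : ℕ) : ZMod p) ≠ 0 := by rwa [Ne, ZMod.natCast_eq_zero_iff]
    simp only [y] at h12
    rw [Nat.cast_mul, Nat.cast_mul, Nat.cast_mul _ c.val, Nat.cast_mul 2 (h2 + 1)] at h12
    have h12 := mul_left_cancel₀ e2 (mul_right_cancel₀ e3 h12)
    have := congrArg ZMod.val h12
    rw [ZMod.val_cast_of_lt (by omega), ZMod.val_cast_of_lt (by omega)] at this
    omega
  have hterm : ∀ h ∈ Finset.range (N - 1), ‖∑ v ∈ Finset.range (N - (h + 1)),
      ZMod.stdAddChar ((v : ZMod (p ^ (k + 1))) *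
        (2 * ((h + 1 : ℕ) : ZMod (p ^ (k + 1))) * ((p : ZMod (p ^ (k + 1))) ^ k * c)) + γ h)‖ ≤
      (p : ℝ) / (2 * |((y h).valMinAbs : ℝ)|) := by
    intro h hh
    have e1 : ∀ v : ℕ, ZMod.stdAddChar ((v : ZMod (p ^ (k + 1))) *
        (2 * ((h + 1 : ℕ) : ZMod (p ^ (k + 1))) * ((p : ZMod (p ^ (k + 1))) ^ k * c)) + γ h) =
        ZMod.stdAddChar ((v : ZMod p) * y h) * ZMod.stdAddChar (γ h) := by
      intro v
      rw [AddChar.map_add_eq_mul]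
      congr 1
      have := stdAddChar_pow_mul (p := p) 1 k ((v * (2 * (h + 1) * c.val) : ℕ) : ℤ)
      have key : ∀ (m : ℕ) [NeZero m], m = p →
        ZMod.stdAddChar (((v * (2 * (h + 1) * c.val) : ℕ) : ℤ) : ZMod m) =
          ZMod.stdAddChar ((v : ZMod p) * y h) := by
        rintro m _ rfl
        simp only [y]; push_cast; rfl
      rw [key _ (pow_one p)] at this
      rw [← this]
      congr 1
      push_cast
      rw [ZMod.natCast_zmod_val]
      ring
    simp_rw [e1]
    rw [← Finset.sum_mul, norm_mul, norm_stdAddChar, mul_one]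
    exact norm_geom_stdAddChar_le (hy h hh) _
  refine (Finset.sum_le_sum hterm).trans ?_
  rw [← Finset.sum_image (s := Finset.range (N - 1)) (g := y)
    (f := fun y : ZMod p => (p : ℝ) / (2 * |(y.valMinAbs : ℝ)|)) hinj]
  refine (Finset.sum_le_sum_of_subset_of_nonneg ?_ ?_).trans (sum_div_valMinAbs_le (n := p))
  · intro z hz
    rw [Finset.mem_image] at hz
    obtain ⟨h, hh, rfl⟩ := hz
    exact Finset.mem_erase.2 ⟨hy h hh, Finset.mem_univ _⟩
  · intros; positivity

open Polynomial in
theorem differenced_phase {k : ℕ} (P : (ZMod (p ^ k))[X]) (h v : ℕ) :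
    ZMod.stdAddChar (P.eval ((v + h : ℕ) : ZMod (p ^ k))) *
      (starRingEnd ℂ) (ZMod.stdAddChar (P.eval (v : ZMod (p ^ k)))) =
    ZMod.stdAddChar ((taylor (h : ZMod (p ^ k)) P - P).eval (v : ZMod (p ^ k))) := by
  rw [conj_stdAddChar, ← AddChar.map_add_eq_mul, eval_sub, taylor_eval, Nat.cast_add, sub_eq_add_neg]

theorem one_add_log_le_rpow {x ε : ℝ} (hx : 1 ≤ x) (hε : 0 < ε) :
    1 + Real.log x ≤ (1 + 1 / ε) * x ^ ε := by
  have h1 := Real.log_le_rpow_div (by linarith : 0 ≤ x) hε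
  have h2 := Real.one_le_rpow hx hε.le
  rw [add_mul, one_mul, one_div_mul_eq_div]
  linarith

theorem rpow_two_thirds_le {N : ℕ} (hN : (N : ℝ) ≤ (p : ℝ) ^ (2 / 3 : ℝ)) : N ≤ p := by
  have h1 : (1 : ℝ) ≤ p := by exact_mod_cast hp.out.one_le
  have : (p : ℝ) ^ (2 / 3 : ℝ) ≤ (p : ℝ) ^ (1 : ℝ) :=
    Real.rpow_le_rpow_of_exponent_le h1 (by norm_num)
  rw [Real.rpow_one] at this
  exact_mod_cast hN.trans this

open Polynomial in
theorem norm_sum_quadratic_phase_le (hp2 : p ≠ 2) {k : ℕ} (P : (ZMod (p ^ (k + 1)))[X])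
    (hP : P.natDegree ≤ 2) (c : ZMod (p ^ (k + 1))) (hc : IsUnit c)
    (hPc : P.coeff 2 = (p : ZMod (p ^ (k + 1))) ^ k * c) (N : ℕ)
    (hN : (N : ℝ) ≤ (p : ℝ) ^ (2 / 3 : ℝ)) :
    ‖∑ v ∈ Finset.range N, ZMod.stdAddChar (P.eval (v : ZMod (p ^ (k + 1))))‖ ≤
      4 * (p : ℝ) ^ (2 / 3 - 1 / 12 : ℝ) := by
  have h1 : (1 : ℝ) ≤ p := by exact_mod_cast hp.out.one_le
  have hNp := rpow_two_thirds_le hN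
  have hV := norm_sum_range_sq_le (fun v => ZMod.stdAddChar (P.eval (v : ZMod (p ^ (k + 1)))))
    (fun v => norm_stdAddChar _) N
  simp_rw [differenced_phase] at hV
  have hlin : ∀ h v : ℕ, (taylor ((h + 1 : ℕ) : ZMod (p ^ (k + 1))) P - P).eval (v : ZMod (p ^ (k + 1))) =
      v * (2 * ((h + 1 : ℕ) : ZMod (p ^ (k + 1))) * ((p : ZMod (p ^ (k + 1))) ^ k * c)) +
        (taylor ((h + 1 : ℕ) : ZMod (p ^ (k + 1))) P - P).coeff 0 := by
    intro h v
    have hd := natDegree_taylor_sub_self_le hP ((h + 1 : ℕ) : ZMod (p ^ (k + 1)))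
    have hcf := coeff_taylor_sub_self hP ((h + 1 : ℕ) : ZMod (p ^ (k + 1)))
    rw [eval_eq_sum_range' (Nat.lt_succ_of_le hd), Finset.sum_range_succ, Finset.sum_range_one, hcf, hPc]
    push_cast
    ring
  simp_rw [hlin] at hV
  have hS := sum_norm_linear_phase_le c hc hp2 N hNp
    (fun h => (taylor ((h + 1 : ℕ) : ZMod (p ^ (k + 1))) P - P).coeff 0)
  -- The exponent 1/6 makes p log p ≪ p^(7/6), the square of p^(2/3 - 1/12). The total is 1 + 2·7 =
  -- 15 such terms, below 4² = 16.
  have hlog := one_add_log_le_rpow h1 (show (0 : ℝ) < 1 / 6 by norm_num)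
  have e1 : (p : ℝ) * (1 + Real.log p) ≤ 7 * (p : ℝ) ^ (7 / 6 : ℝ) := by
    have : (p : ℝ) ^ (7 / 6 : ℝ) = p * (p : ℝ) ^ (1 / 6 : ℝ) := by
      rw [show (7 / 6 : ℝ) = 1 + 1 / 6 by norm_num, Real.rpow_add (by linarith), Real.rpow_one]
    rw [this]
    nlinarith
  have e2 : (N : ℝ) ≤ (p : ℝ) ^ (7 / 6 : ℝ) :=
    hN.trans (Real.rpow_le_rpow_of_exponent_le h1 (by norm_num))
  have e3 : ((p : ℝ) ^ (2 / 3 - 1 / 12 : ℝ)) ^ 2 = (p : ℝ) ^ (7 / 6 : ℝ) := by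
    rw [← Real.rpow_natCast, ← Real.rpow_mul (by linarith)]; norm_num
  refine (sq_le_sq₀ (norm_nonneg _) (by positivity)).1 ?_
  rw [mul_pow, e3]
  have e4 : 0 ≤ (p : ℝ) ^ (7 / 6 : ℝ) := by positivity
  linarith

open Polynomial in
-- Induction on the degree d + 2 by differencing. The constants depend on the degree alone, and the
-- window p^(2/3) is longer than √p, which is what makes the quadratic base case nontrivial.
theorem norm_sum_polynomial_phase_le (d : ℕ) : ∃ C δ : ℝ, 1 ≤ C ∧ 0 < δ ∧ δ ≤ 1 / 12 ∧
    ∀ (p : ℕ) [Fact p.Prime], p ≠ 2 → d + 2 < p → ∀ (k : ℕ) (P : (ZMod (p ^ (k + 1)))[X]),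
    P.natDegree ≤ d + 2 → ∀ c : ZMod (p ^ (k + 1)), IsUnit c →
    P.coeff (d + 2) = (p : ZMod (p ^ (k + 1))) ^ k * c → ∀ N : ℕ, (N : ℝ) ≤ (p : ℝ) ^ (2 / 3 : ℝ) →
    ‖∑ v ∈ Finset.range N, ZMod.stdAddChar (P.eval (v : ZMod (p ^ (k + 1))))‖ ≤
      C * (p : ℝ) ^ (2 / 3 - δ : ℝ) := by
  induction d with
  | zero =>
    refine ⟨4, 1 / 12, by norm_num, by norm_num, le_rfl, ?_⟩
    intro p hp hp2 _ k P hP c hc hPc N hN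
    exact norm_sum_quadratic_phase_le hp2 P hP c hc hPc N hN
  | succ d ih =>
    obtain ⟨C, δ, hC, hδ, hδ', H⟩ := ih
    -- Differencing bounds |S|² by N + 2N·C p^(2/3-δ) ≤ 3C p^(4/3-δ), so the saving is halved under
    -- the square root, and 3C ≤ (3C)².
    refine ⟨3 * C, δ / 2, by linarith, by linarith, by linarith, ?_⟩
    intro p hp hp2 hdp k P hP c hc hPc N hN
    have h1 : (1 : ℝ) ≤ p := by exact_mod_cast hp.out.one_le
    have hNp := rpow_two_thirds_le hN
    have hV := norm_sum_range_sq_le (fun v => ZMod.stdAddChar (P.eval (v : ZMod (p ^ (k + 1)))))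
      (fun v => norm_stdAddChar _) N
    simp_rw [differenced_phase] at hV
    have hterm : ∀ h ∈ Finset.range (N - 1), ‖∑ v ∈ Finset.range (N - (h + 1)), ZMod.stdAddChar
        ((taylor ((h + 1 : ℕ) : ZMod (p ^ (k + 1))) P - P).eval (v : ZMod (p ^ (k + 1))))‖ ≤
        C * (p : ℝ) ^ (2 / 3 - δ : ℝ) := by
      intro h hh
      rw [Finset.mem_range] at hh
      refine H p hp2 (by omega) k _ (natDegree_taylor_sub_self_le hP _)
        (((d + 3 : ℕ) : ZMod (p ^ (k + 1))) * ((h + 1 : ℕ) : ZMod (p ^ (k + 1))) * c) ?_ ?_ _ ?_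
      · refine ((IsUnit.mul ?_ ?_).mul hc)
        · rw [isUnit_natCast_zmod_pow (by omega)]
          exact fun h => absurd (Nat.le_of_dvd (by omega) h) (by omega)
        · rw [isUnit_natCast_zmod_pow (by omega)]
          exact fun h => absurd (Nat.le_of_dvd (by omega) h) (by omega)
      · rw [coeff_taylor_sub_self hP, show d + 2 + 1 = d + 1 + 2 by ring, hPc]
        push_cast; ring
      · refine le_trans ?_ hN
        exact_mod_cast Nat.sub_le _ _
    have hS := Finset.sum_le_sum hterm
    rw [Finset.sum_const, Finset.card_range, nsmul_eq_mul] at hS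
    have hA : 1 ≤ (p : ℝ) ^ (2 / 3 - δ : ℝ) := Real.one_le_rpow h1 (by linarith)
    have hB : 0 ≤ (p : ℝ) ^ (2 / 3 : ℝ) := by positivity
    have hN' : ((N - 1 : ℕ) : ℝ) ≤ (p : ℝ) ^ (2 / 3 : ℝ) :=
      le_trans (by exact_mod_cast Nat.sub_le _ _) hN
    have e3 : ((p : ℝ) ^ (2 / 3 - δ / 2 : ℝ)) ^ 2 = (p : ℝ) ^ (2 / 3 : ℝ) * (p : ℝ) ^ (2 / 3 - δ : ℝ) := by
      rw [← Real.rpow_natCast, ← Real.rpow_mul (by linarith), ← Real.rpow_add (by linarith)]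
      congr 1; push_cast; ring
    refine (sq_le_sq₀ (norm_nonneg _) (by positivity)).1 ?_
    rw [mul_pow, e3]
    have e5 : ((N - 1 : ℕ) : ℝ) * (C * (p : ℝ) ^ (2 / 3 - δ : ℝ)) ≤
        (p : ℝ) ^ (2 / 3 : ℝ) * (C * (p : ℝ) ^ (2 / 3 - δ : ℝ)) :=
      mul_le_mul_of_nonneg_right hN' (by positivity)
    set X := (p : ℝ) ^ (2 / 3 : ℝ)
    set Y := (p : ℝ) ^ (2 / 3 - δ : ℝ)
    have e6 : (N : ℝ) ≤ X * Y * C := by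
      have : X * 1 ≤ X * (Y * C) := mul_le_mul_of_nonneg_left (by nlinarith) hB
      linarith
    have e7 : 0 ≤ X * Y := by positivity
    nlinarith [mul_nonneg e7 (by linarith : 0 ≤ C - 1)]

end

/-! ### Truncated square roots and Kloosterman sums to prime power moduli -/

open Polynomial in
-- The Catalan generating function satisfies T = 1 + XT², so (1 - 2XT)² = 1 - 4X. Truncation at K
-- terms leaves an error divisible by X^K, which is killed after the extra factor z. The
-- coefficients are integers, so no division is needed.
theorem sqrt_catalan_sq {R : Type*} [CommRing R] (K : ℕ) (z : R) (hz : z ^ (K + 1) = 0) :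
    (1 - 2 * ∑ j ∈ Finset.range K, (catalan j : R) * z ^ (j + 1)) ^ 2 = 1 - 4 * z := by
  set T : ℤ[X] := ∑ j ∈ Finset.range K, C (catalan j : ℤ) * X ^ j with hT
  have hcoeff : ∀ n < K, T.coeff n = catalan n := by
    intro n hn
    simp [hT, coeff_X_pow, hn]
  have hdvd : X ^ K ∣ T - 1 - X * T ^ 2 := by
    rw [X_pow_dvd_iff]
    intro d hd
    rw [coeff_sub, coeff_sub, hcoeff d hd]
    rcases d with _ | e
    · simp
    · rw [coeff_X_mul, pow_two, coeff_mul, catalan_succ', coeff_one, if_neg (by omega)]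
      have : ∑ x ∈ Finset.HasAntidiagonal.antidiagonal e, T.coeff x.1 * T.coeff x.2 =
          ∑ x ∈ Finset.HasAntidiagonal.antidiagonal e, (catalan x.1 : ℤ) * catalan x.2 := by
        apply Finset.sum_congr rfl
        intro x hx
        have := Finset.HasAntidiagonal.mem_antidiagonal.1 hx
        rw [hcoeff _ (by omega), hcoeff _ (by omega)]
      rw [this]; push_cast; ring
  obtain ⟨U, hU⟩ := hdvd
  have h1 := congrArg (aeval z) hU
  have hTz : aeval z T = ∑ j ∈ Finset.range K, (catalan j : R) * z ^ j := by
    simp [hT]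
  simp only [map_sub, map_mul, map_pow, map_one, aeval_X, hTz] at h1
  have h2 : ∑ j ∈ Finset.range K, (catalan j : R) * z ^ (j + 1) =
      z * ∑ j ∈ Finset.range K, (catalan j : R) * z ^ j := by
    rw [Finset.mul_sum]; apply Finset.sum_congr rfl; intros; ring
  rw [h2]
  set t := ∑ j ∈ Finset.range K, (catalan j : R) * z ^ j
  have h3 : z * (t - 1 - z * t ^ 2) = 0 := by
    rw [h1, ← mul_assoc, ← pow_succ', hz, zero_mul]
  linear_combination (-4) * h3

/-- The Kloosterman sum `∑ ψ(r x + h x⁻¹)` over the units `x` of `ZMod q`. -/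
noncomputable def kloosterman {q : ℕ} [NeZero q] (r h : ZMod q) : ℂ :=
  ∑ x : (ZMod q)ˣ, ZMod.stdAddChar (r * (x : ZMod q) + h * ((x⁻¹ : (ZMod q)ˣ) : ZMod q))

theorem kloosterman_neg_left {q : ℕ} [NeZero q] (r h : ZMod q) :
    kloosterman (-r) h = kloosterman r (-h) := by
  unfold kloosterman
  refine Fintype.sum_equiv (Equiv.neg _) _ _ ?_
  intro x
  congr 1
  simp only [Equiv.neg_apply, Units.val_neg, inv_neg]
  ring

theorem conj_kloosterman {q : ℕ} [NeZero q] (r h : ZMod q) :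
    (starRingEnd ℂ) (kloosterman r h) = kloosterman r h := by
  unfold kloosterman
  rw [map_sum]
  refine Fintype.sum_equiv (Equiv.neg _) _ _ ?_
  intro x
  rw [conj_stdAddChar]
  congr 1
  simp only [Equiv.neg_apply, Units.val_neg, inv_neg]
  ring

theorem kloosterman_mul_unit {q : ℕ} [NeZero q] (r h : ZMod q) (u : (ZMod q)ˣ) :
    kloosterman (r * (u : ZMod q)) (h * ((u⁻¹ : (ZMod q)ˣ) : ZMod q)) = kloosterman r h := by
  unfold kloosterman
  refine Fintype.sum_equiv (Equiv.mulLeft u) _ _ ?_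
  intro x
  congr 1
  simp only [Equiv.coe_mulLeft, Units.val_mul, mul_inv_rev]
  ring

section

variable {p : ℕ} [hp : Fact p.Prime] {k : ℕ}

omit hp in
theorem natCast_pow_eq_zero {n : ℕ} (h : k ≤ n) : (p : ZMod (p ^ k)) ^ n = 0 := by
  rw [← Nat.cast_pow, ZMod.natCast_eq_zero_iff]
  exact pow_dvd_pow p h

theorem exists_eq_pow_mul_natCast {s m : ℕ} (hk : s + m = k) {z : ZMod (p ^ k)}
    (hz : (p : ZMod (p ^ k)) ^ s * z = 0) :
    ∃ w < p ^ s, z = (p : ZMod (p ^ k)) ^ m * (w : ℕ) := by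
  have h1 : ((p ^ s * z.val : ℕ) : ZMod (p ^ k)) = 0 := by
    push_cast; rw [ZMod.natCast_zmod_val]; exact hz
  have h1 := (ZMod.natCast_eq_zero_iff _ _).1 h1
  have hpk : p ^ k = p ^ s * p ^ m := by rw [← hk, pow_add]
  have h1 : p ^ s * p ^ m ∣ p ^ s * z.val := by rw [← hpk]; exact h1
  obtain ⟨w, hw⟩ := Nat.dvd_of_mul_dvd_mul_left (pow_pos hp.out.pos s) h1
  refine ⟨w, ?_, ?_⟩
  · have h2 := ZMod.val_lt z
    rw [hw, mul_comm] at h2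
    exact Nat.lt_of_mul_lt_mul_right (h2.trans_eq hpk)
  · conv_lhs => rw [← ZMod.natCast_zmod_val z, hw]
    push_cast; rfl

/-- The elements of `ZMod (p ^ k)` killed by `p ^ s`. -/
def torsion (p k s : ℕ) [Fact p.Prime] : Finset (ZMod (p ^ k)) :=
  Finset.univ.filter fun z => (p : ZMod (p ^ k)) ^ s * z = 0

theorem mem_torsion {s : ℕ} {z : ZMod (p ^ k)} :
    z ∈ torsion p k s ↔ (p : ZMod (p ^ k)) ^ s * z = 0 := by
  simp [torsion]

theorem card_torsion_le {s : ℕ} (hs : s ≤ k) : (torsion p k s).card ≤ p ^ s := by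
  have : torsion p k s ⊆ (Finset.range (p ^ s)).image
      (fun w : ℕ => (p : ZMod (p ^ k)) ^ (k - s) * (w : ZMod (p ^ k))) := by
    intro z hz
    obtain ⟨w, hw, rfl⟩ := exists_eq_pow_mul_natCast (show s + (k - s) = k by omega) (mem_torsion.1 hz)
    exact Finset.mem_image.2 ⟨w, Finset.mem_range.2 hw, rfl⟩
  exact (Finset.card_le_card this).trans (Finset.card_image_le.trans (by simp))

/-- p-adic stationary phase. Replacing x by x(1 + p^s t), whose inverse factor is 1 - p^s t because
p^(2s) = 0, does not change the sum. Averaging over t keeps only the x at which p^s kills the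
derivative term rx - h/x. -/
theorem kloosterman_eq_sum_stationary {s : ℕ} (hs : k ≤ 2 * s) (r h : ZMod (p ^ k)) :
    kloosterman r h = ∑ x ∈ (Finset.univ : Finset (ZMod (p ^ k))ˣ).filter
      (fun x : (ZMod (p ^ k))ˣ => (p : ZMod (p ^ k)) ^ s * (r * (x : ZMod (p ^ k)) - h * ((x⁻¹ : (ZMod (p ^ k))ˣ) : ZMod (p ^ k))) = 0),
      ZMod.stdAddChar (r * (x : ZMod (p ^ k)) + h * ((x⁻¹ : (ZMod (p ^ k))ˣ) : ZMod (p ^ k))) := by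
  have hsq : (p : ZMod (p ^ k)) ^ s * (p : ZMod (p ^ k)) ^ s = 0 := by
    rw [← pow_add]; exact natCast_pow_eq_zero (by omega)
  have h1 : ∀ t : ZMod (p ^ k), kloosterman r h = ∑ x : (ZMod (p ^ k))ˣ,
      ZMod.stdAddChar (r * (x : ZMod (p ^ k)) + h * ((x⁻¹ : (ZMod (p ^ k))ˣ) : ZMod (p ^ k))) * ZMod.stdAddChar
        (t * ((p : ZMod (p ^ k)) ^ s * (r * (x : ZMod (p ^ k)) - h * ((x⁻¹ : (ZMod (p ^ k))ˣ) : ZMod (p ^ k))))) := by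
    intro t
    let u : (ZMod (p ^ k))ˣ := ⟨1 + (p : ZMod (p ^ k)) ^ s * t, 1 - (p : ZMod (p ^ k)) ^ s * t,
      by linear_combination (-t ^ 2) * hsq, by linear_combination (-t ^ 2) * hsq⟩
    have hu : (u : ZMod (p ^ k)) = 1 + (p : ZMod (p ^ k)) ^ s * t := rfl
    have hu' : ((u⁻¹ : (ZMod (p ^ k))ˣ) : ZMod (p ^ k)) = 1 - (p : ZMod (p ^ k)) ^ s * t := rfl
    rw [← kloosterman_mul_unit r h u]
    unfold kloosterman
    apply Finset.sum_congr rfl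
    intro x _
    rw [← AddChar.map_add_eq_mul, hu, hu']
    congr 1
    ring
  have hq : ((p ^ k : ℕ) : ℂ) ≠ 0 := by exact_mod_cast NeZero.ne (p ^ k)
  have h2 : ((p ^ k : ℕ) : ℂ) * kloosterman r h = ∑ t : ZMod (p ^ k), ∑ x : (ZMod (p ^ k))ˣ,
      ZMod.stdAddChar (r * (x : ZMod (p ^ k)) + h * ((x⁻¹ : (ZMod (p ^ k))ˣ) : ZMod (p ^ k))) * ZMod.stdAddChar
        (t * ((p : ZMod (p ^ k)) ^ s * (r * (x : ZMod (p ^ k)) - h * ((x⁻¹ : (ZMod (p ^ k))ˣ) : ZMod (p ^ k))))) := by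
    rw [← Finset.sum_congr rfl (fun t _ => h1 t)]
    simp [ZMod.card]
  rw [Finset.sum_comm] at h2
  simp_rw [← Finset.mul_sum, AddChar.sum_mulShift _ (ZMod.isPrimitive_stdAddChar (p ^ k)), ZMod.card] at h2
  apply mul_left_cancel₀ hq
  rw [h2, Finset.sum_filter, Finset.mul_sum]
  apply Finset.sum_congr rfl
  intro x _
  split_ifs <;> simp [mul_comm]

omit hp in
theorem isNilpotent_natCast_mul (w : ZMod (p ^ k)) : IsNilpotent ((p : ZMod (p ^ k)) * w) :=
  ⟨k, by rw [mul_pow, natCast_pow_eq_zero le_rfl, zero_mul]⟩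

theorem isUnit_two (hp2 : p ≠ 2) : IsUnit (2 : ZMod (p ^ k)) := by
  have := (ZMod.isUnit_iff_coprime 2 (p ^ k)).2
    (Nat.Coprime.pow_right _ ((Nat.coprime_primes Nat.prime_two hp.out).2 (Ne.symm hp2)))
  exact_mod_cast this

/-- Instead of Hensel lifting: the Catalan root at z = -pw/4, which is nilpotent. -/
theorem exists_sq_eq_one_add (hp2 : p ≠ 2) (w : ZMod (p ^ k)) :
    ∃ t : ZMod (p ^ k), t ^ 2 = 1 + p * w := by
  obtain ⟨u, hu⟩ := isUnit_two (p := p) (k := k) hp2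
  have hinv : (2 : ZMod (p ^ k)) * ((u⁻¹ : (ZMod (p ^ k))ˣ) : ZMod (p ^ k)) = 1 := by rw [← hu]; exact u.mul_inv
  refine ⟨_, (sqrt_catalan_sq k (-(p * w * ((u⁻¹ : (ZMod (p ^ k))ˣ) : ZMod (p ^ k)) ^ 2)) ?_).trans ?_⟩
  · have : -(p * w * ((u⁻¹ : (ZMod (p ^ k))ˣ) : ZMod (p ^ k)) ^ 2) =
      p * (-w * ((u⁻¹ : (ZMod (p ^ k))ˣ) : ZMod (p ^ k)) ^ 2) := by ring
    rw [this, mul_pow, natCast_pow_eq_zero (by omega), zero_mul]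
  · linear_combination (p * w * (2 * ((u⁻¹ : (ZMod (p ^ k))ˣ) : ZMod (p ^ k)) + 1)) * hinv

/-- A nonzero sum has a stationary point x, where rx - h/x = p^m w with m ≥ 1. Then rh = (h/x)²(1 +
p^m w x/h), and the second factor is a square. -/
theorem exists_unit_sq_of_kloosterman_ne_zero (hp2 : p ≠ 2) (hk : 2 ≤ k) {r h : ZMod (p ^ k)}
    (hh : IsUnit h) (hK : kloosterman r h ≠ 0) : ∃ l : (ZMod (p ^ k))ˣ, (l : ZMod (p ^ k)) ^ 2 = r * h := by
  obtain ⟨s, m, hsm, hms, hsm', hm⟩ : ∃ s m, s + m = k ∧ m ≤ s ∧ s ≤ m + 1 ∧ 1 ≤ m :=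
    ⟨k - k / 2, k / 2, by omega, by omega, by omega, by omega⟩
  rw [kloosterman_eq_sum_stationary (s := s) (by omega)] at hK
  obtain ⟨x, hx, -⟩ := Finset.exists_ne_zero_of_sum_ne_zero hK
  rw [Finset.mem_filter] at hx
  obtain ⟨w, -, hw⟩ := exists_eq_pow_mul_natCast hsm hx.2
  obtain ⟨h, rfl⟩ := hh
  obtain ⟨m, rfl⟩ : ∃ m', m = m' + 1 := ⟨m - 1, by omega⟩
  have hxx : (x : ZMod (p ^ k)) * ((x⁻¹ : (ZMod (p ^ k))ˣ) : ZMod (p ^ k)) = 1 := x.mul_inv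
  have hhh : (h : ZMod (p ^ k)) * ((h⁻¹ : (ZMod (p ^ k))ˣ) : ZMod (p ^ k)) = 1 := h.mul_inv
  obtain ⟨t, ht⟩ := exists_sq_eq_one_add hp2
    ((p : ZMod (p ^ k)) ^ m * (w : ZMod (p ^ k)) * (x : ZMod (p ^ k)) * ((h⁻¹ : (ZMod (p ^ k))ˣ) : ZMod (p ^ k)))
  have htu : IsUnit t := by
    rw [← isUnit_pow_iff (two_ne_zero), ht]
    exact (isNilpotent_natCast_mul _).isUnit_one_add
  obtain ⟨t, rfl⟩ := htu
  refine ⟨h * x⁻¹ * t, ?_⟩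
  rw [Units.val_mul, Units.val_mul, mul_pow, ht]
  linear_combination (-((x⁻¹ : (ZMod (p ^ k))ˣ) : ZMod (p ^ k)) * (h : ZMod (p ^ k))) * hw + ((p : ZMod (p ^ k)) ^ (m+1) * (w : ZMod (p ^ k)) * (h : ZMod (p ^ k)) * ((x⁻¹ : (ZMod (p ^ k))ˣ) : ZMod (p ^ k)) * ((x⁻¹ : (ZMod (p ^ k))ˣ) : ZMod (p ^ k)) * (x : ZMod (p ^ k))) * hhh
    + (r * (h : ZMod (p ^ k)) + (p : ZMod (p ^ k)) ^ (m+1) * (w : ZMod (p ^ k)) * (h : ZMod (p ^ k)) * ((x⁻¹ : (ZMod (p ^ k))ˣ) : ZMod (p ^ k))) * hxx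

/-- The quadratic sum that accompanies each stationary point of a Kloosterman sum. -/
noncomputable def stationaryGauss (p k s : ℕ) [Fact p.Prime] (b : ZMod (p ^ k)) : ℂ :=
  ∑ z ∈ torsion p k s, ZMod.stdAddChar (z ^ 2 * b)

/-- Squared as for a Gauss sum: the inner linear sum over the torsion has at most p^s terms and
vanishes unless p^m kills the difference d, which leaves at most p^m values of d. -/
theorem norm_stationaryGauss_le (hp2 : p ≠ 2) {s m : ℕ} (hsm : s + m = k)
    {b : ZMod (p ^ k)} (hb : IsUnit b) : ‖stationaryGauss p k s b‖ ≤ Real.sqrt (p ^ k) := by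
  have key : stationaryGauss p k s b * (starRingEnd ℂ) (stationaryGauss p k s b) =
      ∑ d ∈ torsion p k s, ZMod.stdAddChar (d ^ 2 * b) *
        ∑ z ∈ torsion p k s, ZMod.stdAddChar (2 * d * b * z) := by
    unfold stationaryGauss
    rw [map_sum, Finset.sum_mul_sum, Finset.sum_comm]
    simp_rw [Finset.mul_sum]
    rw [Finset.sum_comm (s := torsion p k s) (t := torsion p k s)
      (f := fun d z => ZMod.stdAddChar (d ^ 2 * b) * ZMod.stdAddChar (2 * d * b * z))]
    apply Finset.sum_congr rfl
    intro z hz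
    refine Finset.sum_bij' (fun a _ => a - z) (fun d _ => d + z) ?_ ?_ ?_ ?_ ?_
    · intro a ha
      rw [mem_torsion] at *
      rw [mul_sub, ha, hz, sub_zero]
    · intro a ha
      rw [mem_torsion] at *
      rw [mul_add, ha, hz, add_zero]
    · simp
    · simp
    · intro a ha
      rw [conj_stdAddChar, ← AddChar.map_add_eq_mul, ← AddChar.map_add_eq_mul]
      congr 1; ring
  have hinner : ∀ d : ZMod (p ^ k), ‖∑ z ∈ torsion p k s, ZMod.stdAddChar (2 * d * b * z)‖ ≤
      if d ∈ torsion p k m then (p : ℝ) ^ s else 0 := by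
    intro d
    split_ifs with hd
    · refine (norm_sum_le _ _).trans ?_
      simp only [norm_stdAddChar, Finset.sum_const, nsmul_eq_mul, mul_one]
      exact_mod_cast card_torsion_le (by omega)
    · have hne : 2 * d * b * (p : ZMod (p ^ k)) ^ m ≠ 0 := by
        intro h0
        apply hd
        rw [mem_torsion]
        have hu := (isUnit_two (p := p) (k := k) hp2).mul hb
        rw [← hu.mul_right_eq_zero]
        linear_combination h0
      obtain ⟨w, hw⟩ := AddChar.ne_one_iff.1 (ZMod.isPrimitive_stdAddChar (p ^ k) hne)
      rw [AddChar.mulShift_apply] at hw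
      -- Translation by p^m w preserves the torsion and multiplies the sum by a character value
      -- different from 1, so the sum is zero.
      have hsh : ∑ z ∈ torsion p k s, ZMod.stdAddChar (2 * d * b * z) =
          ZMod.stdAddChar (2 * d * b * (p : ZMod (p ^ k)) ^ m * w) *
            ∑ z ∈ torsion p k s, ZMod.stdAddChar (2 * d * b * z) := by
        rw [Finset.mul_sum]
        symm
        have h0 : (p : ZMod (p ^ k)) ^ s * ((p : ZMod (p ^ k)) ^ m * w) = 0 := by
          rw [← mul_assoc, ← pow_add, natCast_pow_eq_zero (by omega), zero_mul]
        refine Finset.sum_bij' (fun a _ => a + (p : ZMod (p ^ k)) ^ m * w) (fun a _ => a - (p : ZMod (p ^ k)) ^ m * w) ?_ ?_ ?_ ?_ ?_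
        · intro a ha
          rw [mem_torsion] at *
          rw [mul_add, ha, h0, zero_add]
        · intro a ha
          rw [mem_torsion] at *
          rw [mul_sub, ha, h0, zero_sub, neg_zero]
        · simp
        · simp
        · intro a ha
          rw [← AddChar.map_add_eq_mul]
          congr 1; ring
      have : (ZMod.stdAddChar (2 * d * b * (p : ZMod (p ^ k)) ^ m * w) - 1) *
          ∑ z ∈ torsion p k s, ZMod.stdAddChar (2 * d * b * z) = 0 := by
        rw [sub_mul, ← hsh, one_mul, sub_self]
      rcases mul_eq_zero.1 this with h | h
      · exact absurd (sub_eq_zero.1 h) hw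
      · rw [h, norm_zero]
  apply Real.le_sqrt_of_sq_le
  have h1 : ‖stationaryGauss p k s b‖ ^ 2 =
      ‖stationaryGauss p k s b * (starRingEnd ℂ) (stationaryGauss p k s b)‖ := by
    rw [norm_mul, RCLike.norm_conj, pow_two]
  rw [h1, key]
  refine (norm_sum_le _ _).trans ?_
  have h2 : ∀ d ∈ torsion p k s, ‖ZMod.stdAddChar (d ^ 2 * b) *
        ∑ z ∈ torsion p k s, ZMod.stdAddChar (2 * d * b * z)‖ ≤
        if d ∈ torsion p k m then (p : ℝ) ^ s else 0 := by
    intro d _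
    rw [norm_mul, norm_stdAddChar, one_mul]
    exact hinner d
  refine (Finset.sum_le_sum h2).trans ?_
  rw [← Finset.sum_filter, Finset.sum_const, nsmul_eq_mul, show (p : ℝ) ^ k = p ^ s * p ^ m by rw [← hsm, pow_add], mul_comm]
  apply mul_le_mul_of_nonneg_left _ (by positivity)
  have : ((torsion p k s).filter (fun d => d ∈ torsion p k m)).card ≤ p ^ m := by
    refine (Finset.card_le_card ?_).trans (card_torsion_le (p := p) (k := k) (s := m) (by omega))
    intro d hd; exact (Finset.mem_filter.1 hd).2
  exact_mod_cast this

/-- On the torsion z = p^m w, so p z² carries p^(2m+1) = 0. The Gauss factor thus depends on b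
modulo p only, and is constant along progressions of step p. -/
theorem stationaryGauss_congr {s m : ℕ} (hsm : s + m = k) (hm : s ≤ m + 1) {b b' : ZMod (p ^ k)}
    {t : ZMod (p ^ k)} (hb : b' = b + p * t) : stationaryGauss p k s b' = stationaryGauss p k s b := by
  unfold stationaryGauss
  apply Finset.sum_congr rfl
  intro z hz
  obtain ⟨w, -, rfl⟩ := exists_eq_pow_mul_natCast hsm (mem_torsion.1 hz)
  congr 1
  have : (p : ZMod (p ^ k)) ^ (2 * m + 1) = 0 := natCast_pow_eq_zero (by omega)
  rw [hb]
  linear_combination (w ^ 2 * t) * this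

/-- For y = l + z with z³ = 0 the expansion l²/y = l - z + z²/l is exact, and the phase becomes 2l +
z²/l. -/
theorem sum_near_stationary {s m : ℕ} (hsm : s + m = k) (hm : k ≤ 3 * m) (l : (ZMod (p ^ k))ˣ) :
    ∑ y ∈ (Finset.univ : Finset (ZMod (p ^ k))ˣ).filter
      (fun y : (ZMod (p ^ k))ˣ => (p : ZMod (p ^ k)) ^ s * ((y : ZMod (p ^ k)) - l) = 0),
      ZMod.stdAddChar ((y : ZMod (p ^ k)) + (l : ZMod (p ^ k)) ^ 2 * ((y⁻¹ : (ZMod (p ^ k))ˣ) : ZMod (p ^ k))) =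
    ZMod.stdAddChar (2 * (l : ZMod (p ^ k))) * stationaryGauss p k s ((l⁻¹ : (ZMod (p ^ k))ˣ) : ZMod (p ^ k)) := by
  have hll : (l : ZMod (p ^ k)) * ((l⁻¹ : (ZMod (p ^ k))ˣ) : ZMod (p ^ k)) = 1 := l.mul_inv
  have hcube : ∀ z ∈ torsion p k s, z ^ 3 = 0 := by
    intro z hz
    obtain ⟨w, -, rfl⟩ := exists_eq_pow_mul_natCast hsm (mem_torsion.1 hz)
    rw [mul_pow, ← pow_mul, natCast_pow_eq_zero (by omega), zero_mul]
  unfold stationaryGauss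
  rw [Finset.mul_sum]
  refine Finset.sum_bij (fun y _ => (y : ZMod (p ^ k)) - l) ?_ ?_ ?_ ?_
  · intro y hy
    rw [mem_torsion]; exact (Finset.mem_filter.1 hy).2
  · intro y _ y' _ h
    exact Units.ext (sub_left_inj.1 h)
  · intro z hz
    have h3 := hcube z hz
    set i := ((l⁻¹ : (ZMod (p ^ k))ˣ) : ZMod (p ^ k))
    have e : (l + z) * (i - z * i ^ 2 + z ^ 2 * i ^ 3) = 1 := by
      linear_combination (1 - z * i + z ^ 2 * i ^ 2) * hll + i ^ 3 * h3
    refine ⟨(⟨l + z, i - z * i ^ 2 + z ^ 2 * i ^ 3, e, by rw [mul_comm]; exact e⟩ : (ZMod (p ^ k))ˣ),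
      ?_, ?_⟩
    · rw [Finset.mem_filter]
      refine ⟨Finset.mem_univ _, ?_⟩
      rw [← mem_torsion]; simpa using hz
    · simp
  · intro y hy
    have h3 := hcube _ (mem_torsion.2 (Finset.mem_filter.1 hy).2)
    have hyy : (y : ZMod (p ^ k)) * ((y⁻¹ : (ZMod (p ^ k))ˣ) : ZMod (p ^ k)) = 1 := y.mul_inv
    rw [← AddChar.map_add_eq_mul]
    congr 1
    set i := ((l⁻¹ : (ZMod (p ^ k))ˣ) : ZMod (p ^ k))
    set j := ((y⁻¹ : (ZMod (p ^ k))ˣ) : ZMod (p ^ k))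
    have h4 : (y : ZMod (p ^ k)) * (y + l ^ 2 * j - (2 * l + (y - l) ^ 2 * i)) = 0 := by
      linear_combination l ^ 2 * hyy - (i) * h3 + ((y : ZMod (p ^ k)) - l) ^ 2 * (-hll)
    exact sub_eq_zero.1 ((Units.mul_right_eq_zero y).1 h4)

/-- After normalising to K(1, l²), stationarity says that p^s kills (y - l)(y + l). The two factors
cannot both be non-units since they add up to the unit 2y, so the stationary points lie near l or
near -l, and these two sets are disjoint. -/
theorem kloosterman_eq {s m : ℕ} (hp2 : p ≠ 2) (hsm : s + m = k) (hms : m ≤ s) (hsm' : s ≤ m + 1)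
    (hm : 1 ≤ m) {r h : ZMod (p ^ k)} (l : (ZMod (p ^ k))ˣ) (hl : (l : ZMod (p ^ k)) ^ 2 = r * h) :
    kloosterman r h =
      ZMod.stdAddChar (2 * (l : ZMod (p ^ k))) * stationaryGauss p k s ((l⁻¹ : (ZMod (p ^ k))ˣ) : ZMod (p ^ k)) +
      ZMod.stdAddChar (-(2 * (l : ZMod (p ^ k)))) *
        stationaryGauss p k s (-((l⁻¹ : (ZMod (p ^ k))ˣ) : ZMod (p ^ k))) := by
  have hru : IsUnit r := by
    have : IsUnit (r * h) := by rw [← hl]; exact l.isUnit.pow 2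
    exact isUnit_of_mul_isUnit_left this
  obtain ⟨r, rfl⟩ := hru
  have h1 : kloosterman (r : ZMod (p ^ k)) h = kloosterman 1 ((l : ZMod (p ^ k)) ^ 2) := by
    rw [← kloosterman_mul_unit 1 _ r, hl, one_mul]
    congr 1
    rw [mul_right_comm, r.mul_inv, one_mul]
  rw [h1, kloosterman_eq_sum_stationary (s := s) (by omega)]
  simp_rw [one_mul]
  have hps : (p : ZMod (p ^ k)) ^ s ≠ 0 := by
    rw [← Nat.cast_pow, Ne, ZMod.natCast_eq_zero_iff, Nat.pow_dvd_pow_iff_le_right hp.out.one_lt]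
    omega
  have hsplit : (Finset.univ : Finset (ZMod (p ^ k))ˣ).filter
      (fun x : (ZMod (p ^ k))ˣ => (p : ZMod (p ^ k)) ^ s * ((x : ZMod (p ^ k)) - l ^ 2 * ((x⁻¹ : (ZMod (p ^ k))ˣ) : ZMod (p ^ k))) = 0) =
      (Finset.univ : Finset (ZMod (p ^ k))ˣ).filter (fun y : (ZMod (p ^ k))ˣ => (p : ZMod (p ^ k)) ^ s * ((y : ZMod (p ^ k)) - l) = 0) ∪
      (Finset.univ : Finset (ZMod (p ^ k))ˣ).filter
        (fun y : (ZMod (p ^ k))ˣ => (p : ZMod (p ^ k)) ^ s * ((y : ZMod (p ^ k)) - ((-l : (ZMod (p ^ k))ˣ) : ZMod (p ^ k))) = 0) := by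
    ext y
    simp only [Finset.mem_filter, Finset.mem_univ, true_and, Finset.mem_union, Units.val_neg,
      sub_neg_eq_add]
    have hyy : (y : ZMod (p ^ k)) * ((y⁻¹ : (ZMod (p ^ k))ˣ) : ZMod (p ^ k)) = 1 := y.mul_inv
    have e : (p : ZMod (p ^ k)) ^ s * ((y : ZMod (p ^ k)) - l ^ 2 * ((y⁻¹ : (ZMod (p ^ k))ˣ) : ZMod (p ^ k))) = 0 ↔
        (p : ZMod (p ^ k)) ^ s * ((y - l) * (y + l)) = 0 := by
      rw [← Units.mul_right_eq_zero y]
      apply Eq.congr _ rfl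
      linear_combination (-(p : ZMod (p ^ k)) ^ s * l ^ 2) * hyy
    rw [e]
    constructor
    · intro h0
      by_cases hu : IsUnit ((y : ZMod (p ^ k)) + l)
      · left
        rw [← hu.mul_left_eq_zero, mul_assoc]; exact h0
      · by_cases hv : IsUnit ((y : ZMod (p ^ k)) - l)
        · right
          rw [← hv.mul_left_eq_zero, mul_assoc, mul_comm ((y : ZMod (p ^ k)) + l)]; exact h0
        · exfalso
          have hk0 : k ≠ 0 := by omega
          have nu : ∀ a : ZMod (p ^ k), ¬ IsUnit a → ∃ w, a = p * w := by
            intro a ha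
            rw [← ZMod.natCast_zmod_val a, isUnit_natCast_zmod_pow hk0, not_not] at ha
            obtain ⟨w, hw⟩ := ha
            exact ⟨w, by rw [← ZMod.natCast_zmod_val a, hw]; push_cast; rfl⟩
          obtain ⟨w, hw⟩ := nu _ hu
          obtain ⟨w', hw'⟩ := nu _ hv
          have h2y : (2 : ZMod (p ^ k)) * y = p * (w + w') := by linear_combination hw + hw'
          have := (isUnit_two (p := p) (k := k) hp2).mul y.isUnit
          rw [h2y] at this
          have hnil := isNilpotent_natCast_mul (p := p) (k := k) (w + w')
          have hnt : Nontrivial (ZMod (p ^ k)) := by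
            refine ⟨⟨_, _, hps⟩⟩
          exact hnil.not_isUnit this
    · rintro (h0 | h0)
      · rw [← mul_assoc, h0, zero_mul]
      · rw [mul_comm ((y : ZMod (p ^ k)) - l), ← mul_assoc, h0, zero_mul]
  rw [hsplit, Finset.sum_union]
  · congr 1
    · exact sum_near_stationary hsm (by omega) l
    · have := sum_near_stationary hsm (by omega) (-l)
      simp only [Units.val_neg, inv_neg, neg_sq, mul_neg] at this ⊢
      exact this
  · rw [Finset.disjoint_left]
    intro y hy hy'
    rw [Finset.mem_filter] at hy hy'
    have h2 : (p : ZMod (p ^ k)) ^ s * (2 * l) = 0 := by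
      have := hy'.2
      rw [Units.val_neg] at this
      linear_combination this - hy.2
    rw [((isUnit_two (p := p) (k := k) hp2).mul l.isUnit).mul_left_eq_zero] at h2
    exact hps h2

theorem norm_kloosterman_le (hp2 : p ≠ 2) (hk : 2 ≤ k) {r h : ZMod (p ^ k)} (hh : IsUnit h) :
    ‖kloosterman r h‖ ≤ 2 * Real.sqrt (p ^ k) := by
  by_cases hK : kloosterman r h = 0
  · rw [hK, norm_zero]; positivity
  obtain ⟨l, hl⟩ := exists_unit_sq_of_kloosterman_ne_zero hp2 hk hh hK
  obtain ⟨s, m, hsm, hms, hsm', hm⟩ : ∃ s m, s + m = k ∧ m ≤ s ∧ s ≤ m + 1 ∧ 1 ≤ m :=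
    ⟨k - k / 2, k / 2, by omega, by omega, by omega, by omega⟩
  rw [kloosterman_eq hp2 hsm hms hsm' hm l hl]
  refine (norm_add_le _ _).trans ?_
  rw [norm_mul, norm_mul, norm_stdAddChar, norm_stdAddChar, one_mul, one_mul, two_mul]
  exact add_le_add (norm_stationaryGauss_le hp2 hsm (l⁻¹).isUnit)
    (norm_stationaryGauss_le hp2 hsm (l⁻¹).isUnit.neg)

end

/-! ### Kloosterman sums along progressions of step p and over long intervals -/

theorem not_dvd_catalan {p : ℕ} (hp : p.Prime) {n : ℕ} (hn : 2 * n < p) : ¬ p ∣ catalan n := by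
  intro h
  have h1 : p ∣ n.centralBinom := by
    rw [← succ_mul_catalan_eq_centralBinom]; exact Dvd.dvd.mul_left h _
  have h2 : p ∣ (2 * n).factorial := by
    rw [← Nat.choose_mul_factorial_mul_factorial (show n ≤ 2 * n by omega)]
    exact Dvd.dvd.mul_right (Dvd.dvd.mul_right h1 _) _
  exact absurd ((hp.dvd_factorial).1 h2) (by omega)

section

open Polynomial

variable {R : Type*} [CommRing R]

/-- The polynomial whose value at a point `X` is `l` times the Catalan truncation of
`√(1 - 4(aX + c))`. -/
noncomputable def sqrtPoly (K : ℕ) (l a c : R) : R[X] :=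
  C l * (1 - 2 * ∑ j ∈ Finset.range K, C (catalan j : R) * (C a * X + C c) ^ (j + 1))

theorem eval_sqrtPoly (K : ℕ) (l a c x : R) : (sqrtPoly K l a c).eval x =
    l * (1 - 2 * ∑ j ∈ Finset.range K, (catalan j : R) * (a * x + c) ^ (j + 1)) := by
  simp [sqrtPoly, eval_finsetSum]

theorem natDegree_linear_pow_le (a c : R) (n : ℕ) : ((C a * X + C c) ^ n).natDegree ≤ n := by
  have := natDegree_pow_le_of_le n (natDegree_linear_le (a := a) (b := c))
  simpa using this

theorem natDegree_sqrtPoly_le (K : ℕ) (l a c : R) : (sqrtPoly K l a c).natDegree ≤ K := by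
  unfold sqrtPoly
  refine ((natDegree_C_mul_le _ _).trans (natDegree_sub_le _ _)).trans (max_le (by simp) ?_)
  rw [show (2 : R[X]) = C 2 from (map_ofNat C 2).symm]
  refine (natDegree_C_mul_le _ _).trans (natDegree_sum_le_of_forall_le _ _ ?_)
  intro j hj
  rw [Finset.mem_range] at hj
  exact (natDegree_C_mul_le _ _).trans ((natDegree_linear_pow_le a c _).trans (by omega))

/-- Only the last power reaches degree K + 1. With a = pβ and modulus p^(K+2) this is p^(K+1) times
a unit, provided p does not divide the Catalan number: exactly the shape required by the
differencing bound. -/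
theorem coeff_sqrtPoly (K : ℕ) (l a c : R) :
    (sqrtPoly (K + 1) l a c).coeff (K + 1) = -2 * l * catalan K * a ^ (K + 1) := by
  unfold sqrtPoly
  rw [show (2 : R[X]) = C 2 from (map_ofNat C 2).symm, coeff_C_mul, coeff_sub, coeff_C_mul, Finset.sum_range_succ,
    coeff_add, coeff_C_mul, coeff_one, if_neg (by omega), finsetSum_coeff]
  have h1 : ∑ j ∈ Finset.range K, (C (catalan j : R) * (C a * X + C c) ^ (j + 1)).coeff (K + 1) = 0 := by
    apply Finset.sum_eq_zero
    intro j hj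
    rw [Finset.mem_range] at hj
    apply coeff_eq_zero_of_natDegree_lt
    exact lt_of_le_of_lt ((natDegree_C_mul_le _ _).trans (natDegree_linear_pow_le a c _)) (by omega)
  have h2 : ((C a * X + C c) ^ (K + 1)).coeff (K + 1) = a ^ (K + 1) := by
    have := coeff_pow_of_natDegree_le (m := K + 1) (natDegree_linear_le (a := a) (b := c))
    simpa using this
  rw [h1, h2]; ring

end

theorem norm_sum_window_le {f : ℕ → ℂ} {V : ℕ} (hV : 0 < V) {W : ℝ} (hW : 0 ≤ W)
    (h : ∀ a N, N ≤ V → ‖∑ v ∈ Finset.range N, f (a + v)‖ ≤ W) (N : ℕ) :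
    ∀ a, ‖∑ v ∈ Finset.range N, f (a + v)‖ ≤ ((N : ℝ) / V + 1) * W := by
  induction N using Nat.strong_induction_on with
  | _ N ih =>
    intro a
    have hV' : (0 : ℝ) < V := by exact_mod_cast hV
    rcases le_or_gt N V with hN | hN
    · refine (h a N hN).trans ?_
      have : 0 ≤ (N : ℝ) / V := by positivity
      nlinarith
    · obtain ⟨M, rfl⟩ : ∃ M, N = V + M := ⟨N - V, by omega⟩
      rw [Finset.sum_range_add]
      have h1 := ih M (by omega) (a + V)
      simp_rw [← add_assoc]
      refine (norm_add_le _ _).trans ((add_le_add (h a V le_rfl) h1).trans (le_of_eq ?_))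
      push_cast
      field_simp
      ring

theorem sum_range_mul_eq {M : Type*} [AddCommMonoid M] (f : ℕ → M) (p n : ℕ) :
    ∑ i ∈ Finset.range (p * n), f i = ∑ u ∈ Finset.range p, ∑ v ∈ Finset.range n, f (u + p * v) := by
  induction n with
  | zero => simp
  | succ n ih =>
    rw [Nat.mul_succ, Finset.sum_range_add, ih, ← Finset.sum_add_distrib]
    apply Finset.sum_congr rfl
    intro u _
    rw [Finset.sum_range_succ, add_comm (p * n) u]

open Polynomial in
/-- Square-root parametrisation of Kloosterman sums along a progression of step `p`. -/
theorem kloosterman_progression {p : ℕ} [hp : Fact p.Prime] (hp2 : p ≠ 2) (d : ℕ)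
    (h : ZMod (p ^ (d + 3))) (hh : IsUnit h) (r1 : ZMod (p ^ (d + 3))) (v0 : ℕ)
    (hK : kloosterman (q := p ^ (d + 3)) (r1 + p * v0) h ≠ 0) :
    ∃ (l β c : ZMod (p ^ (d + 3))) (G G' : ℂ), IsUnit l ∧ IsUnit β ∧ ‖G‖ ≤ Real.sqrt (p ^ (d + 3)) ∧
      ‖G'‖ ≤ Real.sqrt (p ^ (d + 3)) ∧ ∀ v : ℕ, kloosterman (q := p ^ (d + 3)) (r1 + p * v) h =
        ZMod.stdAddChar (2 * (sqrtPoly (d + 2) l (p * β) c).eval (v : ZMod (p ^ (d + 3)))) * G +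
        ZMod.stdAddChar (-(2 * (sqrtPoly (d + 2) l (p * β) c).eval (v : ZMod (p ^ (d + 3))))) * G' := by
  obtain ⟨l, hl⟩ := exists_unit_sq_of_kloosterman_ne_zero hp2 (by omega) hh hK
  obtain ⟨s, m, hsm, hms, hsm', hm⟩ : ∃ s m, s + m = d + 3 ∧ m ≤ s ∧ s ≤ m + 1 ∧ 1 ≤ m :=
    ⟨(d + 3) - (d + 3) / 2, (d + 3) / 2, by omega, by omega, by omega, by omega⟩
  have hr0 : IsUnit (r1 + p * v0) := by
    have : IsUnit ((r1 + p * v0) * h) := by rw [← hl]; exact l.isUnit.pow 2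
    exact isUnit_of_mul_isUnit_left this
  obtain ⟨r0, hr0⟩ := hr0
  obtain ⟨t, ht⟩ := isUnit_two (p := p) (k := d + 3) hp2
  set ti := ((t⁻¹ : (ZMod (p ^ (d + 3)))ˣ) : ZMod (p ^ (d + 3))) with hti
  set ri := ((r0⁻¹ : (ZMod (p ^ (d + 3)))ˣ) : ZMod (p ^ (d + 3))) with hri
  have htt : 2 * ti = 1 := by rw [← ht]; exact t.mul_inv
  have hrr : (r0 : ZMod (p ^ (d + 3))) * ri = 1 := r0.mul_inv
  -- β = -1/(4r₀) makes 1 - 4pβ(v - v₀) = (r₁ + pv)/r₀, where r₀ = r₁ + pv₀; multiplying its root by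
  -- l gives a root of (r₁ + pv)h.
  set β : ZMod (p ^ (d + 3)) := -(ti ^ 2 * ri) with hβ
  refine ⟨l, β, -(p * β * v0), stationaryGauss p (d + 3) s (l⁻¹ : (ZMod (p ^ (d + 3)))ˣ),
    stationaryGauss p (d + 3) s (-(l⁻¹ : (ZMod (p ^ (d + 3)))ˣ)), l.isUnit, ?_, ?_, ?_, ?_⟩
  · exact (((t⁻¹).isUnit.pow 2).mul (r0⁻¹).isUnit).neg
  · exact_mod_cast norm_stationaryGauss_le hp2 hsm (l⁻¹).isUnit
  · exact_mod_cast norm_stationaryGauss_le hp2 hsm (l⁻¹).isUnit.neg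
  intro v
  set L := (sqrtPoly (d + 2) (l : ZMod (p ^ (d + 3))) (p * β) (-(p * β * v0))).eval (v : ZMod (p ^ (d + 3)))
    with hL
  -- The argument is a multiple of p, so its power d + 3 vanishes and d + 2 Catalan terms suffice.
  have hz : (p * β * v + -(p * β * v0)) ^ (d + 2 + 1) = (0 : ZMod (p ^ (d + 3))) := by
    have : p * β * v + -(p * β * v0) = (p : ZMod (p ^ (d + 3))) * (β * (v - v0)) := by ring
    rw [this, mul_pow, natCast_pow_eq_zero (by omega), zero_mul]
  have hLsq : L ^ 2 = (r1 + p * v) * h := by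
    rw [hL, eval_sqrtPoly, mul_pow, sqrt_catalan_sq _ _ hz, hl, hβ, ← hr0]
    linear_combination (h * p * (v - v0) * (2 * ti + 1) * r0 * ri) * htt +
      (h * p * (v - v0)) * hrr + h * hr0
  -- L ≡ l modulo p, so the Gauss factors at L and at l agree and do not depend on v.
  have hLmod : ∃ w, L = l + p * w := by
    refine ⟨-(2 * l * ∑ j ∈ Finset.range (d + 2), (catalan j : ZMod (p ^ (d + 3))) * (β * (v - v0)) *
      (p * β * v + -(p * β * v0)) ^ j), ?_⟩
    rw [hL, eval_sqrtPoly]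
    have : ∑ j ∈ Finset.range (d + 2), (catalan j : ZMod (p ^ (d + 3))) *
        (p * β * v + -(p * β * v0)) ^ (j + 1) = p * ∑ j ∈ Finset.range (d + 2),
        (catalan j : ZMod (p ^ (d + 3))) * (β * (v - v0)) * (p * β * v + -(p * β * v0)) ^ j := by
      rw [Finset.mul_sum]; apply Finset.sum_congr rfl; intros; ring
    rw [this]; ring
  obtain ⟨w, hw⟩ := hLmod
  have hLu : IsUnit L := by
    rw [hw, show (l : ZMod (p ^ (d + 3))) + p * w =
      l * (1 + p * (w * ((l⁻¹ : (ZMod (p ^ (d + 3)))ˣ) : ZMod (p ^ (d + 3))))) by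
        have : (l : ZMod (p ^ (d + 3))) * ((l⁻¹ : (ZMod (p ^ (d + 3)))ˣ) : ZMod (p ^ (d + 3))) = 1 := l.mul_inv
        linear_combination (-(p : ZMod (p ^ (d + 3))) * w) * this]
    exact l.isUnit.mul (isNilpotent_natCast_mul _).isUnit_one_add
  obtain ⟨u, hu⟩ := hLu
  rw [kloosterman_eq hp2 hsm hms hsm' hm u (by rw [hu]; exact hLsq), hu]
  have h1 : (l : ZMod (p ^ (d + 3))) * ((l⁻¹ : (ZMod (p ^ (d + 3)))ˣ) : ZMod (p ^ (d + 3))) = 1 := l.mul_inv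
  have h2 : (u : ZMod (p ^ (d + 3))) * ((u⁻¹ : (ZMod (p ^ (d + 3)))ˣ) : ZMod (p ^ (d + 3))) = 1 := u.mul_inv
  rw [hu, hw] at h2
  set li := ((l⁻¹ : (ZMod (p ^ (d + 3)))ˣ) : ZMod (p ^ (d + 3)))
  set ui := ((u⁻¹ : (ZMod (p ^ (d + 3)))ˣ) : ZMod (p ^ (d + 3)))
  have h3 : ui = li + p * (-(w * ui * li)) := by linear_combination (-ui) * h1 + li * h2
  congr 2
  · exact stationaryGauss_congr hsm hsm' h3
  · exact stationaryGauss_congr hsm hsm' (t := w * ui * li) (by linear_combination -h3)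

open Polynomial in
-- Either every Kloosterman sum on the progression vanishes, or one nonzero value provides the
-- square-root phases ±2L(v) for all v. The twist by b is linear, so it leaves the coefficient of
-- degree d + 2 ≥ 2 unchanged.
theorem norm_sum_kloosterman_progression_le {d : ℕ} {C δ : ℝ} (hC : 1 ≤ C)
    {p : ℕ} [hp : Fact p.Prime] (hp2 : p ≠ 2) (hdp : 2 * (d + 3) < p)
    (H : ∀ P : (ZMod (p ^ (d + 3)))[X], P.natDegree ≤ d + 2 → ∀ c : ZMod (p ^ (d + 3)), IsUnit c →
      P.coeff (d + 2) = (p : ZMod (p ^ (d + 3))) ^ (d + 2) * c → ∀ N : ℕ, (N : ℝ) ≤ (p : ℝ) ^ (2 / 3 : ℝ) →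
      ‖∑ v ∈ Finset.range N, ZMod.stdAddChar (P.eval (v : ZMod (p ^ (d + 3))))‖ ≤
      C * (p : ℝ) ^ (2 / 3 - δ : ℝ))
    {h : ZMod (p ^ (d + 3))} (hh : IsUnit h) (b r1 : ZMod (p ^ (d + 3))) (N : ℕ)
    (hN : (N : ℝ) ≤ (p : ℝ) ^ (2 / 3 : ℝ)) :
    ‖∑ v ∈ Finset.range N, ZMod.stdAddChar (b * (v : ZMod (p ^ (d + 3)))) * kloosterman (q := p ^ (d + 3)) (r1 + p * v) h‖ ≤
      2 * Real.sqrt (p ^ (d + 3)) * (C * (p : ℝ) ^ (2 / 3 - δ : ℝ)) := by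
  by_cases hK : ∀ v0 : ℕ, kloosterman (q := p ^ (d + 3)) (r1 + p * v0) h = 0
  · simp only [hK, mul_zero, Finset.sum_const_zero, norm_zero]
    positivity
  push Not at hK
  obtain ⟨v0, hK⟩ := hK
  obtain ⟨l, β, c, G, G', hl, hβ, hG, hG', hKv⟩ := kloosterman_progression hp2 d h hh r1 v0 hK
  have hphase : ∀ ε : ZMod (p ^ (d + 3)), IsUnit ε →
      ‖∑ v ∈ Finset.range N, ZMod.stdAddChar (b * (v : ZMod (p ^ (d + 3))) +
        ε * (2 * (sqrtPoly (d + 2) l (p * β) c).eval (v : ZMod (p ^ (d + 3)))))‖ ≤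
      C * (p : ℝ) ^ (2 / 3 - δ : ℝ) := by
    intro ε hε
    have h2 := isUnit_two (p := p) (k := d + 3) hp2
    have hcat : IsUnit ((catalan (d + 1) : ℕ) : ZMod (p ^ (d + 3))) := by
      rw [isUnit_natCast_zmod_pow (by omega)]
      exact not_dvd_catalan hp.out (by omega)
    have := H (Polynomial.C b * X + Polynomial.C (ε * 2) * sqrtPoly (d + 2) l (p * β) c) ?_
      (ε * 2 * (-2 * l * catalan (d + 1) * β ^ (d + 2))) ?_ ?_ N hN
    · refine le_trans (le_of_eq ?_) this
      congr 1
      apply Finset.sum_congr rfl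
      intro v _
      congr 1
      simp only [eval_add, eval_mul, eval_C, eval_X]
      ring
    · refine natDegree_add_le_of_degree_le ((natDegree_C_mul_le _ _).trans (natDegree_X_le.trans (by omega))) ?_
      exact (natDegree_C_mul_le _ _).trans (natDegree_sqrtPoly_le _ _ _ _)
    · exact (hε.mul h2).mul (((h2.neg.mul hl).mul hcat).mul (hβ.pow _))
    · rw [coeff_add, coeff_C_mul, coeff_C_mul, coeff_X, if_neg (by omega), coeff_sqrtPoly]
      ring
  have hsum : ∑ v ∈ Finset.range N, ZMod.stdAddChar (b * (v : ZMod (p ^ (d + 3)))) * kloosterman (q := p ^ (d + 3)) (r1 + p * v) h =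
      (∑ v ∈ Finset.range N, ZMod.stdAddChar (b * (v : ZMod (p ^ (d + 3))) +
        1 * (2 * (sqrtPoly (d + 2) l (p * β) c).eval (v : ZMod (p ^ (d + 3)))))) * G +
      (∑ v ∈ Finset.range N, ZMod.stdAddChar (b * (v : ZMod (p ^ (d + 3))) +
        (-1) * (2 * (sqrtPoly (d + 2) l (p * β) c).eval (v : ZMod (p ^ (d + 3)))))) * G' := by
    rw [Finset.sum_mul, Finset.sum_mul, ← Finset.sum_add_distrib]
    apply Finset.sum_congr rfl
    intro v _
    rw [hKv, AddChar.map_add_eq_mul, AddChar.map_add_eq_mul, one_mul, neg_one_mul]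
    ring
  rw [hsum]
  refine (norm_add_le _ _).trans ?_
  rw [norm_mul, norm_mul]
  have e1 := mul_le_mul (hphase 1 isUnit_one) hG (norm_nonneg _) (by positivity)
  have e2 := mul_le_mul (hphase (-1) isUnit_one.neg) hG' (norm_nonneg _) (by positivity)
  linarith

/-- Sums of `ψ(b i) K(r + i, h)` over long intervals save a power of `p`. -/
theorem norm_sum_kloosterman_le (d : ℕ) : ∃ C δ : ℝ, 1 ≤ C ∧ 0 < δ ∧ δ ≤ 1 / 12 ∧
    ∀ (p : ℕ) [Fact p.Prime], p ≠ 2 → 2 * (d + 3) < p →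
    ∀ h : ZMod (p ^ (d + 3)), IsUnit h → ∀ (b r1 : ZMod (p ^ (d + 3))) (n : ℕ),
    ‖∑ i ∈ Finset.range n, ZMod.stdAddChar (b * (i : ZMod (p ^ (d + 3)))) * kloosterman (q := p ^ (d + 3)) (r1 + i) h‖ ≤
      C * Real.sqrt (p ^ (d + 3)) * (p : ℝ) ^ (-δ) * (n + (p : ℝ) ^ (5 / 3 : ℝ)) := by
  obtain ⟨C, δ, hC, hδ, hδ', H⟩ := norm_sum_polynomial_phase_le d
  refine ⟨6 * C, δ, by linarith, hδ, hδ', ?_⟩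
  intro p hp hp2 hdp h hh b r1 n
  have hp1 : (1 : ℝ) ≤ p := by exact_mod_cast hp.out.one_le
  have hp0 : (0 : ℝ) < p := by linarith
  set V := ⌊(p : ℝ) ^ (2 / 3 : ℝ)⌋₊ with hV
  have hX1 : 1 ≤ (p : ℝ) ^ (2 / 3 : ℝ) := Real.one_le_rpow hp1 (by norm_num)
  have hVpos : 0 < V := Nat.floor_pos.2 hX1
  have hVle : (V : ℝ) ≤ (p : ℝ) ^ (2 / 3 : ℝ) := Nat.floor_le (by positivity)
  have hVge : (p : ℝ) ^ (2 / 3 : ℝ) ≤ 2 * V := by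
    have h1 := Nat.lt_floor_add_one ((p : ℝ) ^ (2 / 3 : ℝ))
    have h2 : (1 : ℝ) ≤ V := by exact_mod_cast hVpos
    rw [← hV] at h1
    linarith
  set W := 2 * Real.sqrt (p ^ (d + 3)) * (C * (p : ℝ) ^ (2 / 3 - δ : ℝ)) with hW
  have hW0 : 0 ≤ W := by positivity
  -- Each residue class modulo p is a progression of step p in i, cut into windows of length V ≈
  -- p^(2/3); p classes with windows of this length explain the threshold p^(5/3).
  have hclass : ∀ u M : ℕ, ‖∑ v ∈ Finset.range M, ZMod.stdAddChar (b * ((u + p * v : ℕ) : ZMod (p ^ (d + 3)))) *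
      kloosterman (q := p ^ (d + 3)) (r1 + ((u + p * v : ℕ) : ZMod (p ^ (d + 3)))) h‖ ≤ ((M : ℝ) / V + 1) * W := by
    intro u M
    have := norm_sum_window_le (f := fun v => ZMod.stdAddChar (b * ((u + p * v : ℕ) : ZMod (p ^ (d + 3)))) *
      kloosterman (q := p ^ (d + 3)) (r1 + ((u + p * v : ℕ) : ZMod (p ^ (d + 3)))) h) hVpos hW0 ?_ M 0
    · simpa only [zero_add] using this
    · intro a N hN
      have h1 := norm_sum_kloosterman_progression_le hC hp2 hdp
        (fun P h1 c h2 h3 N h4 => H p hp2 (by omega) (d + 2) P h1 c h2 h3 N h4) hh (b * (p : ZMod (p ^ (d + 3))))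
        (r1 + ((u + p * a : ℕ) : ZMod (p ^ (d + 3)))) N
        (le_trans (by exact_mod_cast hN) hVle)
      refine le_trans (le_of_eq ?_) h1
      have e : ∀ v : ℕ, ZMod.stdAddChar (b * ((u + p * (a + v) : ℕ) : ZMod (p ^ (d + 3)))) *
          kloosterman (q := p ^ (d + 3)) (r1 + ((u + p * (a + v) : ℕ) : ZMod (p ^ (d + 3)))) h =
          ZMod.stdAddChar (b * ((u + p * a : ℕ) : ZMod (p ^ (d + 3)))) *
          (ZMod.stdAddChar (b * (p : ZMod (p ^ (d + 3))) * (v : ZMod (p ^ (d + 3)))) *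
          kloosterman (q := p ^ (d + 3)) (r1 + ((u + p * a : ℕ) : ZMod (p ^ (d + 3))) + p * v) h) := by
        intro v
        rw [← mul_assoc, ← AddChar.map_add_eq_mul]
        congr 2
        · push_cast; ring
        · push_cast; ring
      simp_rw [e]
      rw [← Finset.mul_sum, norm_mul, norm_stdAddChar, one_mul]
  set g : ℕ → ℂ := fun i => ZMod.stdAddChar (b * (i : ZMod (p ^ (d + 3)))) * kloosterman (q := p ^ (d + 3)) (r1 + i) h with hg
  have hn : n = p * (n / p) + n % p := (Nat.div_add_mod n p).symm
  have hsplit : ∑ i ∈ Finset.range n, g i = ∑ u ∈ Finset.range p, ∑ v ∈ Finset.range (n / p), g (u + p * v) +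
      ∑ i ∈ Finset.range (n % p), g (p * (n / p) + i) := by
    conv_lhs => rw [hn]
    rw [Finset.sum_range_add, sum_range_mul_eq]
  rw [hsplit]
  have b1 : ‖∑ u ∈ Finset.range p, ∑ v ∈ Finset.range (n / p), g (u + p * v)‖ ≤
      p * ((((n / p : ℕ) : ℝ) / V + 1) * W) := by
    refine (norm_sum_le _ _).trans ((Finset.sum_le_sum (fun u _ => hclass u (n / p))).trans ?_)
    rw [Finset.sum_const, Finset.card_range, nsmul_eq_mul]
  -- Fewer than p terms remain. The square-root bound gives 2p√q for them, absorbed because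
  -- p^(2/3-δ) ≥ 1.
  have b2 : ‖∑ i ∈ Finset.range (n % p), g (p * (n / p) + i)‖ ≤ p * (2 * Real.sqrt (p ^ (d + 3))) := by
    refine (norm_sum_le _ _).trans ?_
    have : ∀ i ∈ Finset.range (n % p), ‖g (p * (n / p) + i)‖ ≤ 2 * Real.sqrt (p ^ (d + 3)) := by
      intro i _
      rw [hg, norm_mul, norm_stdAddChar, one_mul]
      exact norm_kloosterman_le hp2 (by omega) hh
    refine (Finset.sum_le_sum this).trans ?_
    rw [Finset.sum_const, Finset.card_range, nsmul_eq_mul]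
    apply mul_le_mul_of_nonneg_right _ (by positivity)
    exact_mod_cast (Nat.mod_lt _ hp.out.pos).le
  refine (norm_add_le _ _).trans ((add_le_add b1 b2).trans ?_)
  set Q := Real.sqrt (p ^ (d + 3)) with hQ
  have hQ0 : 0 ≤ Q := Real.sqrt_nonneg _
  set D := (p : ℝ) ^ (-δ) with hD
  have hD0 : 0 < D := by positivity
  set X := (p : ℝ) ^ (2 / 3 : ℝ) with hX
  have eW : W = 2 * Q * (C * (X * D)) := by
    rw [hW, show (2 / 3 - δ : ℝ) = 2 / 3 + -δ by ring, Real.rpow_add hp0]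
  have e53 : (p : ℝ) ^ (5 / 3 : ℝ) = p * X := by
    rw [show (5 / 3 : ℝ) = 1 + 2 / 3 by norm_num, Real.rpow_add hp0, Real.rpow_one]
  have hXD : 1 ≤ X * D := by
    rw [hX, hD, ← Real.rpow_add hp0]; exact Real.one_le_rpow hp1 (by linarith)
  have hM : (p : ℝ) * ((n / p : ℕ) : ℝ) ≤ n := by
    exact_mod_cast Nat.mul_div_le n p
  have hV' : (0 : ℝ) < V := by exact_mod_cast hVpos
  have t1 : (p : ℝ) * (((n / p : ℕ) : ℝ) / V + 1) * X ≤ 2 * n + p * X := by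
    have : (p : ℝ) * (((n / p : ℕ) : ℝ) / V) * X ≤ 2 * n := by
      rw [← mul_div_assoc, div_mul_eq_mul_div, div_le_iff₀ hV']
      have hn0 : (0 : ℝ) ≤ n := by positivity
      nlinarith
    nlinarith
  rw [e53, eW]
  have t2 : p * ((((n / p : ℕ) : ℝ) / V + 1) * (2 * Q * (C * (X * D)))) ≤ 2 * Q * C * D * (2 * n + p * X) := by
    have := mul_le_mul_of_nonneg_left t1 (show 0 ≤ 2 * Q * C * D by positivity)
    linarith
  have t3 : p * (2 * Q) ≤ 2 * Q * C * D * (p * X) := by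
    have : 1 ≤ C * (X * D) := by nlinarith
    have := mul_le_mul_of_nonneg_left this (show 0 ≤ p * (2 * Q) by positivity)
    linarith
  have t4 : 0 ≤ Q * C * D * (p * X) := by positivity
  have t5 : 0 ≤ Q * C * D * n := by positivity
  linarith

/-! ### Incomplete sums over inverses -/

/-- The exponential sum `∑ ψ(h m⁻¹)` over the `m ∈ [m₁, m₂)` prime to `q`. -/
noncomputable def invSum {q : ℕ} [NeZero q] (m₁ m₂ : ℕ) (h : ZMod q) : ℂ :=
  ∑ m ∈ (Finset.Ico m₁ m₂).filter (fun m : ℕ => IsUnit (m : ZMod q)),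
    ZMod.stdAddChar (h * (m : ZMod q)⁻¹)

/-- The exponential sum `∑ ψ(r m)` over `m ∈ [m₁, m₂)`. -/
noncomputable def linSum {q : ℕ} [NeZero q] (m₁ m₂ : ℕ) (r : ZMod q) : ℂ :=
  ∑ m ∈ Finset.Ico m₁ m₂, ZMod.stdAddChar (r * (m : ZMod q))

section

variable {q : ℕ} [NeZero q]

theorem norm_invSum_le (m₁ m₂ : ℕ) (h : ZMod q) : ‖invSum m₁ m₂ h‖ ≤ ((m₂ - m₁ : ℕ) : ℝ) := by
  unfold invSum
  refine (norm_sum_le _ _).trans ?_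
  simp only [norm_stdAddChar, Finset.sum_const, nsmul_eq_mul, mul_one]
  have := Finset.card_filter_le (Finset.Ico m₁ m₂) (fun m : ℕ => IsUnit (m : ZMod q))
  rw [Nat.card_Ico] at this
  exact_mod_cast this

theorem norm_linSum_le (m₁ m₂ : ℕ) (r : ZMod q) : ‖linSum m₁ m₂ r‖ ≤ ((m₂ - m₁ : ℕ) : ℝ) := by
  unfold linSum
  refine (norm_sum_le _ _).trans ?_
  simp

theorem linSum_eq (m₁ m₂ : ℕ) (r : ZMod q) : linSum m₁ m₂ r =
    ZMod.stdAddChar (r * (m₁ : ZMod q)) * ∑ v ∈ Finset.range (m₂ - m₁), ZMod.stdAddChar ((v : ZMod q) * r) := by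
  unfold linSum
  rw [Finset.sum_Ico_eq_sum_range, Finset.mul_sum]
  apply Finset.sum_congr rfl
  intro v _
  rw [← AddChar.map_add_eq_mul]
  congr 1; push_cast; ring

theorem norm_linSum_le_div (m₁ m₂ : ℕ) {r : ZMod q} (hr : r ≠ 0) :
    ‖linSum m₁ m₂ r‖ ≤ q / (2 * |(r.valMinAbs : ℝ)|) := by
  rw [linSum_eq, norm_mul, norm_stdAddChar, one_mul]
  exact norm_geom_stdAddChar_le hr _

/-- Telescoping. For r ≠ 0 it separates the smooth weight (ψ(r) - 1)⁻¹ from the characters at the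
endpoints, which are absorbed as the twist b in the long sums. -/
theorem linSum_mul_sub_one {m₁ m₂ : ℕ} (hm : m₁ ≤ m₂) (r : ZMod q) :
    linSum m₁ m₂ r * (ZMod.stdAddChar r - 1) =
      ZMod.stdAddChar (r * (m₂ : ZMod q)) - ZMod.stdAddChar (r * (m₁ : ZMod q)) := by
  unfold linSum
  rw [Finset.sum_mul, ← Finset.sum_Ico_sub (fun m : ℕ => (ZMod.stdAddChar (r * (m : ZMod q)) : ℂ)) hm]
  apply Finset.sum_congr rfl
  intro m _
  rw [mul_sub, ← AddChar.map_add_eq_mul, mul_one]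
  congr 2; push_cast; ring

theorem conj_linSum (m₁ m₂ : ℕ) (r : ZMod q) :
    (starRingEnd ℂ) (linSum m₁ m₂ r) = linSum m₁ m₂ (-r) := by
  unfold linSum
  rw [map_sum]
  apply Finset.sum_congr rfl
  intro m _
  rw [conj_stdAddChar, neg_mul]

/-- Completion of the sum over inverses. -/
theorem mul_invSum_eq (m₁ m₂ : ℕ) (h : ZMod q) :
    (q : ℂ) * invSum m₁ m₂ h = ∑ r : ZMod q, linSum m₁ m₂ r * kloosterman r (-h) := by
  have h1 : ∀ r : ZMod q, linSum m₁ m₂ r * kloosterman r (-h) = ∑ m ∈ Finset.Ico m₁ m₂, ∑ x : (ZMod q)ˣ,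
      ZMod.stdAddChar (h * ((x⁻¹ : (ZMod q)ˣ) : ZMod q)) * ZMod.stdAddChar (r * ((m : ZMod q) - (x : ZMod q))) := by
    intro r
    rw [← kloosterman_neg_left]
    unfold linSum kloosterman
    rw [Finset.sum_mul_sum]
    apply Finset.sum_congr rfl
    intro m _
    apply Finset.sum_congr rfl
    intro x _
    rw [← AddChar.map_add_eq_mul, ← AddChar.map_add_eq_mul]
    congr 1; ring
  simp_rw [h1]
  rw [Finset.sum_comm]
  unfold invSum
  rw [Finset.sum_filter, Finset.mul_sum]
  apply Finset.sum_congr rfl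
  intro m _
  rw [Finset.sum_comm]
  simp_rw [← Finset.mul_sum, AddChar.sum_mulShift _ (ZMod.isPrimitive_stdAddChar q), ZMod.card]
  split_ifs with hu
  · obtain ⟨u, hu⟩ := hu
    rw [Finset.sum_eq_single u]
    · rw [← hu, sub_self, if_pos rfl, ZMod.inv_coe_unit, mul_comm]
    · intro x _ hx
      rw [if_neg, Nat.cast_zero, mul_zero]
      rw [← hu, sub_eq_zero]
      exact fun h => hx (Units.ext h.symm)
    · simp
  · rw [mul_zero]
    symm
    apply Finset.sum_eq_zero
    intro x _
    rw [if_neg, Nat.cast_zero, mul_zero]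
    rw [sub_eq_zero]
    exact fun h => hu (h ▸ x.isUnit)

end

section

variable {p : ℕ} [hp : Fact p.Prime] {k : ℕ}

/-- A nonzero value would make 0 the square of a unit. Thus the frequency r = 0, where `linSum` has
no cancellation, drops out of the completion. -/
theorem kloosterman_zero_left (hp2 : p ≠ 2) (hk : 2 ≤ k) {h : ZMod (p ^ k)} (hh : IsUnit h) :
    kloosterman 0 h = 0 := by
  by_contra hK
  obtain ⟨l, hl⟩ := exists_unit_sq_of_kloosterman_ne_zero hp2 hk hh hK
  rw [zero_mul] at hl
  have := l.isUnit.pow 2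
  rw [hl, isUnit_zero_iff] at this
  have h1 : ((0 : ℕ) : ZMod (p ^ k)) = ((1 : ℕ) : ZMod (p ^ k)) := by push_cast; exact this
  have h2 := congrArg ZMod.val h1
  have hlt : 1 < p ^ k := Nat.one_lt_pow (by omega) hp.out.one_lt
  rw [ZMod.val_cast_of_lt (by omega), ZMod.val_cast_of_lt hlt] at h2
  omega

theorem sum_eq_sum_erase_zero (hp2 : p ≠ 2) (hk : 2 ≤ k) {h : ZMod (p ^ k)} (hh : IsUnit h)
    (m₁ m₂ : ℕ) : ∑ r : ZMod (p ^ k), linSum m₁ m₂ r * kloosterman r (-h) =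
      ∑ r ∈ (Finset.univ : Finset (ZMod (p ^ k))).erase 0, linSum m₁ m₂ r * kloosterman r (-h) := by
  symm
  apply Finset.sum_erase
  rw [kloosterman_zero_left hp2 hk hh.neg, mul_zero]

/-- The Weil-type bound for incomplete sums over inverses. -/
theorem norm_invSum_le_sqrt (hp2 : p ≠ 2) (hk : 2 ≤ k) {h : ZMod (p ^ k)} (hh : IsUnit h)
    (m₁ m₂ : ℕ) : ‖invSum m₁ m₂ h‖ ≤ 2 * Real.sqrt (p ^ k) * (1 + Real.log (p ^ k)) := by
  have hq : (0 : ℝ) < (p : ℝ) ^ k := by have := hp.out.pos; positivity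
  have h1 := congrArg norm (mul_invSum_eq m₁ m₂ h)
  rw [sum_eq_sum_erase_zero hp2 hk hh, norm_mul, Complex.norm_natCast] at h1
  have h2 : ∀ r ∈ (Finset.univ : Finset (ZMod (p ^ k))).erase 0,
      ‖linSum m₁ m₂ r * kloosterman r (-h)‖ ≤
      (((p ^ k : ℕ) : ℝ) / (2 * |(r.valMinAbs : ℝ)|)) * (2 * Real.sqrt (p ^ k)) := by
    intro r hr
    rw [norm_mul]
    exact mul_le_mul (norm_linSum_le_div _ _ (Finset.ne_of_mem_erase hr))
      (norm_kloosterman_le hp2 hk hh.neg) (norm_nonneg _) (by positivity)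
  have h3 := (norm_sum_le _ _).trans (Finset.sum_le_sum h2)
  rw [← Finset.sum_mul] at h3
  have h4 := sum_div_valMinAbs_le (n := p ^ k)
  have h5 := mul_le_mul_of_nonneg_right h4 (show 0 ≤ 2 * Real.sqrt ((p : ℝ) ^ k) by positivity)
  rw [← h1] at h3
  push_cast at h3 h5
  have h6 := h3.trans h5
  have : (p : ℝ) ^ k * ‖invSum m₁ m₂ h‖ ≤
      (p : ℝ) ^ k * (2 * Real.sqrt (p ^ k) * (1 + Real.log (p ^ k))) := by linarith
  exact le_of_mul_le_mul_left this hq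

end

theorem norm_sum_mul_le_by_parts (w c : ℕ → ℂ) (n : ℕ) :
    ‖∑ i ∈ Finset.range n, w i * c i‖ ≤ ‖w (n - 1)‖ * ‖∑ j ∈ Finset.range n, c j‖ +
      ∑ i ∈ Finset.range (n - 1), ‖w (i + 1) - w i‖ * ‖∑ j ∈ Finset.range (i + 1), c j‖ := by
  have := Finset.sum_range_by_parts w c n
  simp only [smul_eq_mul] at this
  rw [this]
  refine (norm_sub_le _ _).trans (add_le_add (norm_mul_le _ _) ((norm_sum_le _ _).trans ?_))
  exact Finset.sum_le_sum fun i _ => norm_mul_le _ _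

theorem norm_stdAddChar_one_sub_one_le {q : ℕ} [NeZero q] :
    ‖ZMod.stdAddChar (1 : ZMod q) - 1‖ ≤ 7 / q := by
  have hq : (0 : ℝ) < q := by exact_mod_cast Nat.pos_of_ne_zero (NeZero.ne q)
  have h1 := ZMod.stdAddChar_coe (N := q) 1
  rw [Int.cast_one] at h1
  rw [h1]
  have h2 : (2 * (Real.pi : ℂ) * Complex.I * ((1 : ℤ) : ℂ) / (q : ℂ)) =
      Complex.I * ((2 * Real.pi / q : ℝ) : ℂ) := by push_cast; ring
  rw [h2]
  refine Real.norm_exp_I_mul_ofReal_sub_one_le.trans ?_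
  rw [Real.norm_eq_abs, abs_of_nonneg (by positivity)]
  apply div_le_div_of_nonneg_right _ hq.le
  linarith [Real.pi_lt_d2]

theorem norm_inv_stdAddChar_sub_one_le {q : ℕ} [NeZero q] {r : ℕ} (hr : 0 < r) (hr' : r ≤ q / 2) :
    ‖(ZMod.stdAddChar (r : ZMod q) - 1)⁻¹‖ ≤ q / (4 * r) := by
  have hq : (0 : ℝ) < q := by exact_mod_cast Nat.pos_of_ne_zero (NeZero.ne q)
  have hr0 : (0 : ℝ) < r := by exact_mod_cast hr
  have h1 := norm_stdAddChar_sub_one (r : ZMod q)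
  rw [ZMod.valMinAbs_natCast_of_le_half hr'] at h1
  simp only [Int.cast_natCast, Nat.abs_cast] at h1
  rw [norm_inv, ← one_div, div_le_div_iff₀ (lt_of_lt_of_le (by positivity) h1) (by positivity)]
  rw [div_le_iff₀ hq] at h1
  linarith

/-- Partial summation against the weight `(ψ(r) - 1)⁻¹` away from its pole. -/
theorem norm_sum_weight_le {q : ℕ} [NeZero q] (c : ℕ → ℂ) {R₀ n : ℕ} (hR : 0 < R₀)
    (hn : R₀ + n ≤ q / 2 + 1) {D : ℝ} (hD : 0 ≤ D)
    (hc : ∀ j ≤ n, ‖∑ i ∈ Finset.range j, c i‖ ≤ D * (j + R₀)) :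
    ‖∑ i ∈ Finset.range n, (ZMod.stdAddChar ((R₀ + i : ℕ) : ZMod q) - 1)⁻¹ * c i‖ ≤
      q * D * (1 + Real.log q) := by
  have hq : (0 : ℝ) < q := by exact_mod_cast Nat.pos_of_ne_zero (NeZero.ne q)
  have hq1 : (1 : ℝ) ≤ q := by exact_mod_cast Nat.pos_of_ne_zero (NeZero.ne q)
  have hlogq : 0 ≤ Real.log q := Real.log_nonneg hq1
  rcases Nat.eq_zero_or_pos n with rfl | hn0
  · rw [Finset.range_zero, Finset.sum_empty, norm_zero]; positivity
  have hR' : (0 : ℝ) < R₀ := by exact_mod_cast hR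
  have hR1 : (1 : ℝ) ≤ R₀ := by exact_mod_cast hR
  refine (norm_sum_mul_le_by_parts _ _ _).trans ?_
  have b1 : ‖(ZMod.stdAddChar ((R₀ + (n - 1) : ℕ) : ZMod q) - 1)⁻¹‖ * ‖∑ j ∈ Finset.range n, c j‖ ≤
      q * D / 2 := by
    have e1 := norm_inv_stdAddChar_sub_one_le (q := q) (r := R₀ + (n - 1)) (by omega) (by omega)
    refine (mul_le_mul e1 (hc n le_rfl) (norm_nonneg _) (by positivity)).trans ?_
    have e2 : ((R₀ + (n - 1) : ℕ) : ℝ) = R₀ + n - 1 := by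
      rw [Nat.cast_add, Nat.cast_sub hn0]; push_cast; ring
    have e3 : (1 : ℝ) ≤ n := by exact_mod_cast hn0
    rw [e2, div_mul_eq_mul_div, div_le_div_iff₀ (by linarith) (by norm_num)]
    have : 0 ≤ q * D := by positivity
    nlinarith
  -- The increment of the weight is O(q/((R₀ + i)(R₀ + i + 1))). The bound for the partial sum
  -- cancels the second factor, and R₀ ≥ 1 leaves a harmonic sum.
  have b2 : ∀ i ∈ Finset.range (n - 1), ‖(ZMod.stdAddChar ((R₀ + (i + 1) : ℕ) : ZMod q) - 1)⁻¹ -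
      (ZMod.stdAddChar ((R₀ + i : ℕ) : ZMod q) - 1)⁻¹‖ * ‖∑ j ∈ Finset.range (i + 1), c j‖ ≤
      q * D / 2 * (1 / ((i : ℝ) + 1)) := by
    intro i hi
    rw [Finset.mem_range] at hi
    have n1 : ZMod.stdAddChar ((R₀ + (i + 1) : ℕ) : ZMod q) - 1 ≠ 0 := by
      have h1 := norm_stdAddChar_sub_one ((R₀ + (i + 1) : ℕ) : ZMod q)
      rw [ZMod.valMinAbs_natCast_of_le_half (by omega)] at h1
      simp only [Int.cast_natCast, Nat.abs_cast] at h1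
      intro h0
      rw [h0, norm_zero] at h1
      have : 0 < 4 * ((R₀ + (i + 1) : ℕ) : ℝ) / q := by push_cast; positivity
      linarith
    have n2 : ZMod.stdAddChar ((R₀ + i : ℕ) : ZMod q) - 1 ≠ 0 := by
      have h1 := norm_stdAddChar_sub_one ((R₀ + i : ℕ) : ZMod q)
      rw [ZMod.valMinAbs_natCast_of_le_half (by omega)] at h1
      simp only [Int.cast_natCast, Nat.abs_cast] at h1
      intro h0
      rw [h0, norm_zero] at h1
      have : 0 < 4 * ((R₀ + i : ℕ) : ℝ) / q := by push_cast; positivity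
      linarith
    have e1 := norm_inv_stdAddChar_sub_one_le (q := q) (r := R₀ + (i + 1)) (by omega) (by omega)
    have e2 := norm_inv_stdAddChar_sub_one_le (q := q) (r := R₀ + i) (by omega) (by omega)
    have e3 : ‖(ZMod.stdAddChar ((R₀ + (i + 1) : ℕ) : ZMod q) - 1)⁻¹ -
      (ZMod.stdAddChar ((R₀ + i : ℕ) : ZMod q) - 1)⁻¹‖ ≤
        7 / q * (q / (4 * ((R₀ + (i + 1) : ℕ) : ℝ))) * (q / (4 * ((R₀ + i : ℕ) : ℝ))) := by
      have : (ZMod.stdAddChar ((R₀ + (i + 1) : ℕ) : ZMod q) - 1)⁻¹ -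
          (ZMod.stdAddChar ((R₀ + i : ℕ) : ZMod q) - 1)⁻¹ =
          -(ZMod.stdAddChar ((R₀ + i : ℕ) : ZMod q) * (ZMod.stdAddChar (1 : ZMod q) - 1)) *
          (ZMod.stdAddChar ((R₀ + (i + 1) : ℕ) : ZMod q) - 1)⁻¹ *
          (ZMod.stdAddChar ((R₀ + i : ℕ) : ZMod q) - 1)⁻¹ := by
        have e4 : ZMod.stdAddChar ((R₀ + (i + 1) : ℕ) : ZMod q) =
          ZMod.stdAddChar ((R₀ + i : ℕ) : ZMod q) * ZMod.stdAddChar (1 : ZMod q) := by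
          rw [← AddChar.map_add_eq_mul]; congr 1; push_cast; ring
        rw [e4] at n1 ⊢
        field_simp
        ring
      rw [this, norm_mul, norm_mul, norm_neg, norm_mul, norm_stdAddChar, one_mul]
      exact mul_le_mul (mul_le_mul norm_stdAddChar_one_sub_one_le e1 (norm_nonneg _) (by positivity))
        e2 (norm_nonneg _) (by positivity)
    refine (mul_le_mul e3 (hc (i + 1) (by omega)) (norm_nonneg _) (by positivity)).trans ?_
    push_cast
    have hi0 : (0 : ℝ) ≤ i := by positivity
    have e5 : 7 / (q : ℝ) * (q / (4 * (R₀ + (i + 1)))) * (q / (4 * (R₀ + i))) * (D * (i + 1 + R₀)) =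
        7 / 16 * (q * D) * (1 / (R₀ + i)) := by
      have : (R₀ : ℝ) + (i + 1) ≠ 0 := by positivity
      have : (R₀ : ℝ) + i ≠ 0 := by positivity
      field_simp
      ring
    rw [e5]
    have e6 : 1 / ((R₀ : ℝ) + i) ≤ 1 / ((i : ℝ) + 1) :=
      one_div_le_one_div_of_le (by positivity) (by linarith)
    have : 0 ≤ q * D := by positivity
    exact mul_le_mul (by linarith) e6 (by positivity) (by positivity)
  refine (add_le_add b1 (Finset.sum_le_sum b2)).trans ?_
  rw [← Finset.mul_sum]
  have h3 := sum_one_div_le_one_add_log (n - 1)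
  have h4 : Real.log ((n - 1 : ℕ) : ℝ) ≤ Real.log q := by
    rcases Nat.eq_zero_or_pos (n - 1) with h | h
    · rw [h, Nat.cast_zero, Real.log_zero]; exact hlogq
    · apply Real.log_le_log (by exact_mod_cast h)
      have : n - 1 ≤ q := by omega
      exact_mod_cast this
  have : 0 ≤ q * D := by positivity
  nlinarith

theorem sum_erase_zero_eq {q H : ℕ} [NeZero q] (hq : q = 2 * H + 1) (g : ZMod q → ℂ) :
    ∑ r ∈ (Finset.univ : Finset (ZMod q)).erase 0, g r =
      ∑ i ∈ Finset.range H, g ((i + 1 : ℕ) : ZMod q) + ∑ i ∈ Finset.range H, g (-((i + 1 : ℕ) : ZMod q)) := by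
  have h1 := Finset.add_sum_erase Finset.univ g (Finset.mem_univ (0 : ZMod q))
  rw [ZMod.sum_eq_sum_range] at h1
  have h2 : ∑ v ∈ Finset.range q, g v = g 0 + (∑ i ∈ Finset.range H, g ((i + 1 : ℕ) : ZMod q) +
      ∑ i ∈ Finset.range H, g (-((i + 1 : ℕ) : ZMod q))) := by
    rw [← Finset.sum_range_reflect (fun i => g (-((i + 1 : ℕ) : ZMod q))) H]
    have : Finset.range q = Finset.range (H + H + 1) := by congr 1; omega
    rw [this, Finset.sum_range_succ', Finset.sum_range_add, add_comm, Nat.cast_zero]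
    congr 2
    apply Finset.sum_congr rfl
    intro i hi
    rw [Finset.mem_range] at hi
    congr 1
    rw [eq_neg_iff_add_eq_zero, ← Nat.cast_add, ZMod.natCast_eq_zero_iff]
    exact ⟨1, by omega⟩
  rw [h2] at h1
  exact add_left_cancel h1

/-- Frequencies below R₀ are bounded one by one through the length m₂ - m₁ and √q. Beyond R₀ partial
summation exploits the saving in the long sums. -/
theorem norm_half_sum_le {p k : ℕ} [hp : Fact p.Prime] (hp2 : p ≠ 2) (hk : 2 ≤ k)
    {h : ZMod (p ^ k)} (hh : IsUnit h) {D : ℝ} (hD : 0 ≤ D) {R₀ H : ℕ} (hR : 0 < R₀) (hH : H ≤ p ^ k / 2)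
    (hlong : ∀ (b r1 : ZMod (p ^ k)) (n : ℕ), ‖∑ i ∈ Finset.range n,
      ZMod.stdAddChar (b * (i : ZMod (p ^ k))) * kloosterman (q := p ^ k) (r1 + i) h‖ ≤ D * (n + R₀))
    {m₁ m₂ : ℕ} (hm : m₁ ≤ m₂) :
    ‖∑ i ∈ Finset.range H, linSum (q := p ^ k) m₁ m₂ ((i + 1 : ℕ) : ZMod (p ^ k)) *
      kloosterman (q := p ^ k) ((i + 1 : ℕ) : ZMod (p ^ k)) h‖ ≤
      2 * R₀ * ((m₂ - m₁ : ℕ) : ℝ) * Real.sqrt (p ^ k) +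
        2 * ((p : ℝ) ^ k * D * (1 + Real.log (p ^ k))) := by
  have hq1 : (1 : ℝ) ≤ (p : ℝ) ^ k := one_le_pow₀ (by exact_mod_cast hp.out.one_le)
  have hlogq : 0 ≤ Real.log ((p : ℝ) ^ k) := Real.log_nonneg hq1
  set g : ℕ → ℂ := fun i => linSum (q := p ^ k) m₁ m₂ ((i + 1 : ℕ) : ZMod (p ^ k)) *
      kloosterman (q := p ^ k) ((i + 1 : ℕ) : ZMod (p ^ k)) h with hg
  have hgle : ∀ i, ‖g i‖ ≤ ((m₂ - m₁ : ℕ) : ℝ) * (2 * Real.sqrt (p ^ k)) := by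
    intro i
    rw [hg, norm_mul]
    exact mul_le_mul (norm_linSum_le _ _ _) (norm_kloosterman_le hp2 hk hh) (norm_nonneg _) (by positivity)
  have hshort : ∀ M ≤ R₀, ‖∑ i ∈ Finset.range M, g i‖ ≤
      2 * R₀ * ((m₂ - m₁ : ℕ) : ℝ) * Real.sqrt (p ^ k) := by
    intro M hM
    refine (norm_sum_le _ _).trans ((Finset.sum_le_sum (fun i _ => hgle i)).trans ?_)
    rw [Finset.sum_const, Finset.card_range, nsmul_eq_mul]
    have : (M : ℝ) ≤ R₀ := by exact_mod_cast hM
    have := mul_le_mul_of_nonneg_right this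
      (show 0 ≤ ((m₂ - m₁ : ℕ) : ℝ) * (2 * Real.sqrt ((p : ℝ) ^ k)) by positivity)
    linarith
  rcases le_or_gt H (R₀ - 1) with hcase | hcase
  · refine (hshort H (by omega)).trans ?_
    have : 0 ≤ 2 * ((p : ℝ) ^ k * D * (1 + Real.log (p ^ k))) := by positivity
    linarith
  -- Index i stands for frequency i + 1, so R₀ - 1 initial terms make the tail start at frequency
  -- R₀.
  obtain ⟨n, hn⟩ : ∃ n, H = (R₀ - 1) + n := ⟨H - (R₀ - 1), by omega⟩
  rw [hn, Finset.sum_range_add]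
  refine (norm_add_le _ _).trans (add_le_add (hshort _ (by omega)) ?_)
  have htail : ∀ m : ℕ, ‖∑ i ∈ Finset.range n, (ZMod.stdAddChar ((R₀ + i : ℕ) : ZMod (p ^ k)) - 1)⁻¹ *
      (ZMod.stdAddChar (((R₀ + i : ℕ) : ZMod (p ^ k)) * (m : ZMod (p ^ k))) *
        kloosterman (q := p ^ k) ((R₀ + i : ℕ) : ZMod (p ^ k)) h)‖ ≤
      (p : ℝ) ^ k * D * (1 + Real.log (p ^ k)) := by
    intro m
    have := norm_sum_weight_le (q := p ^ k) (fun i =>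
      (ZMod.stdAddChar (((R₀ + i : ℕ) : ZMod (p ^ k)) * (m : ZMod (p ^ k))) *
        kloosterman (q := p ^ k) ((R₀ + i : ℕ) : ZMod (p ^ k)) h)) (R₀ := R₀) (n := n) hR (by omega) hD ?_
    · push_cast at this ⊢; exact this
    · intro j _
      refine le_trans (le_of_eq ?_) (hlong m (R₀ : ZMod (p ^ k)) j)
      have e : ∀ i : ℕ, ZMod.stdAddChar (((R₀ + i : ℕ) : ZMod (p ^ k)) * (m : ZMod (p ^ k))) *
        kloosterman (q := p ^ k) ((R₀ + i : ℕ) : ZMod (p ^ k)) h =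
        ZMod.stdAddChar ((R₀ : ZMod (p ^ k)) * (m : ZMod (p ^ k))) *
        (ZMod.stdAddChar ((m : ZMod (p ^ k)) * (i : ZMod (p ^ k))) *
          kloosterman (q := p ^ k) ((R₀ : ZMod (p ^ k)) + i) h) := by
        intro i
        rw [← mul_assoc, ← AddChar.map_add_eq_mul]
        congr 2
        · push_cast; ring
        · push_cast; ring
      simp_rw [e]
      rw [← Finset.mul_sum, norm_mul, norm_stdAddChar, one_mul]
  have e : ∑ x ∈ Finset.range n, g (R₀ - 1 + x) =
      ∑ i ∈ Finset.range n, (ZMod.stdAddChar ((R₀ + i : ℕ) : ZMod (p ^ k)) - 1)⁻¹ *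
      (ZMod.stdAddChar (((R₀ + i : ℕ) : ZMod (p ^ k)) * (m₂ : ZMod (p ^ k))) *
        kloosterman (q := p ^ k) ((R₀ + i : ℕ) : ZMod (p ^ k)) h) -
      ∑ i ∈ Finset.range n, (ZMod.stdAddChar ((R₀ + i : ℕ) : ZMod (p ^ k)) - 1)⁻¹ *
      (ZMod.stdAddChar (((R₀ + i : ℕ) : ZMod (p ^ k)) * (m₁ : ZMod (p ^ k))) *
        kloosterman (q := p ^ k) ((R₀ + i : ℕ) : ZMod (p ^ k)) h) := by
    rw [← Finset.sum_sub_distrib]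
    apply Finset.sum_congr rfl
    intro i hi
    rw [Finset.mem_range] at hi
    have e1 : R₀ - 1 + i + 1 = R₀ + i := by omega
    simp only [hg, e1]
    have hne : ((R₀ + i : ℕ) : ZMod (p ^ k)) ≠ 0 := by
      rw [Ne, ZMod.natCast_eq_zero_iff]
      intro hd
      have := Nat.le_of_dvd (by omega) hd
      omega
    have hne' := sub_ne_zero.2 (stdAddChar_ne_one hne)
    have := linSum_mul_sub_one (q := p ^ k) hm ((R₀ + i : ℕ) : ZMod (p ^ k))
    rw [← eq_div_iff hne'] at this
    rw [this]
    field_simp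
  rw [e]
  refine (norm_sub_le _ _).trans ?_
  linarith [htail m₁, htail m₂]

/-- The negative frequencies for -h form the conjugate of the positive ones for h, because K is real
and K(-r, -h) = K(r, h). Hence two half sums suffice. -/
theorem norm_invSum_le_of_long {p k : ℕ} [hp : Fact p.Prime] (hp2 : p ≠ 2) (hk : 2 ≤ k)
    {D : ℝ} (hD : 0 ≤ D) {R₀ : ℕ} (hR : 0 < R₀)
    (hlong : ∀ h : ZMod (p ^ k), IsUnit h → ∀ (b r1 : ZMod (p ^ k)) (n : ℕ), ‖∑ i ∈ Finset.range n,
      ZMod.stdAddChar (b * (i : ZMod (p ^ k))) * kloosterman (q := p ^ k) (r1 + i) h‖ ≤ D * (n + R₀))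
    {h : ZMod (p ^ k)} (hh : IsUnit h) {m₁ m₂ : ℕ} (hm : m₁ ≤ m₂) :
    (p : ℝ) ^ k * ‖invSum m₁ m₂ h‖ ≤
      4 * R₀ * ((m₂ - m₁ : ℕ) : ℝ) * Real.sqrt (p ^ k) +
        4 * ((p : ℝ) ^ k * D * (1 + Real.log (p ^ k))) := by
  obtain ⟨H, hH⟩ : Odd (p ^ k) := (hp.out.odd_of_ne_two hp2).pow
  have h1 := congrArg norm (mul_invSum_eq m₁ m₂ h)
  rw [sum_eq_sum_erase_zero hp2 hk hh, norm_mul, Complex.norm_natCast, sum_erase_zero_eq hH] at h1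
  have h2 := norm_half_sum_le hp2 hk hh.neg hD hR (H := H) (by omega) (hlong (-h) hh.neg) hm
  have h3 := norm_half_sum_le hp2 hk hh hD hR (H := H) (by omega) (hlong h hh) hm
  have h4 : ∑ i ∈ Finset.range H, linSum m₁ m₂ (-((i + 1 : ℕ) : ZMod (p ^ k))) *
      kloosterman (-((i + 1 : ℕ) : ZMod (p ^ k))) (-h) = (starRingEnd ℂ) (∑ i ∈ Finset.range H,
      linSum (q := p ^ k) m₁ m₂ ((i + 1 : ℕ) : ZMod (p ^ k)) *
      kloosterman (q := p ^ k) ((i + 1 : ℕ) : ZMod (p ^ k)) h) := by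
    rw [map_sum]
    apply Finset.sum_congr rfl
    intro i _
    rw [map_mul, conj_linSum, conj_kloosterman, kloosterman_neg_left, neg_neg]
  rw [h4] at h1
  have h5 := norm_add_le (∑ i ∈ Finset.range H, linSum m₁ m₂ ((i + 1 : ℕ) : ZMod (p ^ k)) *
      kloosterman ((i + 1 : ℕ) : ZMod (p ^ k)) (-h)) ((starRingEnd ℂ) (∑ i ∈ Finset.range H,
      linSum (q := p ^ k) m₁ m₂ ((i + 1 : ℕ) : ZMod (p ^ k)) *
      kloosterman (q := p ^ k) ((i + 1 : ℕ) : ZMod (p ^ k)) h))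
  rw [← h1, RCLike.norm_conj] at h5
  push_cast at h5 h2 h3
  linarith

/-- Incomplete sums over inverses of length up to `q ^ (3/4 + 1/168)` beat the square-root barrier. -/
theorem exists_norm_invSum_le_rpow (k : ℕ) (hk : 7 ≤ k) : ∃ C σ : ℝ, 1 ≤ C ∧ 0 < σ ∧ σ ≤ 1 / 168 ∧
    ∀ (p : ℕ) [Fact p.Prime], p ≠ 2 → ∀ h : ZMod (p ^ k), IsUnit h → ∀ m₁ m₂ : ℕ,
    ((m₂ - m₁ : ℕ) : ℝ) ≤ ((p : ℝ) ^ k) ^ (3 / 4 + 1 / 168 : ℝ) →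
    ‖invSum m₁ m₂ h‖ ≤ C * ((p : ℝ) ^ k) ^ (1 / 2 - σ : ℝ) := by
  obtain ⟨d, rfl⟩ : ∃ d, k = d + 3 := ⟨k - 3, by omega⟩
  obtain ⟨C, δ, hC, hδ, hδ', H⟩ := norm_sum_kloosterman_le d
  set κ : ℝ := ((d + 3 : ℕ) : ℝ) with hκ
  have hκ7 : (7 : ℝ) ≤ κ := by rw [hκ]; exact_mod_cast hk
  -- p^(-δ) = q^(-2σ): one half of the saving pays for the logarithm, the other half is kept.
  set σ : ℝ := δ / (2 * κ) with hσ
  have hσ0 : 0 < σ := by positivity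
  have hσ1 : σ ≤ 1 / 168 := by
    rw [hσ, div_le_div_iff₀ (by positivity) (by norm_num)]; nlinarith
  refine ⟨8 + 4 * C * (1 + 1 / σ) + ((2 * (d + 3) : ℕ) : ℝ) ^ (d + 3), σ, ?_, hσ0, hσ1, ?_⟩
  · have : 0 ≤ 4 * C * (1 + 1 / σ) := by positivity
    have : 0 ≤ ((2 * (d + 3) : ℕ) : ℝ) ^ (d + 3) := by positivity
    linarith
  intro p hp hp2 h hh m₁ m₂ hlen
  have hp1 : (1 : ℝ) ≤ p := by exact_mod_cast hp.out.one_le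
  have hp0 : (0 : ℝ) < p := by linarith
  set q : ℝ := (p : ℝ) ^ (d + 3) with hq
  have hq1 : 1 ≤ q := one_le_pow₀ hp1
  have hq0 : 0 < q := by linarith
  have hqp : ∀ a : ℝ, (p : ℝ) ^ a = q ^ (a / κ) := by
    intro a
    rw [hq, ← Real.rpow_natCast, ← Real.rpow_mul hp0.le, ← hκ, mul_div_cancel₀ _ (by positivity)]
  have hqσ : 1 ≤ q ^ (1 / 2 - σ : ℝ) := Real.one_le_rpow hq1 (by linarith)
  have hCpos : 0 ≤ 8 + 4 * C * (1 + 1 / σ) := by positivity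
  have hKpos : 0 ≤ ((2 * (d + 3) : ℕ) : ℝ) ^ (d + 3) := by positivity
  -- For p ≤ 2(d + 3) the modulus is bounded in terms of k, and the last summand of the constant
  -- covers the trivial bound.
  rcases le_or_gt p (2 * (d + 3)) with hsmall | hlarge
  · have e1 : q ≤ ((2 * (d + 3) : ℕ) : ℝ) ^ (d + 3) := by
      apply pow_le_pow_left₀ hp0.le; exact_mod_cast hsmall
    have e2 : q ^ (3 / 4 + 1 / 168 : ℝ) ≤ q := by
      conv_rhs => rw [← Real.rpow_one q]
      exact Real.rpow_le_rpow_of_exponent_le hq1 (by norm_num)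
    have e3 := (norm_invSum_le m₁ m₂ h).trans (hlen.trans (e2.trans e1))
    nlinarith
  rcases le_or_gt m₁ m₂ with hm | hm
  swap
  · have : Finset.Ico m₁ m₂ = ∅ := Finset.Ico_eq_empty (by omega)
    rw [invSum, this, Finset.filter_empty, Finset.sum_empty, norm_zero]
    positivity
  set R₀ := ⌈(p : ℝ) ^ (5 / 3 : ℝ)⌉₊ with hR₀
  have hX1 : 1 ≤ (p : ℝ) ^ (5 / 3 : ℝ) := Real.one_le_rpow hp1 (by norm_num)
  have hRpos : 0 < R₀ := Nat.ceil_pos.2 (by linarith)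
  have hRge : (p : ℝ) ^ (5 / 3 : ℝ) ≤ R₀ := Nat.le_ceil _
  have hRle : (R₀ : ℝ) ≤ 2 * (p : ℝ) ^ (5 / 3 : ℝ) := by
    have := Nat.ceil_lt_add_one (show 0 ≤ (p : ℝ) ^ (5 / 3 : ℝ) by positivity)
    rw [← hR₀] at this; linarith
  set D := C * Real.sqrt q * (p : ℝ) ^ (-δ) with hD
  have hD0 : 0 ≤ D := by positivity
  have key := norm_invSum_le_of_long hp2 (by omega) hD0 hRpos (fun h hh b r1 n =>
    (H p hp2 hlarge h hh b r1 n).trans (mul_le_mul_of_nonneg_left (by linarith) hD0)) hh hm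
  rw [← hq] at key
  have hsq : Real.sqrt q = q ^ (1 / 2 : ℝ) := Real.sqrt_eq_rpow q
  have t1 : 4 * R₀ * ((m₂ - m₁ : ℕ) : ℝ) * Real.sqrt q ≤ q * (8 * q ^ (1 / 2 - σ : ℝ)) := by
    have e1 : (R₀ : ℝ) * ((m₂ - m₁ : ℕ) : ℝ) ≤ 2 * (p : ℝ) ^ (5 / 3 : ℝ) * q ^ (3 / 4 + 1 / 168 : ℝ) :=
      mul_le_mul hRle hlen (by positivity) (by positivity)
    have e2 : (p : ℝ) ^ (5 / 3 : ℝ) * q ^ (3 / 4 + 1 / 168 : ℝ) * Real.sqrt q ≤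
        q * q ^ (1 / 2 - σ : ℝ) := by
      rw [hqp, hsq, ← Real.rpow_add hq0, ← Real.rpow_add hq0]
      have : q * q ^ (1 / 2 - σ : ℝ) = q ^ (1 + (1 / 2 - σ) : ℝ) := by
        rw [Real.rpow_add hq0, Real.rpow_one]
      rw [this]
      apply Real.rpow_le_rpow_of_exponent_le hq1
      -- Here k ≥ 7 is decisive: 5/21 + 3/4 + 1/168 = 1 - 1/168, which leaves room for σ.
      have : 5 / 3 / κ ≤ 5 / 21 := by
        rw [div_le_div_iff₀ (by positivity) (by norm_num)]; nlinarith
      linarith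
    have hs0 : 0 ≤ Real.sqrt q := Real.sqrt_nonneg _
    have e3 := mul_le_mul_of_nonneg_right e1 hs0
    linarith
  have t2 : D * (1 + Real.log q) ≤ C * (1 + 1 / σ) * q ^ (1 / 2 - σ : ℝ) := by
    have e1 := one_add_log_le_rpow hq1 hσ0
    have e2 : D = C * q ^ (1 / 2 - 2 * σ : ℝ) := by
      rw [hD, hsq, hqp, mul_assoc, ← Real.rpow_add hq0]
      congr 2
      rw [hσ]; field_simp; ring
    have e3 : q ^ (1 / 2 - σ : ℝ) = q ^ (1 / 2 - 2 * σ : ℝ) * q ^ σ := by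
      rw [← Real.rpow_add hq0]; congr 1; ring
    rw [e2, e3]
    have := mul_le_mul_of_nonneg_left e1 (show 0 ≤ C * q ^ (1 / 2 - 2 * σ : ℝ) by positivity)
    linarith
  have t3 : q * ‖invSum m₁ m₂ h‖ ≤ q * ((8 + 4 * C * (1 + 1 / σ)) * q ^ (1 / 2 - σ : ℝ)) := by
    have := mul_le_mul_of_nonneg_left t2 hq0.le
    linarith
  have t4 := le_of_mul_le_mul_left t3 hq0
  have : 0 ≤ ((2 * (d + 3) : ℕ) : ℝ) ^ (d + 3) * q ^ (1 / 2 - σ : ℝ) := by positivity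
  linarith

/-! ### Solutions of mn ≡ a in boxes -/

theorem abs_card_filter_modEq_sub_le {M : ℕ} (hM : 0 < M) {n₁ n₂ : ℕ} (hn : n₁ ≤ n₂) (v : ℕ) :
    |(((Finset.Ico n₁ n₂).filter (fun n => n ≡ v [MOD M])).card : ℝ) - ((n₂ - n₁ : ℕ) : ℝ) / M| ≤ 1 := by
  have hM0 : (0 : ℚ) < M := by exact_mod_cast hM
  have h := Nat.Ico_filter_modEq_card n₁ n₂ hM v
  have hle : ((n₁ : ℚ) - v) / M ≤ ((n₂ : ℚ) - v) / M := by
    apply div_le_div_of_nonneg_right _ hM0.le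
    have : (n₁ : ℚ) ≤ n₂ := by exact_mod_cast hn
    linarith
  have h0 : 0 ≤ ⌈((n₂ : ℚ) - v) / M⌉ - ⌈((n₁ : ℚ) - v) / M⌉ := sub_nonneg.2 (Int.ceil_mono hle)
  rw [max_eq_left h0] at h
  have hq : |(((Finset.Ico n₁ n₂).filter (fun n => n ≡ v [MOD M])).card : ℚ) - ((n₂ - n₁ : ℕ) : ℚ) / M| ≤ 1 := by
    have h' : (((Finset.Ico n₁ n₂).filter (fun n => n ≡ v [MOD M])).card : ℚ) =
        ⌈((n₂ : ℚ) - v) / M⌉ - ⌈((n₁ : ℚ) - v) / M⌉ := by exact_mod_cast h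
    rw [h', Nat.cast_sub hn]
    have e : ((n₂ : ℚ) - n₁) / M = ((n₂ : ℚ) - v) / M - ((n₁ : ℚ) - v) / M := by ring
    rw [e, abs_le]
    have a1 := Int.le_ceil (((n₂ : ℚ) - v) / M)
    have a2 := Int.ceil_lt_add_one (((n₂ : ℚ) - v) / M)
    have a3 := Int.le_ceil (((n₁ : ℚ) - v) / M)
    have a4 := Int.ceil_lt_add_one (((n₁ : ℚ) - v) / M)
    constructor <;> linarith
  have hr := (Rat.cast_le (K := ℝ)).2 hq
  push_cast at hr
  exact hr

/-- The number of `(m, n) ∈ [m₁, m₂) × [n₁, n₂)` with `m n ≡ a` modulo `M`. -/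
noncomputable def boxCount (M : ℕ) (a : ℤ) (m₁ m₂ n₁ n₂ : ℕ) : ℝ :=
  ∑ m ∈ Finset.Ico m₁ m₂, ∑ n ∈ Finset.Ico n₁ n₂, if ((m : ZMod M) * (n : ZMod M) = (a : ZMod M)) then 1 else 0

/-- The deviation of `boxCount` from its expected value. -/
noncomputable def boxError (p k : ℕ) (a : ℤ) (m₁ m₂ n₁ n₂ : ℕ) : ℝ :=
  boxCount (p ^ k) a m₁ m₂ n₁ n₂ -
    (((Finset.Ico m₁ m₂).filter (fun m => ¬ p ∣ m)).card : ℝ) * ((n₂ - n₁ : ℕ) : ℝ) / (p : ℝ) ^ k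

section

variable {p : ℕ} [hp : Fact p.Prime]

omit hp in
theorem isUnit_intCast_zmod_pow {a : ℤ} (ha : IsCoprime a (p : ℤ)) (k : ℕ) :
    IsUnit (a : ZMod (p ^ k)) := by
  have h := (ha.pow_right (n := k)).map (Int.castRingHom (ZMod (p ^ k)))
  have h0 : (Int.castRingHom (ZMod (p ^ k))) ((p : ℤ) ^ k) = 0 := by
    have := ZMod.natCast_self (p ^ k)
    push_cast at this
    simpa using this
  rw [h0, isCoprime_zero_right] at h
  simpa using h

theorem sum_ite_eq_zero_of_dvd {k : ℕ} (hk : k ≠ 0) {a : ℤ} (ha : IsCoprime a (p : ℤ)) {m : ℕ}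
    (hm : p ∣ m) (s : Finset ℕ) :
    ∑ n ∈ s, (if ((m : ZMod (p ^ k)) * (n : ZMod (p ^ k)) = (a : ZMod (p ^ k))) then (1 : ℝ) else 0) = 0 := by
  apply Finset.sum_eq_zero
  intro n _
  rw [if_neg]
  intro h
  have hu := isUnit_intCast_zmod_pow ha k
  rw [← h] at hu
  have := isUnit_of_mul_isUnit_left hu
  rw [isUnit_natCast_zmod_pow hk] at this
  exact this hm

theorem boxCount_eq_sum_filter {k : ℕ} (hk : k ≠ 0) {a : ℤ} (ha : IsCoprime a (p : ℤ)) (m₁ m₂ n₁ n₂ : ℕ) :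
    boxCount (p ^ k) a m₁ m₂ n₁ n₂ = ∑ m ∈ (Finset.Ico m₁ m₂).filter (fun m => ¬ p ∣ m),
      ∑ n ∈ Finset.Ico n₁ n₂,
        if ((m : ZMod (p ^ k)) * (n : ZMod (p ^ k)) = (a : ZMod (p ^ k))) then (1 : ℝ) else 0 := by
  unfold boxCount
  rw [Finset.sum_filter]
  apply Finset.sum_congr rfl
  intro m _
  split_ifs with h
  · exact sum_ite_eq_zero_of_dvd hk ha h _
  · rfl

/-- Each m prime to p confines n to a single class modulo p^k, at the cost of an error of at most 1.
This serves as the base of the induction on the modulus and for the smallest m on the hyperbola. -/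
theorem abs_boxError_le_length {k : ℕ} (hk : k ≠ 0) {a : ℤ} (ha : IsCoprime a (p : ℤ))
    (m₁ m₂ : ℕ) {n₁ n₂ : ℕ} (hn : n₁ ≤ n₂) :
    |boxError p k a m₁ m₂ n₁ n₂| ≤ ((m₂ - m₁ : ℕ) : ℝ) := by
  unfold boxError
  rw [boxCount_eq_sum_filter hk ha]
  have e : (((Finset.Ico m₁ m₂).filter (fun m => ¬ p ∣ m)).card : ℝ) * ((n₂ - n₁ : ℕ) : ℝ) / (p : ℝ) ^ k =
      ∑ m ∈ (Finset.Ico m₁ m₂).filter (fun m => ¬ p ∣ m), ((n₂ - n₁ : ℕ) : ℝ) / (p : ℝ) ^ k := by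
    rw [Finset.sum_const, nsmul_eq_mul, mul_div_assoc]
  rw [e, ← Finset.sum_sub_distrib]
  refine (Finset.abs_sum_le_sum_abs _ _).trans ?_
  have h1 : ∀ m ∈ (Finset.Ico m₁ m₂).filter (fun m => ¬ p ∣ m), |(∑ n ∈ Finset.Ico n₁ n₂,
        if ((m : ZMod (p ^ k)) * (n : ZMod (p ^ k)) = (a : ZMod (p ^ k))) then (1 : ℝ) else 0) -
        ((n₂ - n₁ : ℕ) : ℝ) / (p : ℝ) ^ k| ≤ 1 := by
    intro m hm
    have hu : IsUnit (m : ZMod (p ^ k)) := (isUnit_natCast_zmod_pow hk m).2 (Finset.mem_filter.1 hm).2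
    obtain ⟨u, hu⟩ := hu
    have := abs_card_filter_modEq_sub_le (M := p ^ k) (pow_pos hp.out.pos k) hn
      (((u⁻¹ : (ZMod (p ^ k))ˣ) : ZMod (p ^ k)) * (a : ZMod (p ^ k))).val
    rw [← Finset.sum_boole] at this
    push_cast at this
    refine le_trans (le_of_eq ?_) this
    congr 2
    apply Finset.sum_congr rfl
    intro n _
    congr 1
    rw [← ZMod.natCast_eq_natCast_iff, ZMod.natCast_zmod_val, ← hu, eq_iff_iff]
    rw [← Units.inv_mul_eq_iff_eq_mul, eq_comm]
    simp only [inv_inv]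
    rw [eq_comm]
  refine (Finset.sum_le_sum h1).trans ?_
  rw [Finset.sum_const, nsmul_eq_mul, mul_one]
  have := Finset.card_filter_le (Finset.Ico m₁ m₂) (fun m => ¬ p ∣ m)
  rw [Nat.card_Ico] at this
  exact_mod_cast this

theorem sum_nonunit_eq (k : ℕ) (F : ZMod (p ^ (k + 1)) → ℂ) :
    ∑ h : ZMod (p ^ (k + 1)), F h = ∑ h : (ZMod (p ^ (k + 1)))ˣ, F h +
      ∑ v ∈ Finset.range (p ^ k), F ((p * v : ℕ) : ZMod (p ^ (k + 1))) := by
  classical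
  have h1 : ∑ h : ZMod (p ^ (k + 1)), F h = ∑ h : ZMod (p ^ (k + 1)), (if IsUnit h then F h else 0) +
      ∑ h : ZMod (p ^ (k + 1)), (if IsUnit h then 0 else F h) := by
    rw [← Finset.sum_add_distrib]
    apply Finset.sum_congr rfl
    intro h _
    split_ifs <;> simp
  rw [h1]
  congr 1
  · rw [← Finset.sum_filter]
    symm
    refine Finset.sum_bij (fun u _ => (u : ZMod (p ^ (k + 1)))) ?_ ?_ ?_ ?_
    · intro u _; simp
    · intro u _ v _ h; exact Units.ext h
    · intro b hb
      obtain ⟨u, hu⟩ := (Finset.mem_filter.1 hb).2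
      exact ⟨u, Finset.mem_univ _, hu⟩
    · intros; rfl
  · rw [ZMod.sum_eq_sum_range, show Finset.range (p ^ (k + 1)) = Finset.range (p * p ^ k) by rw [pow_succ'],
      sum_range_mul_eq]
    rw [Finset.sum_eq_single 0]
    · apply Finset.sum_congr rfl
      intro v _
      rw [zero_add, if_neg]
      rw [isUnit_natCast_zmod_pow (by omega), not_not]
      exact Dvd.intro _ rfl
    · intro u hu hu0
      apply Finset.sum_eq_zero
      intro v _
      rw [if_pos]
      rw [isUnit_natCast_zmod_pow (by omega), ← Nat.dvd_add_iff_left (Dvd.intro _ rfl)]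
      intro hd
      exact absurd (Nat.le_of_dvd (Nat.pos_of_ne_zero hu0) hd) (by rw [Finset.mem_range] at hu; omega)
    · intro h
      exact absurd (Finset.mem_range.2 hp.out.pos) h

theorem stdAddChar_prime_mul (k : ℕ) (x : ℤ) :
    ZMod.stdAddChar ((p : ZMod (p ^ (k + 1))) * (x : ZMod (p ^ (k + 1)))) =
      ZMod.stdAddChar (x : ZMod (p ^ k)) := by
  have key : ∀ (m : ℕ) [NeZero m], m = p * p ^ k →
      ZMod.stdAddChar ((p : ZMod m) * (x : ZMod m)) = ZMod.stdAddChar (x : ZMod (p ^ k)) := by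
    rintro m _ rfl
    exact stdAddChar_mul_intCast p (p ^ k) x
  exact key _ (pow_succ' _ _)

/-- Evaluation of Ramanujan sums to prime power moduli. -/
theorem sum_units_stdAddChar (k : ℕ) (T : ℤ) :
    ∑ h : (ZMod (p ^ (k + 1)))ˣ, ZMod.stdAddChar ((h : ZMod (p ^ (k + 1))) * (T : ZMod (p ^ (k + 1)))) =
      (p : ℂ) ^ (k + 1) * (if (T : ZMod (p ^ (k + 1))) = 0 then 1 else 0) -
        (p : ℂ) ^ k * (if (T : ZMod (p ^ k)) = 0 then 1 else 0) := by
  have h1 := sum_nonunit_eq k (fun h : ZMod (p ^ (k + 1)) => ZMod.stdAddChar (h * (T : ZMod (p ^ (k + 1)))))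
  rw [AddChar.sum_mulShift _ (ZMod.isPrimitive_stdAddChar _), ZMod.card] at h1
  have h2 : ∑ v ∈ Finset.range (p ^ k), ZMod.stdAddChar (((p * v : ℕ) : ZMod (p ^ (k + 1))) *
      (T : ZMod (p ^ (k + 1)))) = (p : ℂ) ^ k * (if (T : ZMod (p ^ k)) = 0 then 1 else 0) := by
    have h3 : ∀ v : ℕ, ZMod.stdAddChar (((p * v : ℕ) : ZMod (p ^ (k + 1))) * (T : ZMod (p ^ (k + 1)))) =
        ZMod.stdAddChar ((v : ZMod (p ^ k)) * (T : ZMod (p ^ k))) := by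
      intro v
      have := stdAddChar_prime_mul (p := p) k (v * T)
      push_cast at this ⊢
      rw [← this, mul_assoc]
    simp_rw [h3]
    rw [← ZMod.sum_eq_sum_range (fun v : ZMod (p ^ k) => ZMod.stdAddChar (v * (T : ZMod (p ^ k)))),
      AddChar.sum_mulShift _ (ZMod.isPrimitive_stdAddChar _), ZMod.card]
    split_ifs <;> simp
  rw [h2] at h1
  rw [← sub_eq_iff_eq_add] at h1
  rw [← h1]
  congr 1
  split_ifs <;> simp

/-- For m a unit, the substitution h ↦ hm moves m to the other term as an inverse, and the sums over
n and m separate. -/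
theorem sum_box_units {k : ℕ} (a : ℤ) (m₁ m₂ n₁ n₂ : ℕ) :
    ∑ m ∈ (Finset.Ico m₁ m₂).filter (fun m => ¬ p ∣ m), ∑ n ∈ Finset.Ico n₁ n₂,
      ∑ h : (ZMod (p ^ (k + 1)))ˣ, ZMod.stdAddChar ((h : ZMod (p ^ (k + 1))) *
        ((m * n - a : ℤ) : ZMod (p ^ (k + 1)))) =
    ∑ h : (ZMod (p ^ (k + 1)))ˣ, linSum n₁ n₂ (h : ZMod (p ^ (k + 1))) *
      invSum m₁ m₂ (-((h : ZMod (p ^ (k + 1))) * (a : ZMod (p ^ (k + 1))))) := by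
  have h1 : ∀ m ∈ (Finset.Ico m₁ m₂).filter (fun m => ¬ p ∣ m), ∑ n ∈ Finset.Ico n₁ n₂,
      ∑ h : (ZMod (p ^ (k + 1)))ˣ, ZMod.stdAddChar ((h : ZMod (p ^ (k + 1))) *
        ((m * n - a : ℤ) : ZMod (p ^ (k + 1)))) =
      ∑ h : (ZMod (p ^ (k + 1)))ˣ, linSum n₁ n₂ (h : ZMod (p ^ (k + 1))) *
        ZMod.stdAddChar (-((h : ZMod (p ^ (k + 1))) * (a : ZMod (p ^ (k + 1)))) * (m : ZMod (p ^ (k + 1)))⁻¹) := by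
    intro m hm
    obtain ⟨u, hu⟩ := (isUnit_natCast_zmod_pow (k := k + 1) (by omega) m).2 (Finset.mem_filter.1 hm).2
    rw [Finset.sum_comm]
    refine Fintype.sum_equiv (Equiv.mulRight u) _ _ ?_
    intro h
    unfold linSum
    rw [Finset.sum_mul]
    apply Finset.sum_congr rfl
    intro n _
    rw [← AddChar.map_add_eq_mul]
    congr 1
    have huu : (u : ZMod (p ^ (k + 1))) * ((u⁻¹ : (ZMod (p ^ (k + 1)))ˣ) : ZMod (p ^ (k + 1))) = 1 := u.mul_inv
    rw [← hu, ZMod.inv_coe_unit, Equiv.coe_mulRight, Units.val_mul]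
    push_cast
    rw [← hu]
    linear_combination (h * (a : ZMod (p ^ (k + 1)))) * huu
  rw [Finset.sum_congr rfl h1, Finset.sum_comm]
  apply Finset.sum_congr rfl
  intro h _
  unfold invSum
  rw [Finset.mul_sum]
  have : (Finset.Ico m₁ m₂).filter (fun m : ℕ => IsUnit (m : ZMod (p ^ (k + 1)))) =
      (Finset.Ico m₁ m₂).filter (fun m => ¬ p ∣ m) := by
    apply Finset.filter_congr
    intro m _
    rw [isUnit_natCast_zmod_pow (by omega)]
  rw [this]

/-- Frequencies divisible by p detect the congruence modulo p^k, those prime to p give a Ramanujan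
sum. The expected values for the two moduli cancel exactly, so no zero frequency remains. -/
theorem boxError_succ {k : ℕ} (hk : k ≠ 0) {a : ℤ} (ha : IsCoprime a (p : ℤ)) (m₁ m₂ n₁ n₂ : ℕ) :
    ((p : ℂ) ^ (k + 1)) * (boxError p (k + 1) a m₁ m₂ n₁ n₂ - boxError p k a m₁ m₂ n₁ n₂ / p : ℝ) =
    ∑ h : (ZMod (p ^ (k + 1)))ˣ, linSum n₁ n₂ (h : ZMod (p ^ (k + 1))) *
      invSum m₁ m₂ (-((h : ZMod (p ^ (k + 1))) * (a : ZMod (p ^ (k + 1))))) := by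
  have hp0 : (p : ℂ) ≠ 0 := by exact_mod_cast hp.out.ne_zero
  rw [← sum_box_units]
  simp_rw [sum_units_stdAddChar, Finset.sum_sub_distrib, ← Finset.mul_sum]
  unfold boxError
  rw [boxCount_eq_sum_filter hk ha, boxCount_eq_sum_filter (Nat.succ_ne_zero k) ha]
  have e : ∀ (j m n : ℕ), (((m * n - a : ℤ) : ZMod (p ^ j)) = 0) =
      ((m : ZMod (p ^ j)) * (n : ZMod (p ^ j)) = (a : ZMod (p ^ j))) := by
    intro j m n
    push_cast
    rw [sub_eq_zero]
  simp_rw [e]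
  push_cast [apply_ite Complex.ofReal]
  field_simp
  ring

theorem abs_boxError_succ_le {k : ℕ} (hk : k ≠ 0) {a : ℤ} (ha : IsCoprime a (p : ℤ)) (m₁ m₂ n₁ n₂ : ℕ)
    {B : ℝ} (hB : ∀ h : ZMod (p ^ (k + 1)), IsUnit h → ‖invSum m₁ m₂ h‖ ≤ B) :
    |boxError p (k + 1) a m₁ m₂ n₁ n₂| ≤ |boxError p k a m₁ m₂ n₁ n₂| / p +
      (1 + Real.log ((p : ℝ) ^ (k + 1))) * B := by
  have hp0 : (0 : ℝ) < p := by exact_mod_cast hp.out.pos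
  have hq : (0 : ℝ) < (p : ℝ) ^ (k + 1) := by positivity
  have hB0 : 0 ≤ B := (norm_nonneg _).trans (hB 1 isUnit_one)
  have h1 := congrArg norm (boxError_succ (k := k) hk ha m₁ m₂ n₁ n₂)
  have hau := isUnit_intCast_zmod_pow ha (k + 1)
  have hne : ∀ h : (ZMod (p ^ (k + 1)))ˣ, (h : ZMod (p ^ (k + 1))) ≠ 0 := by
    intro h h0
    have h2 := h.isUnit
    rw [h0] at h2
    have h3 := (isUnit_natCast_zmod_pow (p := p) (k := k + 1) (by omega) 0).1 (by simpa using h2)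
    exact h3 (dvd_zero p)
  have h2 : ∀ h ∈ (Finset.univ : Finset (ZMod (p ^ (k + 1)))ˣ), ‖linSum n₁ n₂ (h : ZMod (p ^ (k + 1))) *
      invSum m₁ m₂ (-((h : ZMod (p ^ (k + 1))) * (a : ZMod (p ^ (k + 1)))))‖ ≤
      ((p ^ (k + 1) : ℕ) : ℝ) / (2 * |((h : ZMod (p ^ (k + 1))).valMinAbs : ℝ)|) * B := by
    intro h _
    rw [norm_mul]
    exact mul_le_mul (norm_linSum_le_div _ _ (hne h)) (hB _ (h.isUnit.mul hau).neg)
      (norm_nonneg _) (by positivity)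
  have h3 := (norm_sum_le _ _).trans (Finset.sum_le_sum h2)
  rw [← h1, ← Finset.sum_mul, norm_mul, norm_pow, Complex.norm_natCast, Complex.norm_real, Real.norm_eq_abs] at h3
  have h4 : ∑ h : (ZMod (p ^ (k + 1)))ˣ,
      ((p ^ (k + 1) : ℕ) : ℝ) / (2 * |((h : ZMod (p ^ (k + 1))).valMinAbs : ℝ)|) ≤
      ((p ^ (k + 1) : ℕ) : ℝ) * (1 + Real.log ((p ^ (k + 1) : ℕ) : ℝ)) := by
    refine le_trans ?_ (sum_div_valMinAbs_le (n := p ^ (k + 1)))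
    rw [← Finset.sum_image (s := Finset.univ) (g := fun h : (ZMod (p ^ (k + 1)))ˣ => (h : ZMod (p ^ (k + 1))))
      (f := fun y : ZMod (p ^ (k + 1)) => ((p ^ (k + 1) : ℕ) : ℝ) / (2 * |(y.valMinAbs : ℝ)|))
      (fun x _ y _ h => Units.ext h)]
    apply Finset.sum_le_sum_of_subset_of_nonneg
    · intro y hy
      obtain ⟨h, -, rfl⟩ := Finset.mem_image.1 hy
      exact Finset.mem_erase.2 ⟨hne h, Finset.mem_univ _⟩
    · intros; positivity
  have h5 := h3.trans (mul_le_mul_of_nonneg_right h4 hB0)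
  push_cast at h5
  rw [mul_assoc] at h5
  have h6 := le_of_mul_le_mul_left h5 hq
  have h7 := abs_sub_abs_le_abs_sub (boxError p (k + 1) a m₁ m₂ n₁ n₂) (boxError p k a m₁ m₂ n₁ n₂ / p)
  rw [abs_div, abs_of_pos hp0] at h7
  linarith

/-- Descent through the powers of p: each level costs one application of the square-root bound,
while the trivial term at level p gains a factor 1/p every time. -/
theorem abs_boxError_le_sqrt (hp2 : p ≠ 2) {a : ℤ} (ha : IsCoprime a (p : ℤ)) (m₁ m₂ : ℕ) {n₁ n₂ : ℕ}
    (hn : n₁ ≤ n₂) (k : ℕ) : |boxError p (k + 1) a m₁ m₂ n₁ n₂| ≤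
      2 * k * Real.sqrt ((p : ℝ) ^ (k + 1)) * (1 + Real.log ((p : ℝ) ^ (k + 1))) ^ 2 +
        ((m₂ - m₁ : ℕ) : ℝ) / (p : ℝ) ^ k := by
  have hp0 : (0 : ℝ) < p := by exact_mod_cast hp.out.pos
  have hp1 : (1 : ℝ) ≤ p := by exact_mod_cast hp.out.one_le
  induction k with
  | zero =>
    have := abs_boxError_le_length (k := 1) one_ne_zero ha m₁ m₂ hn
    simpa using this
  | succ k ih =>
    have h1 := abs_boxError_succ_le (k := k + 1) (Nat.succ_ne_zero k) ha m₁ m₂ n₁ n₂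
      (fun h hh => norm_invSum_le_sqrt hp2 (by omega) hh m₁ m₂)
    refine h1.trans ?_
    set S := Real.sqrt ((p : ℝ) ^ (k + 1 + 1)) with hS
    set Λ := Real.log ((p : ℝ) ^ (k + 1 + 1)) with hΛ
    have hpow : (p : ℝ) ^ (k + 1) ≤ (p : ℝ) ^ (k + 1 + 1) := pow_le_pow_right₀ hp1 (by omega)
    have e1 : Real.sqrt ((p : ℝ) ^ (k + 1)) ≤ S := Real.sqrt_le_sqrt hpow
    have e2 : Real.log ((p : ℝ) ^ (k + 1)) ≤ Λ := Real.log_le_log (by positivity) hpow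
    have e0 : 0 ≤ Real.log ((p : ℝ) ^ (k + 1)) := Real.log_nonneg (one_le_pow₀ hp1)
    have e3 : 2 * k * Real.sqrt ((p : ℝ) ^ (k + 1)) * (1 + Real.log ((p : ℝ) ^ (k + 1))) ^ 2 ≤
        2 * k * S * (1 + Λ) ^ 2 := by gcongr
    have e4 : |boxError p (k + 1) a m₁ m₂ n₁ n₂| / p ≤ 2 * k * S * (1 + Λ) ^ 2 +
        ((m₂ - m₁ : ℕ) : ℝ) / (p : ℝ) ^ (k + 1) := by
      have := div_le_div_of_nonneg_right (ih.trans (add_le_add_left e3 _)) hp0.le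
      refine this.trans ?_
      rw [add_div, div_div, ← pow_succ]
      have : 2 * k * S * (1 + Λ) ^ 2 / p ≤ 2 * k * S * (1 + Λ) ^ 2 := div_le_self (by positivity) hp1
      linarith
    push_cast
    nlinarith

end

theorem one_add_log_sq_le_rpow {x ε : ℝ} (hx : 1 ≤ x) (hε : 0 < ε) :
    (1 + Real.log x) ^ 2 ≤ (1 + 2 / ε) ^ 2 * x ^ ε := by
  have h1 := one_add_log_le_rpow hx (half_pos hε)
  have h0 : 0 ≤ 1 + Real.log x := by have := Real.log_nonneg hx; linarith
  have h2 := pow_le_pow_left₀ h0 h1 2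
  refine h2.trans (le_of_eq ?_)
  rw [mul_pow, ← Real.rpow_natCast (x ^ (ε / 2)), ← Real.rpow_mul (by linarith)]
  congr 2
  · field_simp
  · push_cast; ring

/-- Only the top level needs a bound better than √q. The lower levels enter divided by p = q^(1/κ),
where κ is the exponent of p in the modulus; the squared logarithm costs q^(1/(2κ)), and a net
saving of q^(1/(2κ)) remains. -/
theorem abs_boxError_le_of_invSum_le {p : ℕ} [hp : Fact p.Prime] (hp2 : p ≠ 2) {d : ℕ} {a : ℤ}
    (ha : IsCoprime a (p : ℤ)) (m₁ m₂ : ℕ) {n₁ n₂ : ℕ} (hn : n₁ ≤ n₂) {B : ℝ}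
    (hB : ∀ h : ZMod (p ^ (d + 2)), IsUnit h → ‖invSum m₁ m₂ h‖ ≤ B) :
    |boxError p (d + 2) a m₁ m₂ n₁ n₂| ≤
      2 * d * (1 + 4 * ((d + 2 : ℕ) : ℝ)) ^ 2 *
        ((p : ℝ) ^ (d + 2)) ^ (1 / 2 - 1 / (2 * ((d + 2 : ℕ) : ℝ)) : ℝ) +
      (1 + Real.log ((p : ℝ) ^ (d + 2))) * B +
      ((m₂ - m₁ : ℕ) : ℝ) * p / (p : ℝ) ^ (d + 2) := by
  have hp0 : (0 : ℝ) < p := by exact_mod_cast hp.out.pos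
  have hp1 : (1 : ℝ) ≤ p := by exact_mod_cast hp.out.one_le
  have h1 := abs_boxError_succ_le (k := d + 1) (Nat.succ_ne_zero d) ha m₁ m₂ n₁ n₂ hB
  have h2 := abs_boxError_le_sqrt hp2 ha m₁ m₂ hn d
  set κ : ℝ := ((d + 2 : ℕ) : ℝ) with hκ
  have hκ0 : 0 < κ := by rw [hκ]; positivity
  set q : ℝ := (p : ℝ) ^ (d + 2) with hq
  have hq1 : 1 ≤ q := one_le_pow₀ hp1
  have hq0 : 0 < q := by linarith
  have hpq : (p : ℝ) = q ^ (1 / κ) := by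
    rw [hq, ← Real.rpow_natCast, ← Real.rpow_mul hp0.le, ← hκ, mul_one_div_cancel hκ0.ne', Real.rpow_one]
  have hpow : (p : ℝ) ^ (d + 1) ≤ q := pow_le_pow_right₀ hp1 (by omega)
  have e1 : Real.sqrt ((p : ℝ) ^ (d + 1)) ≤ q ^ (1 / 2 : ℝ) := by
    rw [← Real.sqrt_eq_rpow]; exact Real.sqrt_le_sqrt hpow
  have e0 : 0 ≤ Real.log ((p : ℝ) ^ (d + 1)) := Real.log_nonneg (one_le_pow₀ hp1)
  have e2 : (1 + Real.log ((p : ℝ) ^ (d + 1))) ^ 2 ≤ (1 + 4 * κ) ^ 2 * q ^ (1 / (2 * κ)) := by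
    have t1 : Real.log ((p : ℝ) ^ (d + 1)) ≤ Real.log q := Real.log_le_log (by positivity) hpow
    have t2 := one_add_log_sq_le_rpow hq1 (show 0 < 1 / (2 * κ) by positivity)
    have t3 : 2 / (1 / (2 * κ)) = 4 * κ := by field_simp; norm_num
    rw [t3] at t2
    exact (pow_le_pow_left₀ (by linarith) (by linarith) 2).trans t2
  have e3 : 2 * d * Real.sqrt ((p : ℝ) ^ (d + 1)) * (1 + Real.log ((p : ℝ) ^ (d + 1))) ^ 2 ≤
      2 * d * q ^ (1 / 2 : ℝ) * ((1 + 4 * κ) ^ 2 * q ^ (1 / (2 * κ))) := by gcongr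
  have e4 : 2 * d * q ^ (1 / 2 : ℝ) * ((1 + 4 * κ) ^ 2 * q ^ (1 / (2 * κ))) / p =
      2 * d * (1 + 4 * κ) ^ 2 * q ^ (1 / 2 - 1 / (2 * κ) : ℝ) := by
    rw [div_eq_iff hp0.ne', hpq]
    have : q ^ (1 / 2 : ℝ) * q ^ (1 / (2 * κ)) = q ^ (1 / 2 - 1 / (2 * κ) : ℝ) * q ^ (1 / κ) := by
      rw [← Real.rpow_add hq0, ← Real.rpow_add hq0]
      congr 1; field_simp; ring
    linear_combination (2 * d * (1 + 4 * κ) ^ 2) * this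
  have e5 : ((m₂ - m₁ : ℕ) : ℝ) / (p : ℝ) ^ d / p = ((m₂ - m₁ : ℕ) : ℝ) * p / q := by
    rw [hq]; field_simp; ring
  have h3 := div_le_div_of_nonneg_right (h2.trans (add_le_add_left e3 _)) hp0.le
  rw [add_div, e4, e5] at h3
  linarith

/-- Equidistribution in boxes whose short side is at most `√x`, slightly past the barrier
`x = q ^ (3/2)`. -/
theorem exists_abs_boxError_le (k : ℕ) (hk : 7 ≤ k) : ∃ η δ C : ℝ, 0 < η ∧ η ≤ 1 / 10 ∧ 0 < δ ∧
    δ ≤ 1 / 336 ∧ 1 ≤ C ∧ ∀ (p : ℕ) [Fact p.Prime], p ≠ 2 → ∀ a : ℤ, IsCoprime a (p : ℤ) →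
    ∀ x : ℝ, ((p : ℝ) ^ k) ^ (3 / 2 - η) < x → ∀ m₁ m₂ n₁ n₂ : ℕ, n₁ ≤ n₂ →
    ((m₂ - m₁ : ℕ) : ℝ) ≤ Real.sqrt x → |boxError p k a m₁ m₂ n₁ n₂| ≤
      C * (x ^ (1 - δ) / (p : ℝ) ^ k) + ((m₂ - m₁ : ℕ) : ℝ) * p / (p : ℝ) ^ k := by
  obtain ⟨d, rfl⟩ : ∃ d, k = d + 2 := ⟨k - 2, by omega⟩
  obtain ⟨C₀, σ, hC₀, hσ, hσ', H⟩ := exists_norm_invSum_le_rpow (d + 2) hk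
  set κ : ℝ := ((d + 2 : ℕ) : ℝ) with hκ
  have hκ7 : (7 : ℝ) ≤ κ := by rw [hκ]; exact_mod_cast hk
  set τ := min (σ / 2) (1 / (2 * κ)) with hτ
  have hτ0 : 0 < τ := lt_min (by positivity) (by positivity)
  have hτ1 : τ ≤ σ / 2 := min_le_left _ _
  have hτ2 : τ ≤ 1 / (2 * κ) := min_le_right _ _
  set A := 2 * (d : ℝ) * (1 + 4 * κ) ^ 2 with hA
  have hA0 : 0 ≤ A := by positivity
  -- With η = τ/2 and δ = τ/4 one has (3/2 - η)(1 - δ) ≥ 3/2 - τ, so q^(1/2-τ) ≤ x^(1-δ)/q. The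
  -- number 336 is 2/(1/168), from the squared logarithm.
  refine ⟨τ / 2, τ / 4, A + C₀ * (1 + 2 / σ) + 2 * (1 + 336) ^ 2, by positivity, by linarith,
    by positivity, by linarith, ?_, ?_⟩
  · have : 0 ≤ C₀ * (1 + 2 / σ) := by positivity
    linarith
  intro p hp hp2 a ha x hx m₁ m₂ n₁ n₂ hn hlen
  have hp1 : (1 : ℝ) ≤ p := by exact_mod_cast hp.out.one_le
  set q : ℝ := (p : ℝ) ^ (d + 2) with hq
  have hq1 : 1 ≤ q := one_le_pow₀ hp1
  have hq0 : 0 < q := by linarith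
  have hx0 : 0 < x := lt_of_le_of_lt (by positivity) hx
  have hC1 : 0 ≤ C₀ * (1 + 2 / σ) := by positivity
  have hmain : ∀ e : ℝ, ∀ f : ℝ, q ^ f ≤ x → e + 1 ≤ f * (1 - τ / 4) → q ^ e ≤ x ^ (1 - τ / 4) / q := by
    intro e f hf hef
    rw [le_div_iff₀ hq0]
    have h1 := Real.rpow_le_rpow (by positivity) hf (show 0 ≤ 1 - τ / 4 by linarith)
    rw [← Real.rpow_mul hq0.le] at h1
    refine le_trans ?_ h1
    nth_rewrite 2 [← Real.rpow_one q]
    rw [← Real.rpow_add hq0]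
    exact Real.rpow_le_rpow_of_exponent_le hq1 hef
  have hfirst : q ^ (1 / 2 - 1 / (2 * κ) : ℝ) ≤ q ^ (1 / 2 - τ : ℝ) :=
    Real.rpow_le_rpow_of_exponent_le hq1 (by linarith)
  have hxq : q ^ (1 / 2 - τ : ℝ) ≤ x ^ (1 - τ / 4) / q := by
    refine hmain _ _ hx.le ?_
    nlinarith
  have hX0 : 0 ≤ x ^ (1 - τ / 4) / q := by positivity
  -- Up to q^(3/2+1/84) the side √x is at most q^(3/4+1/168) and the improved bound applies. For
  -- larger x the square-root bound already suffices.
  rcases le_or_gt x (q ^ (3 / 2 + 1 / 84 : ℝ)) with hsmall | hlarge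
  · have hlen' : ((m₂ - m₁ : ℕ) : ℝ) ≤ q ^ (3 / 4 + 1 / 168 : ℝ) := by
      refine hlen.trans ?_
      have := Real.sqrt_le_sqrt hsmall
      rw [Real.sqrt_eq_rpow (q ^ _), ← Real.rpow_mul hq0.le] at this
      refine this.trans (le_of_eq ?_)
      congr 1; norm_num
    have h1 := abs_boxError_le_of_invSum_le hp2 ha m₁ m₂ hn (fun h hh => H p hp2 h hh m₁ m₂ hlen')
    have h2 : (1 + Real.log q) * (C₀ * q ^ (1 / 2 - σ : ℝ)) ≤ C₀ * (1 + 2 / σ) * q ^ (1 / 2 - τ : ℝ) := by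
      have t1 := one_add_log_le_rpow hq1 (half_pos hσ)
      have t2 : q ^ (1 / 2 - σ : ℝ) * q ^ (σ / 2) ≤ q ^ (1 / 2 - τ : ℝ) := by
        rw [← Real.rpow_add hq0]
        exact Real.rpow_le_rpow_of_exponent_le hq1 (by linarith)
      have t3 : 1 / (σ / 2) = 2 / σ := by field_simp
      rw [t3] at t1
      have t4 := mul_le_mul_of_nonneg_left t1 (show 0 ≤ C₀ * q ^ (1 / 2 - σ : ℝ) by positivity)
      have t5 := mul_le_mul_of_nonneg_left t2 hC1
      linarith
    have h3 := mul_le_mul_of_nonneg_left (hfirst.trans hxq) hA0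
    have h4 := mul_le_mul_of_nonneg_left hxq hC1
    linarith
  · have h1 := abs_boxError_le_of_invSum_le (d := d) hp2 ha m₁ m₂ hn
      (fun h hh => norm_invSum_le_sqrt hp2 (by omega) hh m₁ m₂)
    have h2 : (1 + Real.log q) * (2 * Real.sqrt q * (1 + Real.log q)) ≤
        2 * (1 + 336) ^ 2 * q ^ (1 / 2 + 1 / 168 : ℝ) := by
      have t1 := one_add_log_sq_le_rpow hq1 (show (0 : ℝ) < 1 / 168 by norm_num)
      have t2 := mul_le_mul_of_nonneg_left t1 (show 0 ≤ 2 * Real.sqrt q by positivity)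
      rw [Real.rpow_add hq0, ← Real.sqrt_eq_rpow]
      norm_num at t2 ⊢
      linarith
    have h3 := mul_le_mul_of_nonneg_left (hfirst.trans hxq) hA0
    have h4 : q ^ (1 / 2 + 1 / 168 : ℝ) ≤ x ^ (1 - τ / 4) / q := by
      refine hmain _ _ hlarge.le ?_
      nlinarith
    have h5 : 0 ≤ C₀ * (1 + 2 / σ) * (x ^ (1 - τ / 4) / q) := by positivity
    linarith

/-! ### The hyperbola method and the dissection of the hyperbola into boxes -/

theorem card_divisorsAntidiagonal_eq (n : ℕ) : n.divisorsAntidiagonal.card = n.divisors.card := by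
  rw [← Nat.map_div_right_divisors, Finset.card_map]

theorem sum_mul_card_divisors_eq (f : ℕ → ℝ) (X : ℕ) :
    ∑ n ∈ Finset.Icc 1 X, f n * (n.divisors.card : ℝ) =
      ∑ x ∈ (Finset.Icc 1 X ×ˢ Finset.Icc 1 X).filter (fun x => x.1 * x.2 ≤ X), f (x.1 * x.2) := by
  rw [← Finset.sum_fiberwise_of_maps_to (t := Finset.Icc 1 X) (g := fun x : ℕ × ℕ => x.1 * x.2)]
  · apply Finset.sum_congr rfl
    intro n hn
    rw [Finset.mem_Icc] at hn
    have : ((Finset.Icc 1 X ×ˢ Finset.Icc 1 X).filter (fun x => x.1 * x.2 ≤ X)).filter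
        (fun x => x.1 * x.2 = n) = n.divisorsAntidiagonal := by
      ext ⟨u, v⟩
      simp only [Finset.mem_filter, Finset.mem_product, Finset.mem_Icc, Nat.mem_divisorsAntidiagonal]
      constructor
      · rintro ⟨_, h⟩
        exact ⟨h, by omega⟩
      · rintro ⟨h, _⟩
        have hu : 0 < u := Nat.pos_of_ne_zero (by rintro rfl; omega)
        have hv : 0 < v := Nat.pos_of_ne_zero (by rintro rfl; omega)
        have h1 : u ≤ u * v := Nat.le_mul_of_pos_right _ hv
        have h2 : v ≤ u * v := Nat.le_mul_of_pos_left _ hu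
        refine ⟨⟨⟨⟨hu, by omega⟩, ⟨hv, by omega⟩⟩, by omega⟩, h⟩
    rw [this, Finset.sum_congr rfl (g := fun _ => f n), Finset.sum_const, card_divisorsAntidiagonal_eq,
      nsmul_eq_mul, mul_comm]
    intro x hx
    rw [(Nat.mem_divisorsAntidiagonal.1 hx).1]
  · intro x hx
    simp only [Finset.mem_filter, Finset.mem_product, Finset.mem_Icc] at hx
    rw [Finset.mem_Icc]
    exact ⟨Nat.mul_pos hx.1.1.1 hx.1.2.1, hx.2⟩

/-- Dirichlet's hyperbola method. -/
theorem sum_mul_card_divisors_hyperbola (f : ℕ → ℝ) (X : ℕ) :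
    ∑ n ∈ Finset.Icc 1 X, f n * (n.divisors.card : ℝ) =
      2 * ∑ m ∈ Finset.Ico 1 (X.sqrt + 1), ∑ n ∈ Finset.Ico 1 (X / m + 1), f (m * n) -
        ∑ m ∈ Finset.Ico 1 (X.sqrt + 1), ∑ n ∈ Finset.Ico 1 (X.sqrt + 1), f (m * n) := by
  set Y := X.sqrt with hY
  have hYX : Y ≤ X := Nat.sqrt_le_self X
  have hYY : Y * Y ≤ X := Nat.sqrt_le X
  have hXY : X < (Y + 1) * (Y + 1) := Nat.lt_succ_sqrt X
  set P := (Finset.Icc 1 X ×ˢ Finset.Icc 1 X).filter (fun x => x.1 * x.2 ≤ X) with hP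
  have hleft : ∑ x ∈ P.filter (fun x => x.1 ≤ Y), f (x.1 * x.2) =
      ∑ m ∈ Finset.Ico 1 (Y + 1), ∑ n ∈ Finset.Ico 1 (X / m + 1), f (m * n) := by
    apply Finset.sum_finset_product
    rintro ⟨m, n⟩
    simp only [hP, Finset.mem_filter, Finset.mem_product, Finset.mem_Icc, Finset.mem_Ico, Nat.lt_succ_iff]
    constructor
    · rintro ⟨⟨⟨⟨h1, h2⟩, h3, h4⟩, h5⟩, h6⟩
      refine ⟨⟨h1, h6⟩, h3, ?_⟩
      rw [Nat.le_div_iff_mul_le h1, mul_comm]; exact h5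
    · rintro ⟨⟨h1, h2⟩, h3, h4⟩
      rw [Nat.le_div_iff_mul_le h1, mul_comm] at h4
      have h5 : n ≤ m * n := Nat.le_mul_of_pos_left _ h1
      exact ⟨⟨⟨⟨h1, by omega⟩, h3, by omega⟩, h4⟩, h2⟩
  have hright : ∑ x ∈ P.filter (fun x => x.2 ≤ Y), f (x.1 * x.2) =
      ∑ x ∈ P.filter (fun x => x.1 ≤ Y), f (x.1 * x.2) := by
    apply Finset.sum_equiv (Equiv.prodComm ℕ ℕ)
    · rintro ⟨m, n⟩
      simp only [hP, Finset.mem_filter, Finset.mem_product, Equiv.prodComm_apply, Prod.swap]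
      rw [mul_comm n m]; tauto
    · rintro ⟨m, n⟩ _
      simp [mul_comm]
  have hboth : ∑ x ∈ (P.filter (fun x => x.1 ≤ Y)).filter (fun x => x.2 ≤ Y), f (x.1 * x.2) =
      ∑ m ∈ Finset.Ico 1 (Y + 1), ∑ n ∈ Finset.Ico 1 (Y + 1), f (m * n) := by
    apply Finset.sum_finset_product
    rintro ⟨m, n⟩
    simp only [hP, Finset.mem_filter, Finset.mem_product, Finset.mem_Icc, Finset.mem_Ico, Nat.lt_succ_iff]
    constructor
    · rintro ⟨⟨⟨⟨⟨h1, h2⟩, h3, h4⟩, h5⟩, h6⟩, h7⟩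
      exact ⟨⟨h1, h6⟩, h3, h7⟩
    · rintro ⟨⟨h1, h2⟩, h3, h4⟩
      have : m * n ≤ Y * Y := Nat.mul_le_mul h2 h4
      exact ⟨⟨⟨⟨⟨h1, by omega⟩, h3, by omega⟩, by omega⟩, h2⟩, h4⟩
  rw [sum_mul_card_divisors_eq, ← hP, ← hleft, ← hboth]
  have e1 := Finset.sum_filter_add_sum_filter_not P (fun x => x.1 ≤ Y) (fun x => f (x.1 * x.2))
  have e2 := Finset.sum_filter_add_sum_filter_not (P.filter (fun x => x.2 ≤ Y)) (fun x => x.1 ≤ Y)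
    (fun x => f (x.1 * x.2))
  -- If both factors exceeded Y, their product would be at least (Y + 1)² > X.
  have e3 : P.filter (fun x => ¬ x.1 ≤ Y) = (P.filter (fun x => x.2 ≤ Y)).filter (fun x => ¬ x.1 ≤ Y) := by
    ext ⟨m, n⟩
    simp only [hP, Finset.mem_filter]
    constructor
    · rintro ⟨hx, h1⟩
      refine ⟨⟨hx, ?_⟩, h1⟩
      by_contra h2
      have : (Y + 1) * (Y + 1) ≤ m * n := Nat.mul_le_mul (by omega) (by omega)
      omega
    · rintro ⟨⟨hx, -⟩, h1⟩
      exact ⟨hx, h1⟩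
  rw [e3] at e1
  rw [Finset.filter_filter, Finset.filter_congr (fun x _ => and_comm), ← Finset.filter_filter] at e2
  linarith

/-- The number of `(m, n)` with `m ∈ [m₁, m₂)`, `m n ≤ X` and `m n ≡ a` modulo `M`. -/
noncomputable def hyperbolaCount (M : ℕ) (a : ℤ) (X m₁ m₂ : ℕ) : ℝ :=
  ∑ m ∈ Finset.Ico m₁ m₂, ∑ n ∈ Finset.Ico 1 (X / m + 1),
    if ((m : ZMod M) * (n : ZMod M) = (a : ZMod M)) then 1 else 0

theorem boxCount_le_hyperbolaCount {M : ℕ} {a : ℤ} {X m₁ m₂ W : ℕ} (hW : m₂ ≤ W + 1) (hm₁ : 0 < m₁) :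
    boxCount M a m₁ m₂ 1 (X / W + 1) ≤ hyperbolaCount M a X m₁ m₂ := by
  apply Finset.sum_le_sum
  intro m hm
  rw [Finset.mem_Ico] at hm
  apply Finset.sum_le_sum_of_subset_of_nonneg
  · apply Finset.Ico_subset_Ico_right
    have : X / W ≤ X / m := Nat.div_le_div_left (by omega) (by omega)
    omega
  · intros; split_ifs <;> norm_num

theorem hyperbolaCount_le_boxCount {M : ℕ} {a : ℤ} {X m₁ m₂ U : ℕ} (hU : 0 < U) (hm : U ≤ m₁) :
    hyperbolaCount M a X m₁ m₂ ≤ boxCount M a m₁ m₂ 1 (X / U + 1) := by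
  apply Finset.sum_le_sum
  intro m hm
  rw [Finset.mem_Ico] at hm
  apply Finset.sum_le_sum_of_subset_of_nonneg
  · apply Finset.Ico_subset_Ico_right
    have : X / m ≤ X / U := Nat.div_le_div_left (by omega) hU
    omega
  · intros; split_ifs <;> norm_num

section

variable {p : ℕ}

/-- The number of integers in `[m₁, m₂)` prime to `p`. -/
def coprimeCount (p m₁ m₂ : ℕ) : ℕ := ((Finset.Ico m₁ m₂).filter (fun m => ¬ p ∣ m)).card

theorem coprimeCount_le (m₁ m₂ : ℕ) : coprimeCount p m₁ m₂ ≤ m₂ - m₁ := by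
  have := Finset.card_filter_le (Finset.Ico m₁ m₂) (fun m => ¬ p ∣ m)
  rwa [Nat.card_Ico] at this

theorem boxCount_eq (k : ℕ) (a : ℤ) (m₁ m₂ N : ℕ) : boxCount (p ^ k) a m₁ m₂ 1 (N + 1) =
    coprimeCount p m₁ m₂ * N / (p : ℝ) ^ k + boxError p k a m₁ m₂ 1 (N + 1) := by
  unfold boxError coprimeCount
  rw [Nat.add_sub_cancel]
  ring

/-- The strip lies between the boxes of heights X/W and X/U. The gap between their expected values
is the price for replacing the curve by a step. -/
theorem abs_hyperbolaCount_sub_le {k : ℕ} {a : ℤ} {X m₁ m₂ U W : ℕ} (hU : 0 < U)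
    (hm : U ≤ m₁) (hW : m₂ ≤ W + 1) (hUW : U ≤ W) {E : ℝ}
    (hE : ∀ N, |boxError p k a m₁ m₂ 1 (N + 1)| ≤ E) :
    |hyperbolaCount (p ^ k) a X m₁ m₂ - coprimeCount p m₁ m₂ * (X / U : ℕ) / (p : ℝ) ^ k| ≤
      E + ((m₂ - m₁ : ℕ) : ℝ) * (((X / U : ℕ) : ℝ) - (X / W : ℕ)) / (p : ℝ) ^ k := by
  have h1 := boxCount_le_hyperbolaCount (M := p ^ k) (a := a) (X := X) (m₁ := m₁) hW (by omega)
  have h2 := hyperbolaCount_le_boxCount (M := p ^ k) (a := a) (X := X) (m₂ := m₂) hU hm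
  rw [boxCount_eq] at h1 h2
  have h3 := abs_le.1 (hE (X / U))
  have h4 := abs_le.1 (hE (X / W))
  have hd : ((X / W : ℕ) : ℝ) ≤ (X / U : ℕ) := by exact_mod_cast Nat.div_le_div_left hUW hU
  have hc : (coprimeCount p m₁ m₂ : ℝ) ≤ ((m₂ - m₁ : ℕ) : ℝ) := by exact_mod_cast coprimeCount_le m₁ m₂
  have h5 : coprimeCount p m₁ m₂ * (X / U : ℕ) / (p : ℝ) ^ k - coprimeCount p m₁ m₂ * (X / W : ℕ) / (p : ℝ) ^ k ≤
      ((m₂ - m₁ : ℕ) : ℝ) * (((X / U : ℕ) : ℝ) - (X / W : ℕ)) / (p : ℝ) ^ k := by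
    rw [← sub_div, ← mul_sub]
    apply div_le_div_of_nonneg_right _ (by positivity)
    exact mul_le_mul_of_nonneg_right hc (by linarith)
  have h6 : 0 ≤ ((m₂ - m₁ : ℕ) : ℝ) * (((X / U : ℕ) : ℝ) - (X / W : ℕ)) / (p : ℝ) ^ k := by
    apply div_nonneg (mul_nonneg (by positivity) (by linarith)) (by positivity)
  rw [abs_le]
  constructor <;> linarith

theorem hyperbolaCount_append {M : ℕ} {a : ℤ} {X m₁ m₂ m₃ : ℕ} (h : m₁ ≤ m₂) (h' : m₂ ≤ m₃) :
    hyperbolaCount M a X m₁ m₃ = hyperbolaCount M a X m₁ m₂ + hyperbolaCount M a X m₂ m₃ :=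
  (Finset.sum_Ico_consecutive _ h h').symm

/-- The initial segment, where every `m` is treated on its own. -/
theorem abs_hyperbolaCount_initial_le [hp : Fact p.Prime] {k : ℕ} (hk : k ≠ 0) {a : ℤ}
    (ha : IsCoprime a (p : ℤ)) (X m : ℕ) :
    |hyperbolaCount (p ^ k) a X 1 (m + 1) -
      ∑ j ∈ Finset.Ico 1 (m + 1), (coprimeCount p j (j + 1) : ℝ) * (X / j : ℕ) / (p : ℝ) ^ k| ≤ m := by
  induction m with
  | zero => simp [hyperbolaCount]
  | succ m ih =>
    rw [hyperbolaCount_append (m₂ := m + 1) (by omega) (by omega), Finset.sum_Ico_succ_top (by omega)]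
    -- With U = W the strip is a single column, hence exactly a box, and its error is at most 1.
    have h1 := abs_hyperbolaCount_sub_le (p := p) (k := k) (a := a) (X := X) (m₁ := m + 1) (m₂ := m + 1 + 1)
      (U := m + 1) (W := m + 1) (E := 1) (by omega) le_rfl le_rfl le_rfl (fun N => by
        have := abs_boxError_le_length hk ha (m + 1) (m + 1 + 1) (n₁ := 1) (n₂ := N + 1) (by omega)
        simpa using this)
    rw [sub_self, mul_zero, zero_div, add_zero] at h1
    rw [add_sub_add_comm]
    refine (abs_add_le _ _).trans ?_
    push_cast at *
    linarith

/-- A main term for `hyperbolaCount`, independent of the residue class. -/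
noncomputable def hyperbolaMain (p k A X Y i₀ n : ℕ) : ℝ :=
  ∑ j ∈ Finset.Ico 1 (min (i₀ ^ A) (Y + 1)), (coprimeCount p j (j + 1) : ℝ) * (X / j : ℕ) / (p : ℝ) ^ k +
    ∑ i ∈ Finset.range n, (coprimeCount p (min ((i₀ + i) ^ A) (Y + 1)) (min ((i₀ + (i + 1)) ^ A) (Y + 1)) : ℝ) *
      (X / (i₀ + i) ^ A : ℕ) / (p : ℝ) ^ k

/-- Breakpoints at A-th powers make few blocks, so the box error E is paid rarely, while a block at
i has relative width only O(1/i). Truncation at Y + 1 stops the dissection at the square root. -/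
theorem abs_hyperbolaCount_sub_main_le [hp : Fact p.Prime] {k : ℕ} (hk : k ≠ 0) {a : ℤ}
    (ha : IsCoprime a (p : ℤ)) (A X Y : ℕ) {i₀ : ℕ} (hi₀ : 0 < i₀) {E F : ℝ}
    (hE : ∀ m₁ m₂ N, m₂ - m₁ ≤ Y → |boxError p k a m₁ m₂ 1 (N + 1)| ≤ E + ((m₂ - m₁ : ℕ) : ℝ) * F) (n : ℕ) :
    |hyperbolaCount (p ^ k) a X 1 (min ((i₀ + n) ^ A) (Y + 1)) - hyperbolaMain p k A X Y i₀ n| ≤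
      i₀ ^ A + n * E + ((min ((i₀ + n) ^ A) (Y + 1) - min (i₀ ^ A) (Y + 1) : ℕ) : ℝ) * F +
        ∑ i ∈ Finset.range n, ((min ((i₀ + (i + 1)) ^ A) (Y + 1) - min ((i₀ + i) ^ A) (Y + 1) : ℕ) : ℝ) *
          (((X / (i₀ + i) ^ A : ℕ) : ℝ) - (X / (i₀ + (i + 1)) ^ A : ℕ)) / (p : ℝ) ^ k := by
  induction n with
  | zero =>
    have hpos : 0 < i₀ ^ A := pow_pos hi₀ A
    obtain ⟨m, hm⟩ : ∃ m, min (i₀ ^ A) (Y + 1) = m + 1 := ⟨min (i₀ ^ A) (Y + 1) - 1, by omega⟩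
    have h1 := abs_hyperbolaCount_initial_le hk ha X m
    simp only [hyperbolaMain, add_zero, Finset.range_zero, Finset.sum_empty, Nat.sub_self, Nat.cast_zero,
      zero_mul, hm]
    refine h1.trans ?_
    have : m ≤ i₀ ^ A := by omega
    exact_mod_cast this
  | succ n ih =>
    have hmono : ∀ i : ℕ, min ((i₀ + i) ^ A) (Y + 1) ≤ min ((i₀ + (i + 1)) ^ A) (Y + 1) := by
      intro i
      apply min_le_min_right
      exact Nat.pow_le_pow_left (by omega) A
    have hpos : ∀ i : ℕ, 0 < (i₀ + i) ^ A := fun i => pow_pos (by omega) A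
    have hle0 : min (i₀ ^ A) (Y + 1) ≤ min ((i₀ + n) ^ A) (Y + 1) :=
      min_le_min_right _ (Nat.pow_le_pow_left (by omega) A)
    rw [hyperbolaCount_append (m₂ := min ((i₀ + n) ^ A) (Y + 1)) (by have := hpos n; omega) (hmono n),
      Finset.sum_range_succ]
    have hmain : hyperbolaMain p k A X Y i₀ (n + 1) = hyperbolaMain p k A X Y i₀ n +
        (coprimeCount p (min ((i₀ + n) ^ A) (Y + 1)) (min ((i₀ + (n + 1)) ^ A) (Y + 1)) : ℝ) *
      (X / (i₀ + n) ^ A : ℕ) / (p : ℝ) ^ k := by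
      unfold hyperbolaMain
      rw [Finset.sum_range_succ]; ring
    rw [hmain, add_sub_add_comm]
    refine (abs_add_le _ _).trans ?_
    set m₁ := min ((i₀ + n) ^ A) (Y + 1) with hm₁
    set m₂ := min ((i₀ + (n + 1)) ^ A) (Y + 1) with hm₂
    have hm12 : m₁ ≤ m₂ := hmono n
    -- Equal endpoints mean an empty block. Otherwise the left endpoint has not been truncated and
    -- is a true A-th power.
    rcases hm12.eq_or_lt with heq | hlt
    · rw [← heq]
      have c1 : hyperbolaCount (p ^ k) a X m₁ m₁ = 0 := by simp [hyperbolaCount]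
      have c2 : coprimeCount p m₁ m₁ = 0 := by simp [coprimeCount]
      simp only [c1, c2, Nat.cast_zero, zero_mul, zero_div, sub_zero, abs_zero, add_zero, Nat.sub_self]
      have hE0 : 0 ≤ E := by
        have := (abs_nonneg _).trans (hE 0 0 0 (by omega))
        simpa using this
      push_cast
      linarith
    have hm₁' : m₁ = (i₀ + n) ^ A := by omega
    have h2 := abs_hyperbolaCount_sub_le (p := p) (k := k) (a := a) (X := X) (m₁ := m₁) (m₂ := m₂)
      (U := (i₀ + n) ^ A) (W := (i₀ + (n + 1)) ^ A) (E := E + ((m₂ - m₁ : ℕ) : ℝ) * F) (hpos n)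
      (by omega) (by omega) (Nat.pow_le_pow_left (by omega) A)
      (fun N => hE m₁ m₂ N (by have := hpos n; omega))
    have hsplit : ((m₂ - min (i₀ ^ A) (Y + 1) : ℕ) : ℝ) =
        ((m₁ - min (i₀ ^ A) (Y + 1) : ℕ) : ℝ) + ((m₂ - m₁ : ℕ) : ℝ) := by
      rw [← Nat.cast_add]; congr 1; omega
    rw [hsplit]
    push_cast
    linarith

end

theorem succ_pow_le (B i : ℕ) : ((i : ℝ) + 1) ^ (B + 1) ≤ (i : ℝ) ^ (B + 1) + (B + 1) * ((i : ℝ) + 1) ^ B := by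
  have hi : (0 : ℝ) ≤ i := by positivity
  induction B with
  | zero => simp
  | succ B ih =>
    have h1 := mul_le_mul_of_nonneg_left ih (show 0 ≤ (i : ℝ) + 1 by linarith)
    have h2 : (i : ℝ) ^ (B + 1) ≤ ((i : ℝ) + 1) ^ (B + 1) := pow_le_pow_left₀ hi (by linarith) _
    have e1 : ((i : ℝ) + 1) * ((i : ℝ) + 1) ^ (B + 1) = ((i : ℝ) + 1) ^ (B + 1 + 1) := by ring
    have e2 : ((i : ℝ) + 1) * ((i : ℝ) ^ (B + 1) + (B + 1) * ((i : ℝ) + 1) ^ B) =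
      (i : ℝ) ^ (B + 1 + 1) + (i : ℝ) ^ (B + 1) + (B + 1) * ((i : ℝ) + 1) ^ (B + 1) := by ring
    rw [e1, e2] at h1
    push_cast
    linarith

/-- For u = i^(B+1) and w = (i+1)^(B+1) the gap is (w - u)(X/u - X/w) = X(w - u)²/(uw) ≪ X/i².
Rounding the two quotients costs at most the block length. -/
theorem pow_gap_le {B i : ℕ} (hi : 0 < i) (X Y : ℕ) :
    ((min ((i + 1) ^ (B + 1)) (Y + 1) - min (i ^ (B + 1)) (Y + 1) : ℕ) : ℝ) *
      (((X / i ^ (B + 1) : ℕ) : ℝ) - (X / (i + 1) ^ (B + 1) : ℕ)) ≤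
    X * ((B + 1) ^ 2 * 4 ^ B) * ((i : ℝ) ^ 2)⁻¹ +
      ((min ((i + 1) ^ (B + 1)) (Y + 1) - min (i ^ (B + 1)) (Y + 1) : ℕ) : ℝ) := by
  have hi0 : (0 : ℝ) < i := by exact_mod_cast hi
  have hi1 : (1 : ℝ) ≤ i := by exact_mod_cast hi
  set u : ℝ := (i : ℝ) ^ (B + 1) with hu
  set w : ℝ := ((i : ℝ) + 1) ^ (B + 1) with hw
  have hu0 : 0 < u := by positivity
  have huw : u ≤ w := pow_le_pow_left₀ hi0.le (by linarith) _
  set L : ℝ := ((min ((i + 1) ^ (B + 1)) (Y + 1) - min (i ^ (B + 1)) (Y + 1) : ℕ) : ℝ) with hL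
  have hL0 : 0 ≤ L := by positivity
  have hLle : L ≤ w - u := by
    have h1 : min ((i + 1) ^ (B + 1)) (Y + 1) - min (i ^ (B + 1)) (Y + 1) ≤ (i + 1) ^ (B + 1) - i ^ (B + 1) := by
      have : i ^ (B + 1) ≤ (i + 1) ^ (B + 1) := Nat.pow_le_pow_left (by omega) _
      omega
    have h2 : (((i + 1) ^ (B + 1) - i ^ (B + 1) : ℕ) : ℝ) = w - u := by
      rw [Nat.cast_sub (Nat.pow_le_pow_left (by omega) _)]; push_cast; rfl
    rw [← h2, hL]; exact_mod_cast h1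
  have hgap : w - u ≤ (B + 1) * (2 * i) ^ B := by
    have h1 := succ_pow_le B i
    have h2 : ((i : ℝ) + 1) ^ B ≤ (2 * i) ^ B := pow_le_pow_left₀ (by linarith) (by linarith) _
    have h3 := mul_le_mul_of_nonneg_left h2 (show 0 ≤ (B : ℝ) + 1 by positivity)
    linarith
  have hdiff : ((X / i ^ (B + 1) : ℕ) : ℝ) - (X / (i + 1) ^ (B + 1) : ℕ) ≤ X / u - X / w + 1 := by
    have h1 : ((X / i ^ (B + 1) : ℕ) : ℝ) ≤ X / u := by
      have := Nat.cast_div_le (α := ℝ) (m := X) (n := i ^ (B + 1)); push_cast at this; exact this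
    have h2 : (X : ℝ) / w < (X / (i + 1) ^ (B + 1) : ℕ) + 1 := by
      have := Nat.lt_floor_add_one ((X : ℝ) / (((i + 1) ^ (B + 1) : ℕ) : ℝ))
      rw [Nat.floor_div_eq_div] at this
      push_cast at this ⊢
      exact this
    linarith
  have hX0 : (0 : ℝ) ≤ X := by positivity
  have hsq : (w - u) * (X / u - X / w) ≤ X * ((B + 1) ^ 2 * 4 ^ B) * ((i : ℝ) ^ 2)⁻¹ := by
    have hw0 : 0 < w := by linarith
    have e1 : (w - u) * (X / u - X / w) = X * ((w - u) ^ 2 / (u * w)) := by field_simp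
    rw [e1, mul_assoc]
    apply mul_le_mul_of_nonneg_left _ hX0
    have e2 : (w - u) ^ 2 ≤ ((B + 1) * (2 * i) ^ B) ^ 2 := pow_le_pow_left₀ (by linarith) hgap 2
    have e3 : u * u ≤ u * w := mul_le_mul_of_nonneg_left huw hu0.le
    refine (div_le_div₀ (by positivity) e2 (by positivity) e3).trans (le_of_eq ?_)
    rw [hu, show (4 : ℝ) ^ B = (2 ^ B) ^ 2 by rw [← pow_mul, mul_comm, pow_mul]; norm_num]
    field_simp
    ring
  have h0 : 0 ≤ X / u - X / w := by
    have : (X : ℝ) / w ≤ X / u := div_le_div_of_nonneg_left hX0 hu0 huw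
    linarith
  calc L * _ ≤ L * (X / u - X / w + 1) := mul_le_mul_of_nonneg_left hdiff hL0
    _ = L * (X / u - X / w) + L := by ring
    _ ≤ (w - u) * (X / u - X / w) + L := by
      have := mul_le_mul_of_nonneg_right hLle h0; linarith
    _ ≤ _ := by linarith

/-- The tail of ∑ i⁻² from i₀ is at most 2/i₀, and the block lengths telescope to at most Y. -/
theorem sum_pow_gap_le (B X Y : ℕ) {i₀ : ℕ} (hi₀ : 0 < i₀) (n : ℕ) :
    ∑ i ∈ Finset.range n, ((min ((i₀ + (i + 1)) ^ (B + 1)) (Y + 1) - min ((i₀ + i) ^ (B + 1)) (Y + 1) : ℕ) : ℝ) *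
          (((X / (i₀ + i) ^ (B + 1) : ℕ) : ℝ) - (X / (i₀ + (i + 1)) ^ (B + 1) : ℕ)) ≤
    X * ((B + 1) ^ 2 * 4 ^ B) * (2 / i₀) + Y := by
  have h1 := Finset.sum_le_sum (fun i (_ : i ∈ Finset.range n) => pow_gap_le (B := B) (i := i₀ + i) (by omega) X Y)
  simp_rw [add_assoc] at h1
  refine h1.trans ?_
  rw [Finset.sum_add_distrib]
  apply add_le_add
  · rw [← Finset.mul_sum]
    apply mul_le_mul_of_nonneg_left _ (by positivity)
    have h2 := sum_Ioo_inv_sq_le (α := ℝ) (i₀ - 1) (i₀ + n)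
    have e1 : Finset.Ioo (i₀ - 1) (i₀ + n) = Finset.Ico i₀ (i₀ + n) := by
      ext j; simp only [Finset.mem_Ioo, Finset.mem_Ico]; omega
    rw [e1, Finset.sum_Ico_eq_sum_range, Nat.add_sub_cancel_left] at h2
    have e2 : ((i₀ - 1 : ℕ) : ℝ) + 1 = i₀ := by
      rw [Nat.cast_sub hi₀]; push_cast; ring
    rw [e2] at h2
    exact h2
  · have hmono : Monotone (fun i : ℕ => min ((i₀ + i) ^ (B + 1)) (Y + 1)) := by
      intro i j hij
      exact min_le_min_right _ (Nat.pow_le_pow_left (by omega) _)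
    have h3 := Finset.sum_range_tsub hmono n
    rw [← Nat.cast_sum]
    have hpos : 0 < (i₀ + 0) ^ (B + 1) := pow_pos (by omega) _
    have h4 : min ((i₀ + n) ^ (B + 1)) (Y + 1) - min ((i₀ + 0) ^ (B + 1)) (Y + 1) ≤ Y := by omega
    rw [h3]
    exact_mod_cast h4

/-! ### Assembly: divisor sums over residue classes -/

/-- The sum of the divisor function over a residue class. -/
noncomputable def residueDivisorSum (M : ℕ) (a : ℤ) (X : ℕ) : ℝ :=
  ∑ n ∈ Finset.Icc 1 X, (if ((n : ZMod M) = (a : ZMod M)) then 1 else 0) * (n.divisors.card : ℝ)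

theorem residueDivisorSum_eq (M : ℕ) (a : ℤ) (X : ℕ) : residueDivisorSum M a X =
    2 * hyperbolaCount M a X 1 (X.sqrt + 1) - boxCount M a 1 (X.sqrt + 1) 1 (X.sqrt + 1) := by
  unfold residueDivisorSum hyperbolaCount boxCount
  rw [sum_mul_card_divisors_hyperbola (fun n => if ((n : ZMod M) = (a : ZMod M)) then 1 else 0)]
  simp only [Nat.cast_mul]

theorem natCeil_le_two_mul {y : ℝ} (hy : 1 ≤ y) : (⌈y⌉₊ : ℝ) ≤ 2 * y := by
  have := Nat.ceil_lt_add_one (show 0 ≤ y by linarith)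
  linarith

theorem sqrt_floor_le_sqrt {x : ℝ} (hx : 0 ≤ x) : ((⌊x⌋₊.sqrt : ℕ) : ℝ) ≤ Real.sqrt x := by
  apply Real.le_sqrt_of_sq_le
  have h1 : (((⌊x⌋₊.sqrt) ^ 2 : ℕ) : ℝ) ≤ (⌊x⌋₊ : ℕ) := by exact_mod_cast Nat.sqrt_le' _
  push_cast at h1
  exact h1.trans (Nat.floor_le hx)

/-- The point is the order of quantifiers: the main term M is chosen before the class a. -/
theorem exists_abs_residueDivisorSum_sub_le (k : ℕ) (hk : 7 ≤ k) : ∃ η δ C : ℝ, 0 < η ∧ 0 < δ ∧ 0 < C ∧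
    ∀ (p : ℕ) [Fact p.Prime], p ≠ 2 → ∀ x : ℝ, ((p : ℝ) ^ k) ^ (3 / 2 - η) < x →
    ∃ M : ℝ, ∀ a : ℤ, IsCoprime a (p : ℤ) →
      |residueDivisorSum (p ^ k) a ⌊x⌋₊ - M| ≤ C * (x ^ (1 - δ) / (p : ℝ) ^ k) := by
  obtain ⟨η, δ, C, hη, hη', hδ, hδ', hC, H⟩ := exists_abs_boxError_le k hk
  obtain ⟨B, hB⟩ : ∃ B : ℕ, 1 / δ ≤ (B : ℝ) + 1 := by
    obtain ⟨B, hB⟩ := exists_nat_ge (1 / δ)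
    exact ⟨B, by linarith⟩
  set A : ℝ := (B : ℝ) + 1 with hA
  have hA0 : 0 < A := by positivity
  have hAδ : 1 / A ≤ δ := by rw [div_le_iff₀ hA0]; rw [div_le_iff₀ hδ] at hB; linarith
  -- The balance: i₀ ≈ x^ε makes i₀^A ≈ x^(1/4) and the step error x/i₀ ≤ x^(1-ε). With n ≈ x^(2ε)
  -- blocks, n^A ≥ √x, and the n box errors stay admissible because 4ε ≤ δ.
  set ε : ℝ := 1 / (4 * A) with hε
  have hε0 : 0 < ε := by positivity
  have hεA : ε * A = 1 / 4 := by rw [hε]; field_simp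
  have hεδ : 4 * ε ≤ δ := by
    have : 4 * ε = 1 / A := by rw [hε]; field_simp
    linarith
  refine ⟨η, ε, 2 * (2 ^ (B + 1) + 2 * C + 1 + (2 * (A ^ 2 * 4 ^ B) + 1)) + (C + 1), hη, hε0, by positivity, ?_⟩
  intro p hp hp2 x hx
  set q : ℝ := (p : ℝ) ^ k with hq
  have hp1 : (1 : ℝ) ≤ p := by exact_mod_cast hp.out.one_lt.le
  have hq1 : 1 ≤ q := one_le_pow₀ hp1
  have hq0 : 0 < q := by linarith
  -- η ≤ 1/10 gives q ≤ x^(5/7), and k ≥ 7 then gives p ≤ x^(1/7); hence x^(1/4) and Y·p/q are both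
  -- O(x^(1-ε)/q).
  have hqx : q ^ (7 / 5 : ℝ) ≤ x := (Real.rpow_le_rpow_of_exponent_le hq1 (by linarith)).trans hx.le
  have hx1 : 1 ≤ x := (Real.one_le_rpow hq1 (by norm_num)).trans hqx
  have hx0 : 0 < x := by linarith
  have hqx' : q ≤ x ^ (5 / 7 : ℝ) := by
    have := Real.rpow_le_rpow (by positivity) hqx (show (0 : ℝ) ≤ 5 / 7 by norm_num)
    rw [← Real.rpow_mul hq0.le] at this
    norm_num at this
    exact this
  have hpx : (p : ℝ) ≤ x ^ (1 / 7 : ℝ) := by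
    have h7 : (p : ℝ) ^ 7 ≤ x := by
      have h1 : (p : ℝ) ^ 7 ≤ q := pow_le_pow_right₀ hp1 hk
      have h2 : x ^ (5 / 7 : ℝ) ≤ x ^ (1 : ℝ) := Real.rpow_le_rpow_of_exponent_le hx1 (by norm_num)
      rw [Real.rpow_one] at h2
      linarith
    have := Real.rpow_le_rpow (by positivity) h7 (show (0 : ℝ) ≤ 1 / 7 by norm_num)
    rw [← Real.rpow_natCast, ← Real.rpow_mul (by positivity)] at this
    norm_num at this ⊢
    exact this
  set X := ⌊x⌋₊ with hX
  set Y := X.sqrt with hY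
  have hXx : (X : ℝ) ≤ x := Nat.floor_le hx0.le
  have hYx : (Y : ℝ) ≤ x ^ (1 / 2 : ℝ) := by
    rw [← Real.sqrt_eq_rpow]; exact sqrt_floor_le_sqrt hx0.le
  set R := x ^ (1 - ε) with hR
  have hRle : ∀ t : ℝ, t ≤ 1 - ε → x ^ t ≤ R := fun t ht => Real.rpow_le_rpow_of_exponent_le hx1 ht
  set E := C * (x ^ (1 - δ) / q) with hE
  have hE0 : 0 ≤ E := by positivity
  set i₀ := ⌈x ^ ε⌉₊ with hi₀
  set n := ⌈x ^ (2 * ε)⌉₊ with hn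
  have hxε : 1 ≤ x ^ ε := Real.one_le_rpow hx1 hε0.le
  have hi₀pos : 0 < i₀ := Nat.ceil_pos.2 (by linarith)
  have hi₀le : (i₀ : ℝ) ≤ 2 * x ^ ε := natCeil_le_two_mul hxε
  have hi₀ge : x ^ ε ≤ i₀ := Nat.le_ceil _
  have hnle : (n : ℝ) ≤ 2 * x ^ (2 * ε) := natCeil_le_two_mul (Real.one_le_rpow hx1 (by positivity))
  have hnge : x ^ (2 * ε) ≤ n := Nat.le_ceil _
  have hmin : min ((i₀ + n) ^ (B + 1)) (Y + 1) = Y + 1 := by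
    apply min_eq_right
    have h1 : (Y : ℝ) ≤ ((n ^ (B + 1) : ℕ) : ℝ) := by
      push_cast
      have h2 := pow_le_pow_left₀ (by positivity) hnge (B + 1)
      rw [← Real.rpow_natCast (x ^ (2 * ε)), ← Real.rpow_mul hx0.le] at h2
      have e : 2 * ε * ((B + 1 : ℕ) : ℝ) = 1 / 2 := by push_cast; rw [← hA]; linarith
      rw [e] at h2
      exact hYx.trans h2
    have h2 : n ^ (B + 1) < (i₀ + n) ^ (B + 1) := Nat.pow_lt_pow_left (by omega) (by omega)
    have h3 : Y ≤ n ^ (B + 1) := by exact_mod_cast h1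
    omega
  have t1 : (i₀ : ℝ) ^ (B + 1) ≤ 2 ^ (B + 1) * (R / q) := by
    have h1 := pow_le_pow_left₀ (by positivity) hi₀le (B + 1)
    rw [mul_pow, ← Real.rpow_natCast (x ^ ε), ← Real.rpow_mul hx0.le] at h1
    have e : ε * ((B + 1 : ℕ) : ℝ) = 1 / 4 := by push_cast; exact hεA
    rw [e] at h1
    refine h1.trans (mul_le_mul_of_nonneg_left ?_ (by positivity))
    rw [le_div_iff₀ hq0]
    calc x ^ (1 / 4 : ℝ) * q ≤ x ^ (1 / 4 : ℝ) * x ^ (5 / 7 : ℝ) := by gcongr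
      _ = x ^ (1 / 4 + 5 / 7 : ℝ) := (Real.rpow_add hx0 _ _).symm
      _ ≤ R := hRle _ (by linarith)
  have t2 : n * E ≤ 2 * C * (R / q) := by
    have h1 : x ^ (2 * ε) * x ^ (1 - δ) ≤ R := by
      rw [← Real.rpow_add hx0]; exact hRle _ (by linarith)
    calc n * E ≤ 2 * x ^ (2 * ε) * E := by gcongr
      _ = 2 * C * ((x ^ (2 * ε) * x ^ (1 - δ)) / q) := by rw [hE]; ring
      _ ≤ _ := by gcongr
  have t2' : E ≤ C * (R / q) := by
    have := hRle (1 - δ) (by linarith)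
    rw [hE]; gcongr
  have t3 : (Y : ℝ) * (p / q) ≤ R / q := by
    rw [← mul_div_assoc]
    apply div_le_div_of_nonneg_right _ hq0.le
    calc (Y : ℝ) * p ≤ x ^ (1 / 2 : ℝ) * x ^ (1 / 7 : ℝ) := by gcongr
      _ = x ^ (1 / 2 + 1 / 7 : ℝ) := (Real.rpow_add hx0 _ _).symm
      _ ≤ R := hRle _ (by linarith)
  have t4 : ((X : ℝ) * (A ^ 2 * 4 ^ B) * (2 / i₀) + Y) / q ≤ (2 * (A ^ 2 * 4 ^ B) + 1) * (R / q) := by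
    rw [← mul_div_assoc (2 * (A ^ 2 * 4 ^ B) + 1)]
    apply div_le_div_of_nonneg_right _ hq0.le
    have h1 : (X : ℝ) / i₀ ≤ R := by
      rw [div_le_iff₀ (by positivity)]
      calc (X : ℝ) ≤ x := hXx
        _ = R * x ^ ε := by rw [hR, ← Real.rpow_add hx0, sub_add_cancel, Real.rpow_one]
        _ ≤ _ := by gcongr
    have h2 : (Y : ℝ) ≤ R := hYx.trans (hRle _ (by linarith))
    have h3 := mul_le_mul_of_nonneg_left h1 (show 0 ≤ 2 * (A ^ 2 * 4 ^ B) by positivity)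
    calc _ = 2 * (A ^ 2 * 4 ^ B) * ((X : ℝ) / i₀) + Y := by ring
      _ ≤ _ := by linarith
  refine ⟨2 * hyperbolaMain p k (B + 1) X Y i₀ n - coprimeCount p 1 (Y + 1) * Y / q, ?_⟩
  intro a ha
  have hbox : ∀ m₁ m₂ N, m₂ - m₁ ≤ Y →
      |boxError p k a m₁ m₂ 1 (N + 1)| ≤ E + ((m₂ - m₁ : ℕ) : ℝ) * (p / q) := by
    intro m₁ m₂ N hm
    rw [← mul_div_assoc]
    apply H p hp2 a ha x hx m₁ m₂ 1 (N + 1) (by omega)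
    have : ((m₂ - m₁ : ℕ) : ℝ) ≤ Y := by exact_mod_cast hm
    exact this.trans (sqrt_floor_le_sqrt hx0.le)
  have u1 := abs_hyperbolaCount_sub_main_le (by omega) ha (B + 1) X Y hi₀pos hbox n
  rw [hmin, ← Finset.sum_div] at u1
  have u2 : ((Y + 1 - min (i₀ ^ (B + 1)) (Y + 1) : ℕ) : ℝ) * (p / q) ≤ Y * (p / q) := by
    have hpos : 0 < i₀ ^ (B + 1) := pow_pos hi₀pos _
    have : ((Y + 1 - min (i₀ ^ (B + 1)) (Y + 1) : ℕ) : ℝ) ≤ Y := by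
      exact_mod_cast (by omega : Y + 1 - min (i₀ ^ (B + 1)) (Y + 1) ≤ Y)
    gcongr
  have u3 := div_le_div_of_nonneg_right (sum_pow_gap_le B X Y hi₀pos n) hq0.le
  have u4 := hbox 1 (Y + 1) Y (by omega)
  have u5 := boxCount_eq (p := p) k a 1 (Y + 1) Y
  rw [Nat.add_sub_cancel] at u4
  rw [residueDivisorSum_eq, u5]
  have hfin : ∀ h m b w : ℝ, |2 * h - (w + b) - (2 * m - w)| ≤ 2 * |h - m| + |b| := by
    intro h m b w
    have : 2 * h - (w + b) - (2 * m - w) = 2 * (h - m) - b := by ring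
    rw [this]
    refine (abs_sub _ _).trans ?_
    rw [abs_mul, abs_two]
  refine (hfin _ _ _ _).trans ?_
  rw [add_mul, mul_assoc 2]
  linarith

theorem sum_units_residueDivisorSum {M : ℕ} [NeZero M] (X : ℕ) :
    ∑ u : (ZMod M)ˣ, residueDivisorSum M ((u : ZMod M).val : ℤ) X =
      ∑ n ∈ (Finset.Icc 1 X).filter (fun n : ℕ => Nat.Coprime n M), (n.divisors.card : ℝ) := by
  unfold residueDivisorSum
  rw [Finset.sum_comm, Finset.sum_filter]
  apply Finset.sum_congr rfl
  intro n _
  rw [← Finset.sum_mul]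
  have hval : ∀ u : (ZMod M)ˣ, ((((u : ZMod M).val : ℕ) : ℤ) : ZMod M) = u := by
    intro u; rw [Int.cast_natCast, ZMod.natCast_zmod_val]
  simp_rw [hval]
  split_ifs with h
  · rw [Finset.sum_eq_single (ZMod.unitOfCoprime n h)]
    · simp
    · intro u _ hu
      rw [if_neg]
      intro h2
      exact hu (Units.ext (by rw [ZMod.coe_unitOfCoprime]; exact h2.symm))
    · simp
  · rw [Finset.sum_eq_zero, zero_mul]
    intro u _
    rw [if_neg]
    intro h2
    exact h ((ZMod.isUnit_iff_coprime n M).1 (h2 ▸ u.isUnit))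

theorem theorem1 (k : ℕ) (hk : 7 ≤ k) :
    ∃ η δ C : ℝ, 0 < η ∧ 0 < δ ∧ 0 < C ∧
      ∀ p : ℕ, p.Prime → Odd p →
      ∀ q : ℕ, q = p ^ k →
      ∀ a : ℤ, IsCoprime a (q : ℤ) →
      ∀ x : ℝ, (q : ℝ) ^ ((3 : ℝ) / 2 - η) < x →
        |(∑ n ∈ (Finset.Icc 1 ⌊x⌋₊).filter (fun n : ℕ => (n : ℤ) ≡ a [ZMOD (q : ℤ)]),
              (n.divisors.card : ℝ)) -
            1 / (Nat.totient q : ℝ) *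
              ∑ n ∈ (Finset.Icc 1 ⌊x⌋₊).filter (fun n : ℕ => Nat.Coprime n q),
                (n.divisors.card : ℝ)| ≤
          C * (x ^ (1 - δ) / (q : ℝ)) := by
  obtain ⟨η, δ, C, hη, hδ, hC, H⟩ := exists_abs_residueDivisorSum_sub_le k hk
  refine ⟨η, δ, 2 * C, hη, hδ, by positivity, ?_⟩
  rintro p hp hodd q rfl a ha x hx
  have : Fact p.Prime := ⟨hp⟩
  have : NeZero (p ^ k) := ⟨(pow_pos hp.pos k).ne'⟩
  have hp2 : p ≠ 2 := by rintro rfl; exact absurd hodd (by decide)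
  have hcast : ((p ^ k : ℕ) : ℝ) = (p : ℝ) ^ k := Nat.cast_pow p k
  rw [hcast] at hx ⊢
  rw [Nat.cast_pow] at ha
  obtain ⟨M, hM⟩ := H p hp2 x hx
  set ρ := C * (x ^ (1 - δ) / (p : ℝ) ^ k) with hρ
  have hleft : (∑ n ∈ (Finset.Icc 1 ⌊x⌋₊).filter (fun n : ℕ => (n : ℤ) ≡ a [ZMOD ((p ^ k : ℕ) : ℤ)]),
      (n.divisors.card : ℝ)) = residueDivisorSum (p ^ k) a ⌊x⌋₊ := by
    unfold residueDivisorSum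
    rw [Finset.sum_filter]
    apply Finset.sum_congr rfl
    intro n _
    have : (n : ℤ) ≡ a [ZMOD ((p ^ k : ℕ) : ℤ)] ↔ (n : ZMod (p ^ k)) = (a : ZMod (p ^ k)) := by
      rw [← ZMod.intCast_eq_intCast_iff, Int.cast_natCast]
    simp only [this]
    split_ifs <;> simp
  rw [hleft, ← sum_units_residueDivisorSum]
  have hφ : 0 < (Nat.totient (p ^ k) : ℝ) := by
    exact_mod_cast Nat.totient_pos.2 (pow_pos hp.pos k)
  have hcard : ∑ _u : (ZMod (p ^ k))ˣ, (1 : ℝ) = Nat.totient (p ^ k) := by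
    rw [Finset.sum_const, Finset.card_univ, ZMod.card_units_eq_totient, nsmul_eq_mul, mul_one]
  have hu : ∀ u : (ZMod (p ^ k))ˣ,
      |residueDivisorSum (p ^ k) ((u : ZMod (p ^ k)).val : ℤ) ⌊x⌋₊ - M| ≤ ρ := by
    intro u
    apply hM
    rw [Nat.isCoprime_iff_coprime]
    exact Nat.Coprime.coprime_dvd_right (dvd_pow_self p (by omega)) (ZMod.val_coe_unit_coprime u)
  -- M is within ρ of the divisor sum in every reduced class, hence within ρ of their mean. The
  -- triangle inequality through M doubles the constant.
  have havg : |M - 1 / (Nat.totient (p ^ k) : ℝ) *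
      ∑ u : (ZMod (p ^ k))ˣ, residueDivisorSum (p ^ k) ((u : ZMod (p ^ k)).val : ℤ) ⌊x⌋₊| ≤ ρ := by
    have e : M - 1 / (Nat.totient (p ^ k) : ℝ) *
        ∑ u : (ZMod (p ^ k))ˣ, residueDivisorSum (p ^ k) ((u : ZMod (p ^ k)).val : ℤ) ⌊x⌋₊ =
        -(1 / (Nat.totient (p ^ k) : ℝ) *
        ∑ u : (ZMod (p ^ k))ˣ, (residueDivisorSum (p ^ k) ((u : ZMod (p ^ k)).val : ℤ) ⌊x⌋₊ - M)) := by
      have : ∑ _u : (ZMod (p ^ k))ˣ, M = Nat.totient (p ^ k) * M := by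
        rw [← hcard, Finset.sum_mul]; simp
      rw [Finset.sum_sub_distrib, this]
      field_simp
      ring
    rw [e, abs_neg, abs_mul, abs_of_pos (by positivity), one_div, inv_mul_le_iff₀ hφ, ← hcard, Finset.sum_mul]
    refine (Finset.abs_sum_le_sum_abs _ _).trans (Finset.sum_le_sum fun u _ => ?_)
    rw [one_mul]; exact hu u
  have ha' : IsCoprime a (p : ℤ) := ha.of_isCoprime_of_dvd_right (dvd_pow_self _ (by omega))
  refine (abs_sub_le _ M _).trans ?_
  have := hM a ha'
  linarith
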